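/- Let $V$ be a finite-dimensional complex vector space with a non-degenerate bilinear form $B$ that is symmetric ($\varepsilon=1$) or anti-symmetric ($\varepsilon=-1$); let $G=\mathrm{O}(V)$, resp. $\mathrm{Sp}(V)$, be its isometry group, and $\mathfrak g$ the Lie algebra of $G$. Generalized quivers. A $G$-generalized quiver $\tilde Q$ consists of a Zariski closed abelian reductive subgroup $H\subseteq G$, its centralizer $R$ in $G$, and a finite-dimensional representation $\mathrm{Rep}(\tilde Q)=\bigoplus_{\alpha\in A} Z_\alpha$ of $R$ ($A$ finite). For characters $\chi,\mu$ of $H$, with isotypic components $V_\chi, V_\mu\subseteq V$, put $\mathfrak g_{\chi\mu}=\mathfrak g\cap\big(\mathrm{Hom}(V_\chi,V_\mu)+\mathrm{Hom}(V_{\mu^{-1}},V_{\chi^{-1}})\big)$. Each $Z_\alpha$ is required to be a non-trivial $R$-module which is either (a) irreducible and isomorphic to an $\mathrm{Ad}\,R$-submodule of $\mathfrak g$, or (b) isomorphic to some $\mathfrak g_{\chi\mu}$. (Case (b) only adds to (a) the modules $E_\chi=\mathfrak g_{\chi\chi}\cong\mathrm{End}(V_\chi)$ with $\chi\ne\chi^{-1}$.)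 Associated symmetric quiver. The symmetric quiver $Q$ has as vertices the characters $\chi$ of $H$ with $V_\chi\neq0$, with involution $\sigma(\chi)=\chi^{-1}$, and for each $\alpha\in A$ an arrow $(\alpha,\chi,\mu):\chi\to\mu$ whenever $Z_\alpha$ embeds $R$-equivariantly in $\mathfrak g_{\chi\mu}$, with $\sigma(\alpha,\chi,\mu)=(\alpha,\mu^{-1},\chi^{-1})$. Let $X$ be a complex manifold and let $\mathbb M_\alpha$ ($\alpha\in A$) be holomorphic vector bundles on $X$ with fibre spaces $M_\alpha$ and product of frame bundles $F$, a principal $\prod_\alpha\mathrm{GL}(M_\alpha)$-bundle. Bundles. A twisted $\tilde Q$-bundle is a pair $(E,\varphi)$ of a holomorphic principal $R$-bundle $E$ on $X$ and a holomorphic section $\varphi$ of $(E\times_X F)\times_\rho\bigoplus_\alpha\mathrm{Hom}(M_\alpha,Z_\alpha)$. A twisted orthogonal bundle representation of $Q$ (symplectic if $\varepsilon=-1$) consists of holomorphic vector bundles $\mathbb V_\chi$ with $\mathrm{rk}\,\mathbb V_\chi=\dim V_\chi$, a holomorphic non-degenerate $\varepsilon$-symmetric form $g$ on $\bigoplus_\chi\mathbb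 V_\chi$ that vanishes on $\mathbb V_\chi\times\mathbb V_\mu$ for $\mu\ne\chi^{-1}$, and holomorphic maps $\psi_a:\mathbb V_{t(a)}\otimes\mathbb M_\alpha\to\mathbb V_{h(a)}$ for every arrow $a=(\alpha,\chi,\mu)$, such that $$g(\psi_a(v\otimes m),w)+g(v,\psi_{\sigma(a)}(w\otimes m))=0$$ for all $v\in\mathbb V_{t(a)}$, $w\in\mathbb V_{t(\sigma(a))}$, $m\in\mathbb M_\alpha$ over the same point. We call it admissible if, for each loop $a$ ($t(a)=h(a)$) whose $Z_\alpha$ is irreducible, the endomorphisms $\psi_a(\cdot\otimes m)$ are traceless. (This is automatic for loops at vertices with $\chi=\chi^{-1}$; it is a condition only where $Z_\alpha\cong\mathfrak{sl}(V_\chi)$, $\chi\neq\chi^{-1}$. If every $Z_\alpha$ embedding in some $E_\chi$ with $\chi\neq\chi^{-1}$ is the full $E_\chi$, every representation is admissible.) Statement. There are linear maps $f_a:Z_\alpha\to\mathrm{Hom}(V_{t(a)},V_{h(a)})$, for the arrows $a=(\alpha,\chi,\mu)$, which induce an $R$-equivariant linear bijection $f$ from $\mathrm{Rep}(\tilde Q)$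 to the space of admissible orthogonal (symplectic) representations of $Q$ on $(V=\bigoplus_\chi V_\chi,B)$, and such that for all $X$ and $\mathbb M_\alpha$ as above: 1. For every holomorphic principal $R$-bundle $E$ there is $(\mathbb V,g)$ as above with an isometric holomorphic isomorphism $u:E\times_R V\cong\mathbb V$ preserving the decompositions indexed by the characters $\chi$; and for every $(\mathbb V,g)$ there are such $E$ and $u$. 2. Given two such triples $(E,(\mathbb V,g),u)$ and $(E',(\mathbb V',g'),u')$, the isomorphisms $E\to E'$ correspond bijectively, compatibly with $u,u'$, to the isometric isomorphisms $(\mathbb V,g)\to(\mathbb V',g')$. Applying $f$ fibrewise gives bijections between the sections $\varphi$ on $E$ and the admissible families $\psi$ on $(\mathbb V,g)$, and likewise for $E'$ and $(\mathbb V',g')$. These bijections are equivariant: an isomorphism $E\to E'$ carries $\varphi$ to $\varphi'$ if and only if the corresponding isomorphism $(\mathbb V,g)\to(\mathbb V',g')$ carries $\psi$ to $\psi'$. In particular, for $E=E'$, they are equivariant for the gauge group. 3. Consequently, there is a bijection between the isomorphism classes of twisted $\tilde Q$-bundles and those of admissible twisted orthogonal (symplectic) bundle representations of $Q$, given by this correspondence.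 -/

import Mathlib

open scoped Manifold ContDiff
open Bundle

noncomputable section

/-! ## Symmetric quivers and their orthogonal representations -/

universe u v w

/-- A symmetric quiver: a quiver with an involution `σ` on vertices and arrows which exchanges
tails and heads, and fixes every arrow `a` with `t(a) = σ(h(a))`. -/
structure SymmetricQuiver where
  Vertex : Type u
  Arrow : Type v
  tail : Arrow → Vertex
  head : Arrow → Vertex
  σV : Vertex → Vertex
  σA : Arrow → Arrow
  σV_σV : ∀ i, σV (σV i) = i
  σA_σA : ∀ a, σA (σA a) = a
  tail_σA : ∀ a, tail (σA a) = σV (head a)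
  head_σA : ∀ a, head (σA a) = σV (tail a)
  σA_of_tail_eq : ∀ a, tail a = σV (head a) → σA a = a

namespace SymmetricQuiver

variable (S : SymmetricQuiver.{u, v}) {W : S.Vertex → Type w}
  [∀ i, AddCommGroup (W i)] [∀ i, Module ℂ (W i)]

/-- `C` is the family of components `W i × W j → ℂ` of a non-degenerate form on the total space
`⨁ i, W i` which is symmetric (`ε = 1`) or anti-symmetric (`ε = -1`) and vanishes on `W i × W j`
unless `j = σ i`. -/
structure IsOrthogonalForm (ε : ℂ) (C : ∀ i j, W i →ₗ[ℂ] W j →ₗ[ℂ] ℂ) : Prop where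
  symm : ∀ i j x y, C i j x y = ε * C j i y x
  eq_zero : ∀ i j, j ≠ S.σV i → C i j = 0
  nondegenerate : ∀ i x, (∀ y, C i (S.σV i) x y = 0) → x = 0

/-- A representation `ψ` of the arrows is orthogonal (symplectic) for the form `C`:
`C(ψ_a x, y) + C(x, ψ_{σ a} y) = 0`. -/
def IsOrthogonalRep (C : ∀ i j, W i →ₗ[ℂ] W j →ₗ[ℂ] ℂ)
    (ψ : ∀ a, W (S.tail a) →ₗ[ℂ] W (S.head a)) : Prop :=
  ∀ a (x : W (S.tail a)) (y : W (S.tail (S.σA a))),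
    C (S.head a) (S.tail (S.σA a)) (ψ a x) y + C (S.tail a) (S.head (S.σA a)) x (ψ (S.σA a) y) = 0

/-- All the maps `ψ a` with `a ∈ L` a loop (`t(a) = h(a)`) are traceless. -/
def IsTracelessOn (L : Set S.Arrow) (ψ : ∀ a, W (S.tail a) →ₗ[ℂ] W (S.head a)) : Prop :=
  ∀ a ∈ L, ∀ e : S.head a = S.tail a,
    LinearMap.trace ℂ (W (S.tail a)) ((LinearEquiv.cast (R := ℂ) (M := W) e).toLinearMap ∘ₗ ψ a) = 0

end SymmetricQuiver

/-! ## Generalized quivers for orthogonal and symplectic groups -/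

section GeneralizedQuivers

variable {V : Type u} [NormedAddCommGroup V] [NormedSpace ℂ V]

/-- The isometry group of a bilinear form: `O(V)` for a non-degenerate symmetric form, `Sp(V)`
for a non-degenerate anti-symmetric form. -/
def isometryGroup (B : LinearMap.BilinForm ℂ V) : Subgroup (V ≃ₗ[ℂ] V) where
  carrier := {g | ∀ x y, B (g x) (g y) = B x y}
  mul_mem' := by
    intro a b ha hb x y
    simp only [LinearEquiv.mul_apply]
    rw [ha, hb]
  one_mem' := by intro x y; rfl
  inv_mem' := by
    intro a ha x y
    have h := ha (a⁻¹ x) (a⁻¹ y)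
    rw [← LinearEquiv.mul_apply, ← LinearEquiv.mul_apply, mul_inv_cancel] at h
    exact h.symm

/-- `H` is a Zariski closed subgroup of `GL(V)`: the zero set in `GL(V)` of a set of polynomial
functions on `End(V)`. -/
def IsZariskiClosed (H : Subgroup (V ≃ₗ[ℂ] V)) : Prop :=
  ∃ P : Set (MvPolynomial (Module.Dual ℂ (Module.End ℂ V)) ℂ), ∀ g : V ≃ₗ[ℂ] V,
    g ∈ H ↔ ∀ p ∈ P, MvPolynomial.eval (fun l => l (g : Module.End ℂ V)) p = 0

/-- Reductivity of a closed subgroup `H` of `GL(V)` in characteristic zero, as complete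
reducibility: every `H`-stable subspace of `V` has an `H`-stable complement. -/
def IsReductiveIn (H : Subgroup (V ≃ₗ[ℂ] V)) : Prop :=
  ∀ U : Submodule ℂ V, (∀ g ∈ H, ∀ x ∈ U, g x ∈ U) →
    ∃ U' : Submodule ℂ V, (∀ g ∈ H, ∀ x ∈ U', g x ∈ U') ∧ IsCompl U U'

/-- The centralizer of `H` in the isometry group of `B`. -/
def centralizerIn (B : LinearMap.BilinForm ℂ V) (H : Subgroup (V ≃ₗ[ℂ] V)) :
    Subgroup (V ≃ₗ[ℂ] V) :=
  isometryGroup B ⊓ Subgroup.centralizer (H : Set (V ≃ₗ[ℂ] V))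

/-- The action of a linear group on `V`. -/
def stdRep (R : Subgroup (V ≃ₗ[ℂ] V)) : Representation ℂ R V where
  toFun r := ((r : V ≃ₗ[ℂ] V) : Module.End ℂ V)
  map_one' := rfl
  map_mul' _ _ := rfl

/-- The conjugation action `r • X = r X r⁻¹` of a linear group on `End(V)`; restricted to the Lie
algebra of the isometry group it is the adjoint representation. -/
def adRep (R : Subgroup (V ≃ₗ[ℂ] V)) : Representation ℂ R (V →ₗ[ℂ] V) :=
  Representation.linHom (stdRep R) (stdRep R)

/-- The Lie algebra `𝔬(V)` or `𝔰𝔭(V)` of the isometry group: the endomorphisms `X` with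
`B(X x, y) + B(x, X y) = 0`. -/
def isometryLie (B : LinearMap.BilinForm ℂ V) : Submodule ℂ (V →ₗ[ℂ] V) :=
  B.skewAdjointSubmodule

/-- The isotypic component of a character `χ` of `H` in `V`. -/
def weightSpace {H : Subgroup (V ≃ₗ[ℂ] V)} (χ : H →* ℂˣ) : Submodule ℂ V where
  carrier := {x | ∀ h : H, (h : V ≃ₗ[ℂ] V) x = (χ h : ℂ) • x}
  add_mem' := by intro x y hx hy h; rw [map_add, hx, hy, smul_add]
  zero_mem' := by intro h; simp
  smul_mem' := by intro c x hx h; rw [map_smul, hx, smul_comm]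

/-- The subspace `Hom(V_χ, V_μ)` of `End(V)`: maps which send `V_χ` to `V_μ` and vanish on all
other isotypic components. -/
def homPiece {H : Subgroup (V ≃ₗ[ℂ] V)} (χ μ : H →* ℂˣ) : Submodule ℂ (V →ₗ[ℂ] V) where
  carrier := {X | (∀ x ∈ weightSpace χ, X x ∈ weightSpace μ) ∧
    ∀ ν : H →* ℂˣ, ν ≠ χ → ∀ x ∈ weightSpace ν, X x = 0}
  add_mem' := by
    rintro X Y ⟨hX, hX'⟩ ⟨hY, hY'⟩
    refine ⟨fun x hx => add_mem (hX x hx) (hY x hx), fun ν hν x hx => ?_⟩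
    simp [hX' ν hν x hx, hY' ν hν x hx]
  zero_mem' := ⟨fun _ _ => zero_mem _, fun _ _ _ _ => rfl⟩
  smul_mem' := by
    rintro c X ⟨hX, hX'⟩
    refine ⟨fun x hx => Submodule.smul_mem _ _ (hX x hx), fun ν hν x hx => ?_⟩
    simp [hX' ν hν x hx]

/-- The piece of the Lie algebra `𝔤` in `Hom(V_χ, V_μ) + Hom(V_{μ⁻¹}, V_{χ⁻¹})`. These are the
pieces `Λ²(V_i)`, `Λ²(V_i*)`, `Λ²(W_i)` (`S²` in the symplectic case), `E_i ≅ End(V_i)`,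
`Hom(V_i, V_j)`, … of the adjoint representation restricted to the centralizer of `H`. -/
def liePiece (B : LinearMap.BilinForm ℂ V) {H : Subgroup (V ≃ₗ[ℂ] V)} (χ μ : H →* ℂˣ) :
    Submodule ℂ (V →ₗ[ℂ] V) :=
  isometryLie B ⊓ (homPiece χ μ ⊔ homPiece μ⁻¹ χ⁻¹)

/-- A generalized quiver (with dimension vector) for the isometry group `G` of `B`, together with
a decomposition `Rep = ⨁ α, Z α` of its representation space.

Every `Z α` is non-trivial, and it is either an irreducible factor of the adjoint representation
of the centralizer `R` of `H` on `𝔤`, or (second alternative) one of the pieces `liePiece χ μ`.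
The second alternative only adds the spaces `E_χ ≅ End(V_χ)`, `χ ≠ χ⁻¹`, which are the sum of an
irreducible and a one-dimensional trivial representation; all other pieces are irreducible.
The norm on `Z α` is auxiliary: it only says what holomorphic maps to `Z α` are. -/
structure GeneralizedQuiver (B : LinearMap.BilinForm ℂ V) where
  H : Subgroup (V ≃ₗ[ℂ] V)
  H_le : H ≤ isometryGroup B
  H_closed : IsZariskiClosed H
  H_comm : ∀ g ∈ H, ∀ h ∈ H, g * h = h * g
  H_reductive : IsReductiveIn H
  A : Type v
  finite_A : Finite A
  Z : A → Type w
  [normedZ : ∀ α, NormedAddCommGroup (Z α)]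
  [spaceZ : ∀ α, NormedSpace ℂ (Z α)]
  [finiteZ : ∀ α, FiniteDimensional ℂ (Z α)]
  ρ : ∀ α, Representation ℂ (centralizerIn B H) (Z α)
  nontrivial : ∀ α, ∃ r z, ρ α r z ≠ z
  factor : ∀ α,
    ((ρ α).IsIrreducible ∧ ∃ e : (ρ α).IntertwiningMap (adRep (centralizerIn B H)),
      Function.Injective e ∧ ∀ z, e z ∈ isometryLie B) ∨
    ∃ χ μ : H →* ℂˣ, ∃ e : (ρ α).IntertwiningMap (adRep (centralizerIn B H)),
      Function.Injective e ∧ Set.range e = (liePiece B χ μ : Set (V →ₗ[ℂ] V))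

attribute [instance] GeneralizedQuiver.normedZ GeneralizedQuiver.spaceZ GeneralizedQuiver.finiteZ

theorem character_inv_inv {H : Subgroup (V ≃ₗ[ℂ] V)} (χ : H →* ℂˣ) : χ⁻¹⁻¹ = χ := by
  ext h
  simp

theorem weightSpace_inv_ne_bot {B : LinearMap.BilinForm ℂ V} (hB : B.Nondegenerate)
    {H : Subgroup (V ≃ₗ[ℂ] V)} (hH : H ≤ isometryGroup B) (hr : IsReductiveIn H)
    (χ : H →* ℂˣ) (hχ : weightSpace χ ≠ ⊥) : weightSpace χ⁻¹ ≠ ⊥ := by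
  obtain ⟨x, hx, hx0⟩ := (Submodule.ne_bot_iff _).1 hχ
  have key : ∀ (h : H) y, B x ((h : V ≃ₗ[ℂ] V) y) = (χ⁻¹ h : ℂ) * B x y := by
    intro h y
    have h1 := hH h.2 x y
    rw [hx h, map_smul, LinearMap.smul_apply, smul_eq_mul] at h1
    rw [← h1, ← mul_assoc]
    simp
  obtain ⟨U', hU', hc⟩ := hr (LinearMap.ker (B x)) (by
    intro g hg y hy
    rw [LinearMap.mem_ker] at hy ⊢
    rw [key ⟨g, hg⟩ y, hy, mul_zero])
  have hne : ∃ y ∈ U', B x y ≠ 0 := by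
    by_contra! hcon
    have hle : U' ≤ LinearMap.ker (B x) := fun y hy => LinearMap.mem_ker.2 (hcon y hy)
    have htop : LinearMap.ker (B x) = ⊤ := by
      have := hc.sup_eq_top
      rwa [sup_eq_left.2 hle] at this
    exact hx0 (hB.1 x fun y => by
      have : y ∈ LinearMap.ker (B x) := htop ▸ Submodule.mem_top
      exact this)
  obtain ⟨y, hy, hxy⟩ := hne
  refine (Submodule.ne_bot_iff _).2 ⟨y, fun h => ?_, fun h0 => hxy (by rw [h0, map_zero])⟩
  have h1 : (h : V ≃ₗ[ℂ] V) y - (χ⁻¹ h : ℂ) • y ∈ U' :=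
    sub_mem (hU' _ h.2 y hy) (Submodule.smul_mem _ _ hy)
  have h2 : (h : V ≃ₗ[ℂ] V) y - (χ⁻¹ h : ℂ) • y ∈ LinearMap.ker (B x) := by
    rw [LinearMap.mem_ker, map_sub, key, map_smul, smul_eq_mul, sub_self]
  exact sub_eq_zero.1 ((Submodule.disjoint_def.1 hc.disjoint) _ h2 h1)

namespace GeneralizedQuiver

variable {B : LinearMap.BilinForm ℂ V} (Q : GeneralizedQuiver.{u, v, w} B)

/-- The group `R` of a generalized quiver: the centralizer of `H` in the isometry group. -/
abbrev R : Subgroup (V ≃ₗ[ℂ] V) := centralizerIn B Q.H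

/-- `Z α` embeds `R`-equivariantly in the piece `liePiece χ μ` of the Lie algebra. -/
def EmbedsInPiece (α : Q.A) (χ μ : Q.H →* ℂˣ) : Prop :=
  ∃ e : (Q.ρ α).IntertwiningMap (adRep Q.R), Function.Injective e ∧ ∀ z, e z ∈ liePiece B χ μ

theorem EmbedsInPiece.dual {α : Q.A} {χ μ : Q.H →* ℂˣ} (h : Q.EmbedsInPiece α χ μ) :
    Q.EmbedsInPiece α μ⁻¹ χ⁻¹ := by
  obtain ⟨e, he, hz⟩ := h
  refine ⟨e, he, fun z => ?_⟩
  have := hz z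
  unfold liePiece at this ⊢
  rwa [character_inv_inv, character_inv_inv, sup_comm]

/-- The vertices of the associated quiver: the characters of `H` occurring in `V`. -/
abbrev Weight : Type u := {χ : Q.H →* ℂˣ // weightSpace χ ≠ ⊥}

/-- The symmetric quiver associated to a generalized quiver. Its vertices are the characters of
`H` occurring in `V`, with involution `χ ↦ χ⁻¹`. For every summand `Z α` there is an arrow
`χ → μ` whenever `Z α` embeds in the piece of `𝔤` in `Hom(V_χ, V_μ) + Hom(V_{μ⁻¹}, V_{χ⁻¹})`;
the involution sends it to the arrow `μ⁻¹ → χ⁻¹` with the same label `α`. -/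
def symmetricQuiver (hB : B.Nondegenerate) : SymmetricQuiver.{u, max u v} where
  Vertex := Q.Weight
  Arrow := {a : Q.A × Q.Weight × Q.Weight // Q.EmbedsInPiece a.1 a.2.1.1 a.2.2.1}
  tail a := a.1.2.1
  head a := a.1.2.2
  σV χ := ⟨χ.1⁻¹, weightSpace_inv_ne_bot hB Q.H_le Q.H_reductive χ.1 χ.2⟩
  σA a := ⟨(a.1.1,
      ⟨a.1.2.2.1⁻¹, weightSpace_inv_ne_bot hB Q.H_le Q.H_reductive _ a.1.2.2.2⟩,
      ⟨a.1.2.1.1⁻¹, weightSpace_inv_ne_bot hB Q.H_le Q.H_reductive _ a.1.2.1.2⟩),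
    EmbedsInPiece.dual Q a.2⟩
  σV_σV i := Subtype.ext (character_inv_inv _)
  σA_σA a := by
    obtain ⟨⟨α, ⟨χ, hχ⟩, ⟨μ, hμ⟩⟩, h⟩ := a
    simp only [character_inv_inv]
  tail_σA _ := rfl
  head_σA _ := rfl
  σA_of_tail_eq a h := by
    obtain ⟨⟨α, ⟨χ, hχ⟩, ⟨μ, hμ⟩⟩, h'⟩ := a
    simp only [Subtype.mk.injEq] at h
    subst h
    simp only [character_inv_inv]

/-- The label of an arrow of the associated symmetric quiver, i.e. its orbit under `σ`. -/
def label (hB : B.Nondegenerate) (a : (Q.symmetricQuiver hB).Arrow) : Q.A := a.1.1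

theorem label_σA (hB : B.Nondegenerate) (a : (Q.symmetricQuiver hB).Arrow) :
    Q.label hB ((Q.symmetricQuiver hB).σA a) = Q.label hB a := rfl

/-- The space at a vertex: the isotypic component of the character. -/
abbrev space (χ : Q.Weight) : Type u := weightSpace χ.1

/-- The components of the form `B` on the isotypic components. -/
def form (χ μ : Q.Weight) : Q.space χ →ₗ[ℂ] Q.space μ →ₗ[ℂ] ℂ :=
  B.domRestrict₁₂ (weightSpace χ.1) (weightSpace μ.1)

/-- The arrows whose label `α` has `Z α` irreducible. -/
def irreducibleArrows (hB : B.Nondegenerate) : Set (Q.symmetricQuiver hB).Arrow :=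
  {a | (Q.ρ (Q.label hB a)).IsIrreducible}

theorem act_mem (r : Q.R) (χ : Q.Weight) (x : V) (hx : x ∈ weightSpace χ.1) :
    (r : V ≃ₗ[ℂ] V) x ∈ weightSpace χ.1 := by
  intro h
  have hc := (Subgroup.mem_centralizer_iff.1 r.2.2) h h.2
  rw [← LinearEquiv.mul_apply, hc, LinearEquiv.mul_apply, hx h, map_smul]

/-- The action of `R` on the isotypic component `V_χ`. -/
def act (r : Q.R) (χ : Q.Weight) : Q.space χ →ₗ[ℂ] Q.space χ :=
  ((r : V ≃ₗ[ℂ] V) : V →ₗ[ℂ] V).restrict (Q.act_mem r χ)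

end GeneralizedQuiver

end GeneralizedQuivers

/-! ## Holomorphic vector bundles and principal bundles -/

section Bundles

/-- A holomorphic vector bundle with fibre space `F` on the complex manifold `X` (modelled on
`EX`). -/
structure HolVectorBundle (EX : Type*) [NormedAddCommGroup EX] [NormedSpace ℂ EX]
    (X : Type*) [TopologicalSpace X] [ChartedSpace EX X]
    (F : Type*) [NormedAddCommGroup F] [NormedSpace ℂ F] where
  Fib : X → Type w
  [addCommGroup : ∀ x, AddCommGroup (Fib x)]
  [module : ∀ x, Module ℂ (Fib x)]
  [topTotal : TopologicalSpace (TotalSpace F Fib)]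
  [topFib : ∀ x, TopologicalSpace (Fib x)]
  [fiberBundle : FiberBundle F Fib]
  [vectorBundle : VectorBundle ℂ F Fib]
  [holomorphic : ContMDiffVectorBundle ω F Fib 𝓘(ℂ, EX)]

attribute [instance] HolVectorBundle.addCommGroup HolVectorBundle.module
  HolVectorBundle.topTotal HolVectorBundle.topFib HolVectorBundle.fiberBundle
  HolVectorBundle.vectorBundle HolVectorBundle.holomorphic

variable {EX : Type*} [NormedAddCommGroup EX] [NormedSpace ℂ EX]
  {X : Type v} [TopologicalSpace X] [ChartedSpace EX X]

/-- Holomorphic maps from an open subset `U` of `X` to a complex vector space. -/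
def HolOn (EX : Type*) [NormedAddCommGroup EX] [NormedSpace ℂ EX]
    {X : Type*} [TopologicalSpace X] [ChartedSpace EX X]
    {F : Type*} [NormedAddCommGroup F] [NormedSpace ℂ F] (U : Set X) (f : X → F) : Prop :=
  ContMDiffOn 𝓘(ℂ, EX) 𝓘(ℂ, F) ω f U

/-- `s` is a holomorphic section of a vector bundle over the open set `U` (its values outside of
`U` are irrelevant). -/
def HolVectorBundle.IsHolOn {F : Type*} [NormedAddCommGroup F] [NormedSpace ℂ F]
    (E : HolVectorBundle EX X F) (U : Set X) (s : ∀ x, E.Fib x) : Prop :=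
  ContMDiffOn 𝓘(ℂ, EX) (𝓘(ℂ, EX).prod 𝓘(ℂ, F)) ω (fun x => TotalSpace.mk' F x (s x)) U

variable {V : Type u} [NormedAddCommGroup V] [NormedSpace ℂ V]

/-- A holomorphic principal bundle on `X` for a complex linear group `R ⊆ GL(V)`: a family of
right `R`-torsors `Fib x`, with an atlas of local sections over open sets covering `X` whose
transition functions are holomorphic. (A pair `(U, s)` in the atlas is a section over `U`; the
values of `s` outside of `U` are irrelevant.) A map to `R ⊆ End(V)` is holomorphic if all its
compositions with evaluations at vectors of `V` are. -/
structure HolPrincipalBundle (EX : Type*) [NormedAddCommGroup EX] [NormedSpace ℂ EX]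
    (X : Type v) [TopologicalSpace X] [ChartedSpace EX X] (R : Subgroup (V ≃ₗ[ℂ] V)) where
  Fib : X → Type u
  act : ∀ x, Fib x → R → Fib x
  act_one : ∀ x p, act x p 1 = p
  act_mul : ∀ x p r r', act x p (r * r') = act x (act x p r) r'
  torsor : ∀ x p q, ∃! r, act x p r = q
  atlas : Set (Set X × (∀ x, Fib x))
  isOpen : ∀ c ∈ atlas, IsOpen c.1
  cover : ∀ x, ∃ c ∈ atlas, x ∈ c.1
  transition : ∀ c ∈ atlas, ∀ c' ∈ atlas, ∀ y : V, HolOn EX (c.1 ∩ c'.1)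
    (fun x => ((torsor x (c.2 x) (c'.2 x)).choose : V ≃ₗ[ℂ] V) y)

namespace HolPrincipalBundle

variable {R : Subgroup (V ≃ₗ[ℂ] V)}

/-- The element `r` of the structure group with `p · r = q`. -/
def div (E : HolPrincipalBundle EX X R) {x : X} (p q : E.Fib x) : R := (E.torsor x p q).choose

/-- `s` is a holomorphic section of the principal bundle over the open set `U`. -/
def IsHolOn (E : HolPrincipalBundle EX X R) (U : Set X) (s : ∀ x, E.Fib x) : Prop :=
  ∀ c ∈ E.atlas, ∀ y : V, HolOn EX (U ∩ c.1) (fun x => (E.div (c.2 x) (s x) : V ≃ₗ[ℂ] V) y)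

/-- Isomorphisms of principal bundles over the identity of `X`; these are the gauge
transformations if `E = E'`. -/
structure Iso (E E' : HolPrincipalBundle EX X R) where
  toFun : ∀ x, E.Fib x → E'.Fib x
  equivariant : ∀ x p r, toFun x (E.act x p r) = E'.act x (toFun x p) r
  hol : ∀ U s, IsOpen U → (E'.IsHolOn U (fun x => toFun x (s x)) ↔ E.IsHolOn U s)

end HolPrincipalBundle

/-! ## Orthogonal bundles for a symmetric quiver -/

/-- The vertex part of an orthogonal (`ε = 1`) or symplectic (`ε = -1`) bundle representation of
a symmetric quiver, with fibre spaces `F i`: holomorphic vector bundles `bdl i`, and a holomorphic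
form `g` on their sum which is non-degenerate, (anti-)symmetric, and pairs `bdl i` with
`bdl (σ i)` only. -/
structure OrthVertexBundle (EX : Type*) [NormedAddCommGroup EX] [NormedSpace ℂ EX]
    (X : Type v) [TopologicalSpace X] [ChartedSpace EX X] (S : SymmetricQuiver) (ε : ℂ)
    (F : S.Vertex → Type u) [∀ i, NormedAddCommGroup (F i)] [∀ i, NormedSpace ℂ (F i)] where
  bdl : ∀ i, HolVectorBundle.{u} EX X (F i)
  g : ∀ x i j, (bdl i).Fib x →ₗ[ℂ] (bdl j).Fib x →ₗ[ℂ] ℂ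
  g_form : ∀ x, S.IsOrthogonalForm ε (g x)
  g_hol : ∀ U i j s t, IsOpen U → (bdl i).IsHolOn U s → (bdl j).IsHolOn U t →
    HolOn EX U (fun x => g x i j (s x) (t x))

namespace OrthVertexBundle

variable {S : SymmetricQuiver} {ε : ℂ}
  {F : S.Vertex → Type u} [∀ i, NormedAddCommGroup (F i)] [∀ i, NormedSpace ℂ (F i)]

/-- Isometric isomorphisms, over the identity of `X`, of the vertex parts of orthogonal bundle
representations; these are the gauge transformations if `W = W'`. -/
structure Iso (W W' : OrthVertexBundle EX X S ε F) where
  toFun : ∀ x i, (W.bdl i).Fib x ≃ₗ[ℂ] (W'.bdl i).Fib x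
  isometry : ∀ x i j v w, W'.g x i j (toFun x i v) (toFun x j w) = W.g x i j v w
  hol : ∀ U i s, IsOpen U →
    ((W'.bdl i).IsHolOn U (fun x => toFun x i (s x)) ↔ (W.bdl i).IsHolOn U s)

variable {T : Type*} {MF : T → Type*} [∀ o, NormedAddCommGroup (MF o)]
  [∀ o, NormedSpace ℂ (MF o)]

/-- The arrow part of a twisted orthogonal bundle representation with vertex part `W`: holomorphic
morphisms `ψ a : W_{t(a)} ⊗ M_{τ(a)} → W_{h(a)}` such that
`g(ψ_a (v ⊗ m), w) + g(v, ψ_{σ a} (w ⊗ m)) = 0`. The twisting bundle of the arrow `a` is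
`M (τ a)`, where `τ` is constant on the orbits of `σ`. -/
structure OrthMorphisms (W : OrthVertexBundle EX X S ε F) (M : ∀ o, HolVectorBundle EX X (MF o))
    (τ : S.Arrow → T) where
  ψ : ∀ x a, (W.bdl (S.tail a)).Fib x →ₗ[ℂ] (M (τ a)).Fib x →ₗ[ℂ] (W.bdl (S.head a)).Fib x
  hol : ∀ U a s m, IsOpen U → (W.bdl (S.tail a)).IsHolOn U s → (M (τ a)).IsHolOn U m →
    (W.bdl (S.head a)).IsHolOn U (fun x => ψ x a (s x) (m x))
  orthogonal : ∀ x (m : ∀ o, (M o).Fib x),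
    S.IsOrthogonalRep (W.g x) (fun a => (ψ x a).flip (m (τ a)))

/-- The morphisms along the loops in `L` are traceless: the trace of `ψ_a (· ⊗ m)` vanishes for
all `m`. -/
def OrthMorphisms.IsTracelessOn {W : OrthVertexBundle EX X S ε F}
    {M : ∀ o, HolVectorBundle EX X (MF o)} {τ : S.Arrow → T} (Ψ : OrthMorphisms W M τ)
    (L : Set S.Arrow) : Prop :=
  ∀ x (m : ∀ o, (M o).Fib x),
    S.IsTracelessOn (W := fun i => (W.bdl i).Fib x) L (fun a => (Ψ.ψ x a).flip (m (τ a)))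

/-- `Ψ' = k · Ψ`: the isomorphism `k` carries the morphisms `Ψ` to `Ψ'`. -/
def Iso.Carries {W W' : OrthVertexBundle EX X S ε F} {M : ∀ o, HolVectorBundle EX X (MF o)}
    {τ : S.Arrow → T} (k : Iso W W') (Ψ : OrthMorphisms W M τ) (Ψ' : OrthMorphisms W' M τ) :
    Prop :=
  ∀ x a v m, Ψ'.ψ x a (k.toFun x _ v) m = k.toFun x _ (Ψ.ψ x a v m)

end OrthVertexBundle

/-! ## Twisted bundles for a generalized quiver, and the correspondence -/

namespace GeneralizedQuiver

variable {B : LinearMap.BilinForm ℂ V} (Q : GeneralizedQuiver.{u} B)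
  {MF : Q.A → Type*} [∀ o, NormedAddCommGroup (MF o)] [∀ o, NormedSpace ℂ (MF o)]

/-- A holomorphic section of the bundle `(E × F) ×_ρ Rep(Q, M)` associated with the fibre product
of the principal `R`-bundle `E` and of the frame bundle `F` of the twisting bundles, as a
holomorphic `R × ∏ GL(M_α)`-equivariant map from `E × F` to `Rep(Q, M) = ⨁ α, Hom(M_α, Z_α)`. -/
structure TwistedSection (E : HolPrincipalBundle EX X Q.R)
    (M : ∀ α, HolVectorBundle EX X (MF α)) where
  φ : ∀ x, E.Fib x → (∀ α, MF α ≃ₗ[ℂ] (M α).Fib x) → ∀ α, MF α →ₗ[ℂ] Q.Z α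
  equivariant : ∀ x p f (r : Q.R) (k : ∀ α, MF α ≃ₗ[ℂ] MF α) α n,
    φ x (E.act x p r) (fun β => (k β).trans (f β)) α n = Q.ρ α r⁻¹ (φ x p f α (k α n))
  hol : ∀ U s (f : ∀ x α, MF α ≃ₗ[ℂ] (M α).Fib x), IsOpen U → E.IsHolOn U s →
    (∀ α n, (M α).IsHolOn U (fun x => f x α n)) →
    ∀ α n, HolOn EX U (fun x => φ x (s x) (f x) α n)

variable {Q}

/-- `φ' = k · φ`: the isomorphism `k` of principal bundles carries the section `φ` to `φ'`. -/
def TwistedSection.CarriedBy {E E' : HolPrincipalBundle EX X Q.R}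
    {M : ∀ α, HolVectorBundle EX X (MF α)} (k : E.Iso E') (s : Q.TwistedSection E M)
    (s' : Q.TwistedSection E' M) : Prop :=
  ∀ x p f, s'.φ x (k.toFun x p) f = s.φ x p f

variable (Q)

/-- An isometric isomorphism `E ×_R V ≅ W` between the bundles associated with the
principal `R`-bundle `E` and the vertex part `W` of an orthogonal bundle representation; it is
given by the frames `V_χ ≅ W_χ` which the points of `E` determine. -/
structure VertexIdentification {hB : B.Nondegenerate} {ε : ℂ} (E : HolPrincipalBundle EX X Q.R)
    (W : OrthVertexBundle EX X (Q.symmetricQuiver hB) ε Q.space) where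
  frame : ∀ x, E.Fib x → ∀ χ : Q.Weight, Q.space χ ≃ₗ[ℂ] (W.bdl χ).Fib x
  equivariant : ∀ x p r χ v, frame x (E.act x p r) χ v = frame x p χ (Q.act r χ v)
  isometry : ∀ x p (χ μ : Q.Weight) v w,
    W.g x χ μ (frame x p χ v) (frame x p μ w) = Q.form χ μ v w
  hol : ∀ U s, IsOpen U → E.IsHolOn U s →
    ∀ (χ : Q.Weight) v, (W.bdl χ).IsHolOn U (fun x => frame x (s x) χ v)

/-- A family of linear maps `f a : Z_α → Hom(V_{t(a)}, V_{h(a)})`, for the arrows `a` with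
label `α`. -/
abbrev ArrowMaps (hB : B.Nondegenerate) :=
  ∀ a : (Q.symmetricQuiver hB).Arrow, Q.Z (Q.label hB a) →ₗ[ℂ]
    (Q.space ((Q.symmetricQuiver hB).tail a) →ₗ[ℂ] Q.space ((Q.symmetricQuiver hB).head a))

/-- The family `f` induces an `R`-equivariant linear bijection from the representations
`(z α)` of the generalized quiver to the orthogonal representations on `V = ⨁ V_χ` (with the form
`B`) of the associated symmetric quiver, traceless on the loops with irreducible label. -/
structure IsFiniteCorrespondence (hB : B.Nondegenerate) (f : Q.ArrowMaps hB) : Prop where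
  equivariant : ∀ a (r : Q.R) z v, f a (Q.ρ _ r z) (Q.act r _ v) = Q.act r _ (f a z v)
  bijective : Set.BijOn (fun (z : ∀ α, Q.Z α) a => f a (z (Q.label hB a))) Set.univ
    {ψ | (Q.symmetricQuiver hB).IsOrthogonalRep (W := Q.space) Q.form ψ ∧
      (Q.symmetricQuiver hB).IsTracelessOn (W := Q.space) (Q.irreducibleArrows hB) ψ}

variable {Q} in
/-- The section `φ` of `(E × F) ×_ρ Rep(Q, M)` and the morphisms `Ψ` correspond to each other
fibrewise by `f`, under the identification `u` of `E ×_R V` with `W`. -/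
def VertexIdentification.Corresponds {hB : B.Nondegenerate} {ε : ℂ}
    {E : HolPrincipalBundle EX X Q.R} {W : OrthVertexBundle EX X (Q.symmetricQuiver hB) ε Q.space}
    {M : ∀ α, HolVectorBundle EX X (MF α)} (u : Q.VertexIdentification E W) (f : Q.ArrowMaps hB)
    (φ : Q.TwistedSection E M) (Ψ : W.OrthMorphisms M (Q.label hB)) : Prop :=
  ∀ x (p : E.Fib x) (m : ∀ α, MF α ≃ₗ[ℂ] (M α).Fib x) a (n : MF (Q.label hB a)) v,
    Ψ.ψ x a (u.frame x p _ v) (m _ n) = u.frame x p _ (f a (φ.φ x p m _ n) v)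

/-- A twisted bundle for the generalized quiver `Q`. -/
structure TwistedBundle (M : ∀ α, HolVectorBundle EX X (MF α)) where
  E : HolPrincipalBundle EX X Q.R
  φ : Q.TwistedSection E M

/-- A twisted orthogonal bundle representation of the associated symmetric quiver, with fibre
spaces `V_χ`, traceless on the loops with irreducible label. -/
structure TwistedOrthBundle (hB : B.Nondegenerate) (ε : ℂ)
    (M : ∀ α, HolVectorBundle EX X (MF α)) where
  W : OrthVertexBundle EX X (Q.symmetricQuiver hB) ε Q.space
  Ψ : W.OrthMorphisms M (Q.label hB)
  traceless : Ψ.IsTracelessOn (Q.irreducibleArrows hB)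

variable {Q}

/-- Isomorphism of twisted bundles for a generalized quiver. -/
def TwistedBundle.IsIsomorphic {M : ∀ α, HolVectorBundle EX X (MF α)} (P P' : Q.TwistedBundle M) :
    Prop :=
  ∃ k : P.E.Iso P'.E, P.φ.CarriedBy k P'.φ

/-- Isomorphism of twisted orthogonal bundle representations. -/
def TwistedOrthBundle.IsIsomorphic {hB : B.Nondegenerate} {ε : ℂ}
    {M : ∀ α, HolVectorBundle EX X (MF α)} (P P' : Q.TwistedOrthBundle hB ε M) : Prop :=
  ∃ k : P.W.Iso P'.W, k.Carries P.Ψ P'.Ψ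

end GeneralizedQuiver

end Bundles

end

/-! Because H is abelian and reductive, V is the direct sum of the isotypic components V_χ, and B
pairs V_χ with V_{χ⁻¹} only. So R consists of the isometries that preserve every V_χ, and a
principal R-bundle is the same thing as the bundle of isometric graded frames of an orthogonal
bundle ⊕ 𝕍_χ. What remains is linear algebra, done once in `exists_finiteCorrespondence` and then
applied fibrewise.

The linear algebra rests on two facts. A summand Z_α embeds in only one piece 𝔤_{χμ}, up to the
symmetry (χ, μ) ↦ (μ⁻¹, χ⁻¹) (`EmbedsInPiece.eq_or_eq`), so the arrows labelled α form a single
σ-orbit. And an Ad R-stable subspace of a piece on which R acts non-trivially contains the whole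
piece, except that for χ = μ ≠ χ⁻¹ it need only contain the elements traceless on V_χ
(`IsAdStable.mem_of_mem_liePiece`). An orthogonal pair (ψ_a, ψ_{σa}) comes from a unique X in
𝔤_{χμ}, and for irreducible Z_α tracelessness on loops is what puts X in the image of Z_α. The
second fact is obtained without differentiating group actions: conjugation by reflections,
unipotents 1 + N with N² = 0 and rescalings of a hyperbolic pair produces the elements x ∧ y, which
span the pieces.

Geometrically, the point is that an orthogonal bundle has local holomorphic isometric frames
(`exists_local_isometricFrame`). In any graded frame the form is B(S·, ·) with S invertible,
B-symmetric and commuting with H; composing the frame with a symmetric square root of S⁻¹ makes it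
isometric. A polynomial square root settles a single point; then S = 1 there, and the analytic
inverse function theorem gives a holomorphic root nearby. In the other direction E ×_R V_χ is glued
from the transition functions of E. Isomorphisms, sections and their holomorphy are compared in
these frames, and each bijection comes from a relation that is functional in both directions. -/

noncomputable section

/-! ### Weight decomposition -/

section WeightDecomposition

variable {V : Type u} [NormedAddCommGroup V] [NormedSpace ℂ V]

theorem weightSpace_stable {H : Subgroup (V ≃ₗ[ℂ] V)} (χ : H →* ℂˣ) (g : V ≃ₗ[ℂ] V) (hg : g ∈ H)
    (x : V) (hx : x ∈ weightSpace χ) : g x ∈ weightSpace χ := by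
  have h1 : g x = (χ ⟨g, hg⟩ : ℂ) • x := hx ⟨g, hg⟩
  rw [h1]
  exact Submodule.smul_mem _ _ hx

/-- A commuting group of automorphisms has a common eigenvector in every nonzero stable
finite-dimensional subspace. -/
theorem exists_common_eigenvector [FiniteDimensional ℂ V] {H : Subgroup (V ≃ₗ[ℂ] V)}
    (hc : ∀ g ∈ H, ∀ h ∈ H, g * h = h * g) (U : Submodule ℂ V)
    (hU : ∀ g ∈ H, ∀ x ∈ U, g x ∈ U) (hne : U ≠ ⊥) :
    ∃ x ∈ U, x ≠ 0 ∧ ∀ g ∈ H, ∃ c : ℂ, g x = c • x := by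
  induction hn : Module.finrank ℂ U using Nat.strong_induction_on generalizing U with
  | _ n ih =>
    -- If every element of H is scalar on `U`, any nonzero vector works. Otherwise an eigenspace of
    -- a non-scalar `g` is a proper nonzero subspace, stable because H commutes with `g`.
    by_cases hs : ∀ g ∈ H, ∃ c : ℂ, ∀ x ∈ U, g x = c • x
    · obtain ⟨x, hx, hx0⟩ := (Submodule.ne_bot_iff _).1 hne
      exact ⟨x, hx, hx0, fun g hg => (hs g hg).imp fun c hc => hc x hx⟩
    · push Not at hs
      obtain ⟨g, hg, hgc⟩ := hs
      have : Nontrivial U := Submodule.nontrivial_iff_ne_bot.2 hne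
      obtain ⟨c, hcv⟩ := Module.End.exists_eigenvalue
        ((g : V →ₗ[ℂ] V).restrict (hU g hg) : Module.End ℂ U)
      obtain ⟨y, hy⟩ := hcv.exists_hasEigenvector
      let U' : Submodule ℂ V := U ⊓ LinearMap.ker ((g : V →ₗ[ℂ] V) - c • LinearMap.id)
      have hmem : ∀ x, x ∈ U' ↔ x ∈ U ∧ g x = c • x := by
        intro x
        simp [U', sub_eq_zero]
      have hne' : U' ≠ ⊥ := by
        refine (Submodule.ne_bot_iff _).2 ⟨y, (hmem _).2 ⟨y.2, ?_⟩, fun h => hy.2 (Subtype.ext h)⟩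
        have := congrArg Subtype.val hy.apply_eq_smul
        simpa using this
      have hlt : U' < U := by
        refine lt_of_le_of_ne inf_le_left fun h => ?_
        obtain ⟨x, hx, hxc⟩ := hgc c
        exact hxc ((hmem x).1 (h ▸ hx)).2
      obtain ⟨x, hx, hx0, hxe⟩ := ih _ (hn ▸ Submodule.finrank_lt_finrank_of_lt hlt) U' (by
        intro k hk x hx
        obtain ⟨h1, h2⟩ := (hmem x).1 hx
        refine (hmem _).2 ⟨hU k hk x h1, ?_⟩
        rw [← LinearEquiv.mul_apply, hc g hg k hk, LinearEquiv.mul_apply, h2, map_smul]) hne' rfl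
      exact ⟨x, hlt.le hx, hx0, hxe⟩

/-- The eigenvalue is multiplicative because a nonzero vector can be cancelled, and a multiplicative
map on a group takes values in units. -/
theorem exists_weight_of_common_eigenvector {H : Subgroup (V ≃ₗ[ℂ] V)} {x : V} (hx0 : x ≠ 0)
    (hx : ∀ g ∈ H, ∃ c : ℂ, g x = c • x) : ∃ χ : H →* ℂˣ, x ∈ weightSpace χ := by
  choose c hc using hx
  have inj : ∀ {a b : ℂ}, a • x = b • x → a = b := fun h => smul_left_injective ℂ hx0 h
  let f : H →* ℂ :=
    { toFun := fun h => c h h.2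
      map_one' := inj (by rw [← hc _ (1 : H).2]; simp)
      map_mul' := fun a b => inj (by
        rw [← hc _ (a * b).2, Subgroup.coe_mul, LinearEquiv.mul_apply, hc b b.2, map_smul, hc a a.2,
          smul_smul, mul_comm]) }
  exact ⟨f.toHomUnits, fun h => hc h h.2⟩

/-- A nonzero stable complement of the sum of the weight spaces would contain a common eigenvector,
which already lies in a weight space. -/
theorem iSup_weightSpace [FiniteDimensional ℂ V] {H : Subgroup (V ≃ₗ[ℂ] V)}
    (hc : ∀ g ∈ H, ∀ h ∈ H, g * h = h * g) (hr : IsReductiveIn H) :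
    ⨆ χ : H →* ℂˣ, weightSpace χ = ⊤ := by
  obtain ⟨U', hU', hcompl⟩ := hr (⨆ χ : H →* ℂˣ, weightSpace χ) (by
    intro g hg x hx
    refine Submodule.iSup_induction (fun χ : H →* ℂˣ => weightSpace χ)
      (motive := fun x => g x ∈ ⨆ χ : H →* ℂˣ, weightSpace χ) hx ?_ (by simp) ?_
    · intro χ x hx
      exact Submodule.mem_iSup_of_mem χ (weightSpace_stable χ g hg x hx)
    · intro x y hx hy
      rw [map_add]
      exact add_mem hx hy)
  by_cases hbot : U' = ⊥
  · subst hbot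
    simpa using hcompl.sup_eq_top
  · obtain ⟨x, hx, hx0, hxe⟩ := exists_common_eigenvector hc U' hU' hbot
    obtain ⟨χ, hχ⟩ := exists_weight_of_common_eigenvector hx0 hxe
    exact absurd ((Submodule.disjoint_def.1 hcompl.disjoint) x (Submodule.mem_iSup_of_mem χ hχ) hx)
      hx0

/-- Weight spaces lie in the simultaneous generalized eigenspaces of a commuting family, and these
are independent. -/
theorem iSupIndep_weightSpace {H : Subgroup (V ≃ₗ[ℂ] V)}
    (hc : ∀ g ∈ H, ∀ h ∈ H, g * h = h * g) :
    iSupIndep fun χ : H →* ℂˣ => weightSpace χ := by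
  have h := Module.End.independent_iInf_maxGenEigenspace_of_forall_mapsTo
    (fun h : H => ((h : V ≃ₗ[ℂ] V) : Module.End ℂ V)) (by
      intro i j φ
      refine Module.End.mapsTo_maxGenEigenspace_of_comm ?_ φ
      ext x
      exact congrArg (fun k : V ≃ₗ[ℂ] V => k x) (hc j j.2 i i.2))
  have h' := h.comp (f := fun (χ : H →* ℂˣ) (h : H) => (χ h : ℂ)) (by
    intro χ μ e
    ext k
    exact congrFun e k)
  refine h'.mono fun χ x hx => ?_
  simp only [Function.comp, Submodule.mem_iInf]
  intro k
  refine Module.End.mem_maxGenEigenspace _ _ _ |>.2 ⟨1, ?_⟩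
  have := hx k
  simp [this]

end WeightDecomposition

/-! ### Isotypic components, their pairing under `B`, and the elements of `R` -/

namespace GeneralizedQuiver

variable {V : Type u} [NormedAddCommGroup V] [NormedSpace ℂ V] {B : LinearMap.BilinForm ℂ V}
  (Q : GeneralizedQuiver.{u, v, w} B)

theorem iSupIndep_weight : iSupIndep fun χ : Q.Weight => weightSpace χ.1 :=
  (iSupIndep_weightSpace Q.H_comm).comp Subtype.val_injective

instance [FiniteDimensional ℂ V] : Finite Q.Weight :=
  WellFoundedGT.finite_of_iSupIndep Q.iSupIndep_weight fun χ => χ.2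

instance [FiniteDimensional ℂ V] : Fintype Q.Weight := Fintype.ofFinite _

theorem iSup_weight [FiniteDimensional ℂ V] : ⨆ χ : Q.Weight, weightSpace χ.1 = ⊤ := by
  refine eq_top_iff.2 ?_
  rw [← iSup_weightSpace Q.H_comm Q.H_reductive]
  refine iSup_le fun χ => ?_
  by_cases h : weightSpace χ = ⊥
  · rw [h]
    exact bot_le
  · exact le_iSup (fun χ : Q.Weight => weightSpace χ.1) ⟨χ, h⟩

variable {Q} in
/-- A linear map is determined by its values on weight vectors. -/
theorem ext_weight [FiniteDimensional ℂ V] {N : Type*} [AddCommGroup N] [Module ℂ N]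
    {f g : V →ₗ[ℂ] N} (h : ∀ (χ : Q.Weight), ∀ x ∈ weightSpace χ.1, f x = g x) : f = g := by
  ext x
  have hx : x ∈ ⨆ χ : Q.Weight, weightSpace χ.1 := by rw [Q.iSup_weight]; trivial
  refine Submodule.iSup_induction _ (motive := fun x => f x = g x) hx h (by simp) ?_
  intro x y hx hy
  rw [map_add, map_add, hx, hy]

open scoped Classical in
theorem isInternal_weight [FiniteDimensional ℂ V] :
    DirectSum.IsInternal fun χ : Q.Weight => weightSpace χ.1 :=
  DirectSum.isInternal_submodule_of_iSupIndep_of_iSup_eq_top Q.iSupIndep_weight Q.iSup_weight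

open scoped Classical in
/-- The projection of `V` to an isotypic component. -/
def proj [FiniteDimensional ℂ V] (χ : Q.Weight) : V →ₗ[ℂ] Q.space χ :=
  DirectSum.component ℂ Q.Weight (fun χ => Q.space χ) χ ∘ₗ
    (LinearEquiv.ofBijective (DirectSum.coeLinearMap fun χ : Q.Weight => weightSpace χ.1)
      Q.isInternal_weight).symm.toLinearMap

variable [FiniteDimensional ℂ V]

theorem proj_coe (χ : Q.Weight) (x : Q.space χ) : Q.proj χ x = x := by
  classical
  exact Q.isInternal_weight.ofBijective_coeLinearMap_same x

theorem proj_of_mem {χ : Q.Weight} {x : V} (hx : x ∈ weightSpace χ.1) :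
    (Q.proj χ x : V) = x := congrArg Subtype.val (Q.proj_coe χ ⟨x, hx⟩)

theorem proj_of_ne {χ μ : Q.Weight} (h : χ ≠ μ) {x : V} (hx : x ∈ weightSpace χ.1) :
    Q.proj μ x = 0 := by
  classical
  exact Q.isInternal_weight.ofBijective_coeLinearMap_of_mem_ne h hx

theorem sum_proj (x : V) : ∑ χ, (Q.proj χ x : V) = x := by
  have : (∑ χ, (weightSpace χ.1).subtype ∘ₗ Q.proj χ) = LinearMap.id := by
    refine ext_weight (Q := Q) fun χ x hx => ?_
    rw [LinearMap.sum_apply, Finset.sum_eq_single χ]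
    · exact Q.proj_of_mem hx
    · intro μ _ hμ
      simp [Q.proj_of_ne hμ.symm hx]
    · simp
  simpa using LinearMap.congr_fun this x

/-- The weight `χ⁻¹`. -/
def inv (hB : B.Nondegenerate) (χ : Q.Weight) : Q.Weight := (Q.symmetricQuiver hB).σV χ

omit [FiniteDimensional ℂ V] in
theorem inv_inv (hB : B.Nondegenerate) (χ : Q.Weight) : Q.inv hB (Q.inv hB χ) = χ :=
  (Q.symmetricQuiver hB).σV_σV χ

omit [FiniteDimensional ℂ V] in
theorem inv_val (hB : B.Nondegenerate) (χ : Q.Weight) : (Q.inv hB χ).1 = χ.1⁻¹ := rfl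

omit [FiniteDimensional ℂ V] in
-- Invariance under h multiplies B(x, y) by χ(h)μ(h), which differs from 1 for some h.
theorem form_eq_zero_of_ne (χ μ : Q.H →* ℂˣ) (h : μ ≠ χ⁻¹) {x y : V} (hx : x ∈ weightSpace χ)
    (hy : y ∈ weightSpace μ) : B x y = 0 := by
  obtain ⟨k, hk⟩ : ∃ k, μ k ≠ χ⁻¹ k := by
    by_contra! hcon
    exact h (MonoidHom.ext hcon)
  have h1 := Q.H_le k.2 x y
  rw [hx k, hy k, map_smul, map_smul, LinearMap.smul_apply, smul_eq_mul, smul_eq_mul,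
    ← mul_assoc] at h1
  by_contra h0
  have h2 : (μ k : ℂ) * χ k = 1 := mul_right_cancel₀ h0 (by rw [h1, one_mul])
  refine hk (Units.ext ?_)
  rw [MonoidHom.inv_apply, Units.val_inv_eq_inv_val]
  exact eq_inv_of_mul_eq_one_left h2

theorem form_nondegenerate (hB : B.Nondegenerate) (χ : Q.Weight) {x : V}
    (hx : x ∈ weightSpace χ.1) (h : ∀ y ∈ weightSpace (Q.inv hB χ).1, B x y = 0) : x = 0 := by
  refine hB.1 x fun y => ?_
  have : B x = 0 := by
    refine ext_weight (Q := Q) fun μ y hy => ?_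
    by_cases hμ : μ.1 = χ.1⁻¹
    · exact h y (by rw [inv_val, ← hμ]; exact hy)
    · exact Q.form_eq_zero_of_ne _ _ hμ hx hy
  rw [this, LinearMap.zero_apply]

theorem form_isOrthogonalForm (hB : B.Nondegenerate) {ε : ℂ} (hsymm : ∀ x y, B x y = ε * B y x) :
    (Q.symmetricQuiver hB).IsOrthogonalForm (W := Q.space) ε Q.form where
  symm _ _ x y := hsymm x y
  eq_zero χ μ h := by
    ext x y
    exact Q.form_eq_zero_of_ne _ _ (fun h' => h (Subtype.ext h')) x.2 y.2
  nondegenerate χ x h := Subtype.ext (Q.form_nondegenerate hB χ x.2 fun y hy => h ⟨y, hy⟩)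

omit [FiniteDimensional ℂ V] in
theorem mem_R_iff (g : V ≃ₗ[ℂ] V) :
    g ∈ Q.R ↔ (∀ x y, B (g x) (g y) = B x y) ∧ ∀ h ∈ Q.H, ∀ x, g (h x) = h (g x) := by
  refine and_congr Iff.rfl ?_
  change g ∈ Subgroup.centralizer (Q.H : Set (V ≃ₗ[ℂ] V)) ↔ _
  rw [Subgroup.mem_centralizer_iff]
  refine forall₂_congr fun h _ => ?_
  rw [LinearEquiv.ext_iff]
  exact forall_congr' fun x => eq_comm

/-- A linear automorphism of `V` which is isometric and stabilizes the weight spaces is in `R`. -/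
theorem mem_R_of_stable (g : V ≃ₗ[ℂ] V)
    (hg : ∀ (χ : Q.Weight), ∀ x ∈ weightSpace χ.1, g x ∈ weightSpace χ.1)
    (hB : ∀ (χ μ : Q.Weight), ∀ x ∈ weightSpace χ.1, ∀ y ∈ weightSpace μ.1,
      B (g x) (g y) = B x y) : g ∈ Q.R := by
  refine (Q.mem_R_iff g).2 ⟨fun x y => ?_, fun h hh x => ?_⟩
  · have : B.compl₁₂ (g : V →ₗ[ℂ] V) (g : V →ₗ[ℂ] V) = B := by
      refine ext_weight (Q := Q) fun χ x hx => ext_weight (Q := Q) fun μ y hy => ?_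
      exact hB χ μ x hx y hy
    exact LinearMap.congr_fun₂ this x y
  · have : (g : V →ₗ[ℂ] V) ∘ₗ (h : V →ₗ[ℂ] V) = (h : V →ₗ[ℂ] V) ∘ₗ (g : V →ₗ[ℂ] V) := by
      refine ext_weight (Q := Q) fun χ x hx => ?_
      have h1 : h x = _ := hx ⟨h, hh⟩
      have h2 : h (g x) = _ := hg χ x hx ⟨h, hh⟩
      simp only [LinearMap.comp_apply, LinearEquiv.coe_coe]
      rw [h1, h2, map_smul]
    exact LinearMap.congr_fun this x

/-- The endomorphism of `V` with prescribed restrictions to the isotypic components. -/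
def blockMap (a : ∀ χ : Q.Weight, Q.space χ →ₗ[ℂ] Q.space χ) : V →ₗ[ℂ] V :=
  ∑ χ, (weightSpace χ.1).subtype ∘ₗ a χ ∘ₗ Q.proj χ

theorem blockMap_coe (a : ∀ χ : Q.Weight, Q.space χ →ₗ[ℂ] Q.space χ) (χ : Q.Weight)
    (x : Q.space χ) : Q.blockMap a x = a χ x := by
  rw [blockMap, LinearMap.sum_apply, Finset.sum_eq_single χ]
  · simp [Q.proj_coe]
  · intro μ _ hμ
    simp [Q.proj_of_ne hμ.symm x.2]
  · simp

/-- The element of `R` given by isometric automorphisms of the isotypic components. -/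
def ofFamily (a : ∀ χ : Q.Weight, Q.space χ ≃ₗ[ℂ] Q.space χ)
    (ha : ∀ χ μ x y, Q.form χ μ (a χ x) (a μ y) = Q.form χ μ x y) : Q.R :=
  ⟨LinearEquiv.ofLinearMap (Q.blockMap fun χ => (a χ).toLinearMap)
    (Q.blockMap fun χ => (a χ).symm.toLinearMap)
    (ext_weight (Q := Q) fun χ x hx => by
      lift x to Q.space χ using hx
      simp [blockMap_coe])
    (ext_weight (Q := Q) fun χ x hx => by
      lift x to Q.space χ using hx
      simp [blockMap_coe]),
  Q.mem_R_of_stable _ (fun χ x hx => by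
      lift x to Q.space χ using hx
      simp [blockMap_coe])
    (fun χ μ x hx y hy => by
      lift x to Q.space χ using hx
      lift y to Q.space μ using hy
      simp only [LinearEquiv.coe_ofLinearMap, blockMap_coe]
      exact ha χ μ x y)⟩

theorem act_ofFamily (a : ∀ χ : Q.Weight, Q.space χ ≃ₗ[ℂ] Q.space χ)
    (ha : ∀ χ μ x y, Q.form χ μ (a χ x) (a μ y) = Q.form χ μ x y) (χ : Q.Weight) (x : Q.space χ) :
    Q.act (Q.ofFamily a ha) χ x = a χ x :=
  Subtype.ext (Q.blockMap_coe _ χ x)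

omit [FiniteDimensional ℂ V] in
theorem act_coe (r : Q.R) (χ : Q.Weight) (x : Q.space χ) :
    (Q.act r χ x : V) = (r : V ≃ₗ[ℂ] V) x := rfl

theorem R_ext {r s : Q.R} (h : ∀ χ x, Q.act r χ x = Q.act s χ x) : r = s := by
  refine Subtype.ext (LinearEquiv.toLinearMap_injective ?_)
  refine ext_weight (Q := Q) fun χ x hx => ?_
  exact congrArg Subtype.val (h χ ⟨x, hx⟩)

omit [FiniteDimensional ℂ V] in
theorem act_one (χ : Q.Weight) (x : Q.space χ) : Q.act 1 χ x = x := rfl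

omit [FiniteDimensional ℂ V] in
theorem act_mul (r s : Q.R) (χ : Q.Weight) (x : Q.space χ) :
    Q.act (r * s) χ x = Q.act r χ (Q.act s χ x) := rfl

omit [FiniteDimensional ℂ V] in
theorem act_inv_act (r : Q.R) (χ : Q.Weight) (x : Q.space χ) : Q.act r⁻¹ χ (Q.act r χ x) = x := by
  rw [← act_mul, inv_mul_cancel, act_one]

omit [FiniteDimensional ℂ V] in
theorem act_act_inv (r : Q.R) (χ : Q.Weight) (x : Q.space χ) : Q.act r χ (Q.act r⁻¹ χ x) = x := by
  rw [← act_mul, mul_inv_cancel, act_one]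

omit [FiniteDimensional ℂ V] in
theorem form_act (r : Q.R) (χ μ : Q.Weight) (x : Q.space χ) (y : Q.space μ) :
    Q.form χ μ (Q.act r χ x) (Q.act r μ y) = Q.form χ μ x y :=
  r.2.1 x y

theorem proj_apply_R (r : Q.R) (χ : Q.Weight) (x : V) :
    Q.proj χ ((r : V ≃ₗ[ℂ] V) x) = Q.act r χ (Q.proj χ x) := by
  have : Q.proj χ ∘ₗ ((r : V ≃ₗ[ℂ] V) : V →ₗ[ℂ] V) = Q.act r χ ∘ₗ Q.proj χ := by
    refine ext_weight (Q := Q) fun μ x hx => ?_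
    have hr := Q.act_mem r μ x hx
    simp only [LinearMap.comp_apply, LinearEquiv.coe_coe]
    by_cases h : μ = χ
    · subst h
      lift x to Q.space μ using hx
      rw [Q.proj_coe]
      exact Subtype.ext (Q.proj_of_mem hr)
    · rw [Q.proj_of_ne h hx, Q.proj_of_ne h hr, map_zero]
  exact LinearMap.congr_fun this x

end GeneralizedQuiver

/-! ### The elements `x ∧ y` of the Lie algebra -/

section Wedge

variable {V : Type u} [NormedAddCommGroup V] [NormedSpace ℂ V]

/-- The rank one endomorphism `v ↦ B(x, v) y`. -/
def rankOne (B : LinearMap.BilinForm ℂ V) : V →ₗ[ℂ] V →ₗ[ℂ] V →ₗ[ℂ] V :=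
  LinearMap.smulRightₗ ∘ₗ B

@[simp] theorem rankOne_apply (B : LinearMap.BilinForm ℂ V) (x y v : V) :
    rankOne B x y v = B x v • y := rfl

/-- The endomorphism `v ↦ B(x, v) y - ε B(y, v) x`; it is skew-adjoint for the `ε`-symmetric
form `B`. -/
def wedge (B : LinearMap.BilinForm ℂ V) (ε : ℂ) : V →ₗ[ℂ] V →ₗ[ℂ] V →ₗ[ℂ] V :=
  rankOne B - ε • (rankOne B).flip

@[simp] theorem wedge_apply (B : LinearMap.BilinForm ℂ V) (ε : ℂ) (x y v : V) :
    wedge B ε x y v = B x v • y - ε • B y v • x := rfl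

theorem mem_isometryLie {B : LinearMap.BilinForm ℂ V} {X : V →ₗ[ℂ] V} :
    X ∈ isometryLie B ↔ ∀ x y, B (X x) y = -B x (X y) := by
  rw [isometryLie, LinearMap.mem_skewAdjointSubmodule]
  constructor
  · intro h x y
    have := h x y
    simpa using this
  · intro h x y
    simpa using h x y

variable {B : LinearMap.BilinForm ℂ V} {ε : ℂ}

theorem wedge_swap (hε : ε = 1 ∨ ε = -1) (x y : V) : wedge B ε y x = -ε • wedge B ε x y := by
  ext v
  rcases hε with rfl | rfl <;> simp [add_comm]

theorem wedge_mem_isometryLie (hε : ε = 1 ∨ ε = -1) (hsymm : ∀ x y, B x y = ε * B y x) (x y : V) :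
    wedge B ε x y ∈ isometryLie B := by
  rw [mem_isometryLie]
  intro u v
  simp only [wedge_apply, map_sub, map_smul, LinearMap.sub_apply, LinearMap.smul_apply, smul_eq_mul]
  rw [hsymm u x, hsymm u y]
  rcases hε with rfl | rfl <;> ring

end Wedge

/-! ### The pieces of the Lie algebra and their generators x ∧ y -/

namespace GeneralizedQuiver

variable {V : Type u} [NormedAddCommGroup V] [NormedSpace ℂ V] {B : LinearMap.BilinForm ℂ V}
  (Q : GeneralizedQuiver.{u, v, w} B)

theorem adRep_apply (r : Q.R) (X : V →ₗ[ℂ] V) (v : V) :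
    adRep Q.R r X v = (r : V ≃ₗ[ℂ] V) (X (((r⁻¹ : Q.R) : V ≃ₗ[ℂ] V) v)) := rfl

theorem liePiece_swap (χ μ : Q.H →* ℂˣ) : liePiece B μ⁻¹ χ⁻¹ = liePiece B χ μ := by
  rw [liePiece, liePiece, character_inv_inv, character_inv_inv, sup_comm]

section

variable {Q} {χ μ : Q.H →* ℂˣ} {X Y : V →ₗ[ℂ] V}

theorem liePiece_skew (hX : X ∈ liePiece B χ μ) (x y : V) : B (X x) y = -B x (X y) :=
  mem_isometryLie.1 hX.1 x y

/-- The summand from Hom(V_{μ⁻¹}, V_{χ⁻¹}) acts on V_χ only if χ = μ⁻¹, and then its target V_{χ⁻¹}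
is V_μ. -/
theorem liePiece_mapsTo (hX : X ∈ liePiece B χ μ) {x : V} (hx : x ∈ weightSpace χ) :
    X x ∈ weightSpace μ := by
  obtain ⟨Y, hY, Z, hZ, rfl⟩ := Submodule.mem_sup.1 hX.2
  rw [LinearMap.add_apply]
  refine add_mem (hY.1 x hx) ?_
  by_cases h : χ = μ⁻¹
  · have := hZ.1 x (h ▸ hx)
    rwa [h, character_inv_inv] at this
  · rw [hZ.2 χ h x hx]
    exact zero_mem _

theorem liePiece_mapsTo' (hX : X ∈ liePiece B χ μ) {x : V} (hx : x ∈ weightSpace μ⁻¹) :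
    X x ∈ weightSpace χ⁻¹ := by
  rw [← liePiece_swap] at hX
  exact liePiece_mapsTo hX hx

theorem liePiece_eq_zero (hX : X ∈ liePiece B χ μ) {ν : Q.H →* ℂˣ} (h1 : ν ≠ χ) (h2 : ν ≠ μ⁻¹)
    {x : V} (hx : x ∈ weightSpace ν) : X x = 0 := by
  obtain ⟨Y, hY, Z, hZ, rfl⟩ := Submodule.mem_sup.1 hX.2
  rw [LinearMap.add_apply, hY.2 ν h1 x hx, hZ.2 ν h2 x hx, add_zero]

end

theorem adRep_mem_isometryLie (r : Q.R) {X : V →ₗ[ℂ] V} (hX : X ∈ isometryLie B) :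
    adRep Q.R r X ∈ isometryLie B := by
  rw [mem_isometryLie] at hX ⊢
  intro x y
  have key : ∀ a v, B a (((r⁻¹ : Q.R) : V ≃ₗ[ℂ] V) v) = B ((r : V ≃ₗ[ℂ] V) a) v := by
    intro a v
    rw [← r.2.1 a, Subgroup.coe_inv, ← LinearEquiv.mul_apply, mul_inv_cancel]
    rfl
  have key' : ∀ a v, B (((r⁻¹ : Q.R) : V ≃ₗ[ℂ] V) v) a = B v ((r : V ≃ₗ[ℂ] V) a) := by
    intro a v
    rw [← r.2.1 _ a, Subgroup.coe_inv, ← LinearEquiv.mul_apply, mul_inv_cancel]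
    rfl
  rw [adRep_apply, adRep_apply, ← key, hX, key']

variable [FiniteDimensional ℂ V]

theorem ext_character {N : Type*} [AddCommGroup N] [Module ℂ N]
    {f g : V →ₗ[ℂ] N} (h : ∀ (χ : Q.H →* ℂˣ), ∀ x ∈ weightSpace χ, f x = g x) : f = g :=
  ext_weight (Q := Q) fun χ => h χ.1

theorem nondegenerate_weightSpace (hB : B.Nondegenerate) (χ : Q.H →* ℂˣ) {x : V}
    (hx : x ∈ weightSpace χ) (h : ∀ y ∈ weightSpace χ⁻¹, B x y = 0) : x = 0 := by
  refine hB.1 x fun y => ?_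
  have : B x = 0 := by
    refine Q.ext_character fun μ y hy => ?_
    by_cases hμ : μ = χ⁻¹
    · exact h y (hμ ▸ hy)
    · exact Q.form_eq_zero_of_ne _ _ hμ hx hy
  rw [this, LinearMap.zero_apply]

theorem exists_pairing_eq_one (hB : B.Nondegenerate) (χ : Q.H →* ℂˣ) {x : V}
    (hx : x ∈ weightSpace χ) (hx0 : x ≠ 0) : ∃ y ∈ weightSpace χ⁻¹, B x y = 1 := by
  by_contra! hcon
  refine hx0 (Q.nondegenerate_weightSpace hB χ hx fun y hy => ?_)
  by_contra h
  refine hcon ((B x y)⁻¹ • y) (Submodule.smul_mem _ _ hy) ?_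
  rw [map_smul, smul_eq_mul, inv_mul_cancel₀ h]

theorem exists_pairing_eq_one' (hB : B.Nondegenerate) {ε : ℂ} (hε : ε = 1 ∨ ε = -1)
    (hsymm : ∀ x y, B x y = ε * B y x) (χ : Q.H →* ℂˣ) {x : V}
    (hx : x ∈ weightSpace χ) (hx0 : x ≠ 0) : ∃ y ∈ weightSpace χ⁻¹, B y x = 1 := by
  obtain ⟨y, hy, h⟩ := Q.exists_pairing_eq_one hB χ hx hx0
  refine ⟨ε • y, Submodule.smul_mem _ _ hy, ?_⟩
  rw [map_smul, LinearMap.smul_apply, smul_eq_mul, hsymm, h]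
  rcases hε with rfl | rfl <;> ring

/-- With P the projection to V_χ, the splitting X = XP + X(1 - P) exhibits X in the sum of the two
Hom spaces. If χ does not occur in V there is no such P, and X lies in the second space. -/
theorem mem_liePiece_of {χ μ : Q.H →* ℂˣ} {X : V →ₗ[ℂ] V} (h1 : X ∈ isometryLie B)
    (h2 : ∀ x ∈ weightSpace χ, X x ∈ weightSpace μ)
    (h3 : ∀ x ∈ weightSpace μ⁻¹, X x ∈ weightSpace χ⁻¹)
    (h4 : ∀ ν, ν ≠ χ → ν ≠ μ⁻¹ → ∀ x ∈ weightSpace ν, X x = 0) : X ∈ liePiece B χ μ := by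
  classical
  refine ⟨h1, Submodule.mem_sup.2 ?_⟩
  by_cases hw : weightSpace χ = ⊥
  · refine ⟨0, zero_mem _, X, ⟨h3, fun ν hν x hx => ?_⟩, zero_add _⟩
    by_cases hνχ : ν = χ
    · rw [hνχ, hw, Submodule.mem_bot] at hx
      rw [hx, map_zero]
    · exact h4 ν hνχ hν x hx
  · let P : V →ₗ[ℂ] V := (weightSpace χ).subtype ∘ₗ Q.proj ⟨χ, hw⟩
    have hP : ∀ x ∈ weightSpace χ, P x = x := fun x hx => Q.proj_of_mem (χ := ⟨χ, hw⟩) hx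
    have hP' : ∀ ν, ν ≠ χ → ∀ x ∈ weightSpace ν, P x = 0 := by
      intro ν hν x hx
      by_cases hw' : weightSpace ν = ⊥
      · rw [hw', Submodule.mem_bot] at hx
        rw [hx, map_zero]
      · simp only [P, LinearMap.comp_apply]
        rw [Q.proj_of_ne (χ := ⟨ν, hw'⟩) (μ := ⟨χ, hw⟩) (fun h => hν (congrArg Subtype.val h)) hx,
          map_zero]
    refine ⟨X ∘ₗ P, ⟨fun x hx => ?_, fun ν hν x hx => ?_⟩, X - X ∘ₗ P, ⟨fun x hx => ?_,
      fun ν hν x hx => ?_⟩, by abel⟩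
    · rw [LinearMap.comp_apply, hP x hx]
      exact h2 x hx
    · rw [LinearMap.comp_apply, hP' ν hν x hx, map_zero]
    · rw [LinearMap.sub_apply, LinearMap.comp_apply]
      by_cases h : μ⁻¹ = χ
      · rw [hP x (h ▸ hx), sub_self]
        exact zero_mem _
      · rw [hP' _ h x hx, map_zero, sub_zero]
        exact h3 x hx
    · rw [LinearMap.sub_apply, LinearMap.comp_apply]
      by_cases h : ν = χ
      · rw [hP x (h ▸ hx), sub_self]
      · rw [hP' _ h x hx, map_zero, sub_zero]
        exact h4 ν h hν x hx

theorem adRep_mem_liePiece (r : Q.R) {χ μ : Q.H →* ℂˣ} {X : V →ₗ[ℂ] V} (hX : X ∈ liePiece B χ μ) :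
    adRep Q.R r X ∈ liePiece B χ μ := by
  have stab : ∀ (r : Q.R) (χ : Q.H →* ℂˣ) x, x ∈ weightSpace χ →
      (r : V ≃ₗ[ℂ] V) x ∈ weightSpace χ := by
    intro r χ x hx
    by_cases h : weightSpace χ = ⊥
    · rw [h, Submodule.mem_bot] at hx
      rw [hx, map_zero]
      exact zero_mem _
    · exact Q.act_mem r ⟨χ, h⟩ x hx
  refine Q.mem_liePiece_of (Q.adRep_mem_isometryLie r hX.1) (fun x hx => ?_) (fun x hx => ?_)
    fun ν h1 h2 x hx => ?_
  · exact stab _ _ _ (liePiece_mapsTo hX (stab _ _ _ hx))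
  · exact stab _ _ _ (liePiece_mapsTo' hX (stab _ _ _ hx))
  · rw [adRep_apply, liePiece_eq_zero hX h1 h2 (stab _ _ _ hx), map_zero]

/-- B(x, ·) is supported on V_χ and B(y, ·) on V_{μ⁻¹}. -/
theorem wedge_mem_liePiece {ε : ℂ} (hε : ε = 1 ∨ ε = -1) (hsymm : ∀ x y, B x y = ε * B y x)
    {χ μ : Q.H →* ℂˣ} {x y : V} (hx : x ∈ weightSpace χ⁻¹) (hy : y ∈ weightSpace μ) :
    wedge B ε x y ∈ liePiece B χ μ := by
  have hx0 : ∀ ν : Q.H →* ℂˣ, ν ≠ χ → ∀ v ∈ weightSpace ν, B x v = 0 := fun ν hν v hv =>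
    Q.form_eq_zero_of_ne χ⁻¹ ν (by rwa [character_inv_inv]) hx hv
  have hy0 : ∀ ν : Q.H →* ℂˣ, ν ≠ μ⁻¹ → ∀ v ∈ weightSpace ν, B y v = 0 := fun ν hν v hv =>
    Q.form_eq_zero_of_ne μ ν hν hy hv
  refine Q.mem_liePiece_of (wedge_mem_isometryLie hε hsymm x y) (fun v hv => ?_) (fun v hv => ?_)
    fun ν h1 h2 v hv => ?_
  · rw [wedge_apply]
    refine sub_mem (Submodule.smul_mem _ _ hy) ?_
    by_cases h : χ = μ⁻¹
    · rw [h, character_inv_inv] at hx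
      exact Submodule.smul_mem _ _ (Submodule.smul_mem _ _ hx)
    · rw [hy0 χ h v hv]
      simp
  · rw [wedge_apply]
    refine sub_mem ?_ (Submodule.smul_mem _ _ (Submodule.smul_mem _ _ hx))
    by_cases h : μ⁻¹ = χ
    · rw [← h, character_inv_inv]
      exact (Submodule.smul_mem _ _ hy)
    · rw [hx0 _ h v hv]
      simp
  · rw [wedge_apply, hx0 ν h1 v hv, hy0 ν h2 v hv]
    simp

/-- An element of a piece of the Lie algebra is determined by its restriction to `V_χ`. -/
theorem liePiece_ext (hB : B.Nondegenerate) {χ μ : Q.H →* ℂˣ} {X Y : V →ₗ[ℂ] V}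
    (hX : X ∈ liePiece B χ μ) (hY : Y ∈ liePiece B χ μ)
    (h : ∀ x ∈ weightSpace χ, X x = Y x) : X = Y := by
  refine Q.ext_character fun ν x hx => ?_
  by_cases h1 : ν = χ
  · exact h x (h1 ▸ hx)
  by_cases h2 : ν = μ⁻¹
  -- By skew-adjointness the restriction to V_{μ⁻¹} is minus the adjoint of the restriction to V_χ.
  · subst h2
    rw [← sub_eq_zero]
    refine Q.nondegenerate_weightSpace hB χ⁻¹
      (sub_mem (liePiece_mapsTo' hX hx) (liePiece_mapsTo' hY hx)) fun y hy => ?_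
    rw [character_inv_inv] at hy
    rw [map_sub, LinearMap.sub_apply, liePiece_skew hX, liePiece_skew hY, h y hy, sub_self]
  · rw [liePiece_eq_zero hX h1 h2 hx, liePiece_eq_zero hY h1 h2 hx]

/-- The isotypic components of `χ⁻¹` and `χ` are dual to each other. -/
def dualEquiv (hB : B.Nondegenerate) (χ : Q.H →* ℂˣ) :
    weightSpace χ⁻¹ ≃ₗ[ℂ] Module.Dual ℂ (weightSpace χ) :=
  have inj : ∀ χ μ : Q.H →* ℂˣ, μ = χ⁻¹ →
      Function.Injective (B.domRestrict₁₂ (weightSpace χ) (weightSpace μ)) := by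
    rintro χ _ rfl
    refine (injective_iff_map_eq_zero _).2 fun x hx => Subtype.ext ?_
    exact Q.nondegenerate_weightSpace hB χ x.2 fun y hy => LinearMap.congr_fun hx ⟨y, hy⟩
  LinearMap.linearEquivOfInjective (B.domRestrict₁₂ (weightSpace χ⁻¹) (weightSpace χ))
    (inj _ _ (character_inv_inv χ).symm) (le_antisymm
      ((LinearMap.finrank_le_finrank_of_injective (inj _ _ (character_inv_inv χ).symm)))
      (by
        have := LinearMap.finrank_le_finrank_of_injective (inj χ χ⁻¹ rfl)
        rwa [Subspace.dual_finrank_eq] at this ⊢))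

theorem dualEquiv_apply (hB : B.Nondegenerate) (χ : Q.H →* ℂˣ) (x : weightSpace χ⁻¹)
    (y : weightSpace χ) : Q.dualEquiv hB χ x y = B x y := rfl

/-- A basis of the isotypic component of `χ`. -/
def weightBasis (χ : Q.H →* ℂˣ) :
    Module.Basis (Fin (Module.finrank ℂ (weightSpace χ))) ℂ (weightSpace χ) :=
  Module.finBasis ℂ (weightSpace χ)

/-- The basis of the isotypic component of `χ⁻¹` dual to `weightBasis`. -/
def dualWeightBasis (hB : B.Nondegenerate) (χ : Q.H →* ℂˣ)
    (i : Fin (Module.finrank ℂ (weightSpace χ))) : weightSpace χ⁻¹ :=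
  (Q.dualEquiv hB χ).symm ((Q.weightBasis χ).coord i)

theorem form_dualWeightBasis (hB : B.Nondegenerate) (χ : Q.H →* ℂˣ) (i) (y : weightSpace χ) :
    B (Q.dualWeightBasis hB χ i) y = (Q.weightBasis χ).repr y i := by
  rw [← Q.dualEquiv_apply hB, dualWeightBasis, LinearEquiv.apply_symm_apply,
    Module.Basis.coord_apply]

theorem sum_form_smul_weightBasis (hB : B.Nondegenerate) (χ : Q.H →* ℂˣ) {y : V}
    (hy : y ∈ weightSpace χ) :
    ∑ i, B (Q.dualWeightBasis hB χ i) y • (Q.weightBasis χ i : V) = y := by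
  lift y to weightSpace χ using hy
  simp_rw [form_dualWeightBasis]
  have := congrArg (weightSpace χ).subtype ((Q.weightBasis χ).sum_repr y)
  rw [map_sum] at this
  exact this

theorem sum_form_smul_dualWeightBasis (hB : B.Nondegenerate) (χ : Q.H →* ℂˣ) {y : V}
    (hy : y ∈ weightSpace χ⁻¹) :
    ∑ i, B y (Q.weightBasis χ i) • (Q.dualWeightBasis hB χ i : V) = y := by
  lift y to weightSpace χ⁻¹ using hy
  suffices ∑ i, B y (Q.weightBasis χ i) • (Q.dualWeightBasis hB χ i) = y by
    have h := congrArg (weightSpace χ⁻¹).subtype this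
    rw [map_sum] at h
    exact h
  apply (Q.dualEquiv hB χ).injective
  refine (Q.weightBasis χ).ext fun j => ?_
  rw [map_sum, LinearMap.sum_apply]
  simp only [map_smul, LinearMap.smul_apply, dualEquiv_apply, form_dualWeightBasis, smul_eq_mul,
    Module.Basis.repr_self]
  simp [Finsupp.single_apply]

/-- Elements of the pieces of the Lie algebra are sums of elements `x ∧ y`. -/
theorem sum_wedge_eq (hB : B.Nondegenerate) {ε : ℂ} (hε : ε = 1 ∨ ε = -1)
    (hsymm : ∀ x y, B x y = ε * B y x) {χ μ : Q.H →* ℂˣ} {X : V →ₗ[ℂ] V}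
    (hX : X ∈ liePiece B χ μ) : ∃ c : ℂ, c ≠ 0 ∧
      ∑ i, wedge B ε (Q.dualWeightBasis hB χ i) (X (Q.weightBasis χ i)) = c • X := by
  have hε2 : ε * ε = 1 := by rcases hε with rfl | rfl <;> ring
  have hmem : ∑ i, wedge B ε (Q.dualWeightBasis hB χ i) (X (Q.weightBasis χ i)) ∈
      liePiece B χ μ := Submodule.sum_mem _ fun i _ => Q.wedge_mem_liePiece hε hsymm
        (Q.dualWeightBasis hB χ i).2 (liePiece_mapsTo hX (Q.weightBasis χ i).2)
  have h1 : ∀ v ∈ weightSpace χ, ∑ i, B (Q.dualWeightBasis hB χ i) v • X (Q.weightBasis χ i) =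
      X v := by
    intro v hv
    conv_rhs => rw [← Q.sum_form_smul_weightBasis hB χ hv, map_sum]
    simp only [map_smul]
  -- If χ = μ⁻¹, both terms of each wedge act on V_χ and each sums to X, so c = 2. Otherwise the
  -- second term vanishes on V_χ and c = 1.
  by_cases h : χ = μ⁻¹
  · refine ⟨2, two_ne_zero, Q.liePiece_ext hB hmem (Submodule.smul_mem _ _ hX) fun v hv => ?_⟩
    have h2 : ∑ i, (ε * B (X (Q.weightBasis χ i)) v) • (Q.dualWeightBasis hB χ i : V) = - X v := by
      have hm : X v ∈ weightSpace χ⁻¹ := by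
        rw [h, character_inv_inv]
        exact liePiece_mapsTo hX hv
      conv_rhs => rw [← Q.sum_form_smul_dualWeightBasis hB χ hm]
      rw [← Finset.sum_neg_distrib]
      refine Finset.sum_congr rfl fun i _ => ?_
      rw [liePiece_skew hX, hsymm _ (X v), mul_neg, ← mul_assoc, hε2, one_mul, neg_smul]
    rw [LinearMap.sum_apply]
    simp only [wedge_apply, Finset.sum_sub_distrib, smul_smul]
    rw [h1 v hv, h2, LinearMap.smul_apply, two_smul, sub_neg_eq_add]
  · refine ⟨1, one_ne_zero, Q.liePiece_ext hB hmem (Submodule.smul_mem _ _ hX) fun v hv => ?_⟩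
    rw [LinearMap.sum_apply, one_smul, ← h1 v hv]
    refine Finset.sum_congr rfl fun i _ => ?_
    rw [wedge_apply, Q.form_eq_zero_of_ne μ χ h (liePiece_mapsTo hX (Q.weightBasis χ i).2) hv]
    simp

/-- Reduces the irreducibility statements below to producing the generators x ∧ y. -/
theorem mem_of_wedge_mem (hB : B.Nondegenerate) {ε : ℂ} (hε : ε = 1 ∨ ε = -1)
    (hsymm : ∀ x y, B x y = ε * B y x) {χ μ : Q.H →* ℂˣ} {X : V →ₗ[ℂ] V}
    (hX : X ∈ liePiece B χ μ) (U : Submodule ℂ (V →ₗ[ℂ] V))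
    (hU : ∀ x ∈ weightSpace χ⁻¹, ∀ y ∈ weightSpace μ, wedge B ε x y ∈ U) : X ∈ U := by
  obtain ⟨c, hc, h⟩ := Q.sum_wedge_eq hB hε hsymm hX
  have : c • X ∈ U := h ▸ Submodule.sum_mem _ fun i _ =>
    hU _ (Q.dualWeightBasis hB χ i).2 _ (liePiece_mapsTo hX (Q.weightBasis χ i).2)
  exact (Submodule.smul_mem_iff _ hc).1 this

end GeneralizedQuiver

/-! ### Stable subspaces of the pieces of the Lie algebra -/

namespace GeneralizedQuiver

variable {V : Type u} [NormedAddCommGroup V] [NormedSpace ℂ V] {B : LinearMap.BilinForm ℂ V}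
  (Q : GeneralizedQuiver.{u, v, w} B)

/-- `U` is stable under the adjoint action of `R`. -/
def IsAdStable (U : Submodule ℂ (V →ₗ[ℂ] V)) : Prop := ∀ r : Q.R, ∀ X ∈ U, adRep Q.R r X ∈ U

variable [FiniteDimensional ℂ V] {Q} {U : Submodule ℂ (V →ₗ[ℂ] V)}

theorem IsAdStable.conj_mem (hU : Q.IsAdStable U) {g g' : V →ₗ[ℂ] V}
    (h1 : g ∘ₗ g' = LinearMap.id) (h2 : g' ∘ₗ g = LinearMap.id)
    (hiso : ∀ x y, B (g x) (g y) = B x y)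
    (hw : ∀ χ : Q.H →* ℂˣ, ∀ x ∈ weightSpace χ, g x ∈ weightSpace χ) {X : V →ₗ[ℂ] V}
    (hX : X ∈ U) : g ∘ₗ X ∘ₗ g' ∈ U :=
  hU ⟨LinearEquiv.ofLinearMap g g' h1 h2, Q.mem_R_of_stable _ (fun χ x hx => hw χ.1 x hx)
    fun _ _ x _ y _ => hiso x y⟩ X hX

/-- Stability under the unipotent elements `1 + N`, `N² = 0`, of `R`. -/
theorem IsAdStable.comp_nilpotent_mem (hU : Q.IsAdStable U) {N : V →ₗ[ℂ] V}
    (hN : N ∈ isometryLie B) (hN2 : ∀ x, N (N x) = 0)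
    (hw : ∀ χ : Q.H →* ℂˣ, ∀ x ∈ weightSpace χ, N x ∈ weightSpace χ) {X : V →ₗ[ℂ] V}
    (hX : X ∈ U) : N ∘ₗ X - X ∘ₗ N ∈ U ∧ N ∘ₗ X ∘ₗ N ∈ U := by
  -- 1 + M lies in R with inverse 1 - M, and (1 + M)X(1 - M) = X + [M, X] - MXM. Taking M = N and M
  -- = -N separates the odd part from the even part, which replaces differentiation.
  have key : ∀ M : V →ₗ[ℂ] V, M ∈ isometryLie B → (∀ x, M (M x) = 0) →
      (∀ χ : Q.H →* ℂˣ, ∀ x ∈ weightSpace χ, M x ∈ weightSpace χ) →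
      (LinearMap.id + M) ∘ₗ X ∘ₗ (LinearMap.id - M) ∈ U := by
    intro M hM hM2 hw
    rw [mem_isometryLie] at hM
    refine hU.conj_mem ?_ ?_ ?_ ?_ hX
    · ext x
      simp [hM2]
    · ext x
      simp [hM2]
    · intro x y
      simp [hM, hM2]
    · intro χ x hx
      exact add_mem hx (hw χ x hx)
  have h1 := key N hN hN2 hw
  have h2 := key (-N) (neg_mem hN) (by simp [hN2]) fun χ x hx => neg_mem (hw χ x hx)
  constructor
  · have h3 := Submodule.smul_mem _ (1 / 2 : ℂ) (sub_mem h1 h2)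
    convert h3 using 1
    ext x
    simp only [LinearMap.sub_apply, LinearMap.add_apply, LinearMap.comp_apply, LinearMap.smul_apply,
      LinearMap.id_apply, LinearMap.neg_apply, map_sub, map_neg]
    module
  · have h3 := sub_mem (Submodule.smul_mem _ (-1 / 2 : ℂ) (add_mem h1 h2)) (neg_mem hX)
    convert h3 using 1
    ext x
    simp only [LinearMap.sub_apply, LinearMap.add_apply, LinearMap.comp_apply, LinearMap.smul_apply,
      LinearMap.id_apply, LinearMap.neg_apply, map_sub, map_neg]
    module

/-- For a real character, `v ∧ X v` is in the `R`-module generated by `X`. -/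
theorem IsAdStable.wedge_self_mem (hU : Q.IsAdStable U) {ε : ℂ} (hε : ε = 1 ∨ ε = -1)
    (hsymm : ∀ x y, B x y = ε * B y x) {χ : Q.H →* ℂˣ} (hχ : χ⁻¹ = χ) {v : V}
    (hv : v ∈ weightSpace χ) (hvv : ε = 1 → B v v ≠ 0) {X : V →ₗ[ℂ] V}
    (hXB : X ∈ isometryLie B) (hX : X ∈ U) : wedge B ε v (X v) ∈ U := by
  rw [mem_isometryLie] at hXB
  have hstab : ∀ ν : Q.H →* ℂˣ, ∀ x ∈ weightSpace ν, B v x • v ∈ weightSpace ν := by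
    intro ν x hx
    by_cases h : ν = χ
    · exact Submodule.smul_mem _ _ (h ▸ hv)
    · rw [Q.form_eq_zero_of_ne χ ν (by rwa [hχ]) hv hx, zero_smul]
      exact zero_mem _
  -- For ε = 1, the reflection s in v satisfies sXs - X = -(2 / B(v, v)) v ∧ Xv. For ε = -1, N =
  -- B(v, ·)v has square zero and [N, X] = -(v ∧ Xv).
  rcases hε with rfl | rfl
  · have hb := hvv rfl
    have hsymm' : ∀ x y, B x y = B y x := fun x y => by rw [hsymm, one_mul]
    have hXv : B v (X v) = 0 := by
      have h1 := hXB v v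
      rw [hsymm'] at h1
      linear_combination (1 / 2) * h1
    let s : V →ₗ[ℂ] V := LinearMap.id - (2 / B v v) • rankOne B v v
    have hs : ∀ x, s x = x - (2 / B v v * B v x) • v := fun x => by simp [s, smul_smul]
    have hss : s ∘ₗ s = LinearMap.id := by
      ext x
      rw [LinearMap.comp_apply, hs, hs, LinearMap.id_apply, map_sub, map_smul, smul_eq_mul, sub_sub,
        ← add_smul]
      rw [show 2 / B v v * B v x + 2 / B v v * (B v x - 2 / B v v * B v x * B v v) = 0 by
        field_simp; ring]
      simp
    have h1 := hU.conj_mem hss hss (by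
      intro x y
      rw [hs, hs]
      simp only [map_sub, map_smul, LinearMap.sub_apply, LinearMap.smul_apply, smul_eq_mul]
      rw [hsymm' x v]
      field_simp
      ring) (by
      intro ν x hx
      rw [hs]
      refine sub_mem hx ?_
      rw [← smul_smul]
      exact Submodule.smul_mem _ _ (hstab ν x hx)) hX
    have h2 := Submodule.smul_mem _ (-(B v v) / 2) (sub_mem h1 hX)
    convert h2 using 1
    ext x
    simp only [LinearMap.sub_apply, LinearMap.comp_apply, LinearMap.smul_apply, hs, map_sub,
      map_smul, wedge_apply, hXv]
    rw [hXB v x]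
    match_scalars <;> field_simp <;> ring
  · have hb : B v v = 0 := by
      have := hsymm v v
      linear_combination (1 / 2) * this
    have h1 := (hU.comp_nilpotent_mem (N := rankOne B v v) (by
      rw [mem_isometryLie]
      intro x y
      simp only [rankOne_apply, map_smul, LinearMap.smul_apply, smul_eq_mul]
      rw [hsymm x v]
      ring) (by simp [hb]) hstab hX).1
    convert neg_mem h1 using 1
    ext x
    simp only [LinearMap.sub_apply, LinearMap.comp_apply, LinearMap.neg_apply, rankOne_apply,
      map_smul, wedge_apply]
    rw [hXB v x]
    module

/-- The derived action of `x ∧ y`, for a character `χ ≠ χ⁻¹`. -/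
theorem IsAdStable.wedge_apply_mem_of_ne (hU : Q.IsAdStable U) (hB : B.Nondegenerate) {ε : ℂ}
    (hε : ε = 1 ∨ ε = -1) (hsymm : ∀ x y, B x y = ε * B y x) {χ μ : Q.H →* ℂˣ} (hχ : χ ≠ χ⁻¹)
    (hχμ : χ ≠ μ) {X : V →ₗ[ℂ] V} (hXp : X ∈ liePiece B χ μ) (hX : X ∈ U) {x y : V}
    (hx : x ∈ weightSpace χ) (hy : y ∈ weightSpace χ⁻¹) : wedge B ε y (X x) ∈ U := by
  have hε2 : ε * ε = 1 := by rcases hε with rfl | rfl <;> ring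
  have hxx : B x x = 0 := Q.form_eq_zero_of_ne _ _ hχ hx hx
  have hyy : ∀ y ∈ weightSpace χ⁻¹, B y y = 0 := fun y hy =>
    Q.form_eq_zero_of_ne _ _ (by rw [character_inv_inv]; exact hχ.symm) hy hy
  have one : ∀ y ∈ weightSpace χ⁻¹, B y x = 1 → wedge B ε y (X x) ∈ U := by
    intro y hy hyx
    have hxy : B x y = ε := by rw [hsymm, hyx, mul_one]
    -- `g s s'` multiplies x by 1 + s and y by 1 + s'. It is an isometry with inverse `g s' s` when
    -- (1 + s)(1 + s') = 1, which is the condition s + s' + ss' = 0.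
    let g : ℂ → ℂ → V →ₗ[ℂ] V := fun s s' =>
      LinearMap.id + s • rankOne B y x + (s' * ε) • rankOne B x y
    have hg : ∀ s s' v, g s s' v = v + (s * B y v) • x + (s' * ε * B x v) • y := fun s s' v => by
      simp [g, smul_smul]
    have hgg : ∀ s s', s + s' + s * s' = 0 → g s s' ∘ₗ g s' s = LinearMap.id := by
      intro s s' h
      ext v
      simp only [LinearMap.comp_apply, hg, map_add, map_smul, smul_eq_mul, hyx, hxy, hxx, hyy y hy,
        LinearMap.id_apply]
      match_scalars
      · ring
      · linear_combination (B y v) * h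
      · linear_combination (ε * B x v) * h + ε * s * s' * B x v * hε2
    have hXy : X y = 0 := by
      refine liePiece_eq_zero hXp hχ.symm (fun h => hχμ ?_) hy
      rw [← character_inv_inv χ, h, character_inv_inv]
    have hyX : ∀ v, B y (X v) = 0 := fun v => by
      have := liePiece_skew hXp y v
      rw [hXy, map_zero, LinearMap.zero_apply] at this
      linear_combination this
    have conj : ∀ s s', s + s' + s * s' = 0 → g s s' ∘ₗ X ∘ₗ g s' s ∈ U := by
      intro s s' h
      refine hU.conj_mem (hgg s s' h) (hgg s' s (by linear_combination h)) (fun a b => ?_)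
        (fun ν a ha => ?_) hX
      · simp only [hg, map_add, map_smul, smul_eq_mul, LinearMap.add_apply, LinearMap.smul_apply,
          hyx, hxy, hxx, hyy y hy]
        rw [hsymm a x, hsymm a y]
        linear_combination (ε * B x a * B y b + B y a * B x b) * h +
          (s' + s * s') * B y a * B x b * hε2
      · rw [hg]
        refine add_mem (add_mem ha ?_) ?_
        · by_cases h : ν = χ
          · exact Submodule.smul_mem _ _ (h ▸ hx)
          · rw [Q.form_eq_zero_of_ne _ _ (by rwa [character_inv_inv]) hy ha]
            simp
        · by_cases h : ν = χ⁻¹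
          · exact Submodule.smul_mem _ _ (h ▸ hy)
          · rw [Q.form_eq_zero_of_ne _ _ h hx ha]
            simp
    -- Since Xy = 0 and B(y, X·) = 0, the conjugate of X by `g s s'` is X + s'L + s'²Q with L = y ∧
    -- Xx. The values s' = 1 and s' = -2 give L + Q and -2L + 4Q, and 2/3 of the first minus 1/6 of
    -- the second is L.
    have h1 := sub_mem (conj (-1 / 2) 1 (by ring)) hX
    have h2 := sub_mem (conj (-2) (-2) (by ring)) hX
    have h3 := sub_mem (Submodule.smul_mem _ (2 / 3 : ℂ) h1) (Submodule.smul_mem _ (1 / 6 : ℂ) h2)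
    convert h3 using 1
    ext v
    simp only [LinearMap.sub_apply, LinearMap.comp_apply, LinearMap.smul_apply, hg, map_add,
      map_smul, wedge_apply, hXy, hyX, liePiece_skew hXp x v, map_zero, smul_zero]
    module
  by_cases hx0 : x = 0
  · simp [hx0]
  -- A general y is a combination of two vectors whose pairing with x is 1.
  obtain ⟨y₀, hy₀, h₀⟩ := Q.exists_pairing_eq_one' hB hε hsymm χ hx hx0
  have h1 := one (y + (1 - B y x) • y₀) (add_mem hy (Submodule.smul_mem _ _ hy₀)) (by
    rw [map_add, map_smul, LinearMap.add_apply, LinearMap.smul_apply, h₀, smul_eq_mul]; ring)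
  have h2 := sub_mem h1 (Submodule.smul_mem _ (1 - B y x) (one y₀ hy₀ h₀))
  rwa [map_add, map_smul, LinearMap.add_apply, LinearMap.smul_apply, add_sub_cancel_right] at h2

omit [FiniteDimensional ℂ V] in
/-- A line through an anisotropic vector contains an anisotropic vector. -/
theorem exists_anisotropic_add_smul (hsymm : ∀ x y, B x y = B y x) {v : V} (hv : B v v ≠ 0)
    (z : V) : ∃ t : ℂ, B (z + t • v) (z + t • v) ≠ 0 ∧ B v (z + t • v) ≠ 0 := by
  have key : ∀ s : ℂ, s ≠ 0 → s ^ 2 ≠ B v z ^ 2 - B z z * B v v →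
      ∃ t : ℂ, B (z + t • v) (z + t • v) ≠ 0 ∧ B v (z + t • v) ≠ 0 := by
    intro s hs h
    -- This t makes B(v, z + tv) = s, and then B(v, v)B(z + tv, z + tv) = s² - (B(v, z)² - B(z,
    -- z)B(v, v)). One of s = 1, 2 avoids the excluded value of s².
    refine ⟨(s - B v z) / B v v, ?_, ?_⟩
    · simp only [map_add, map_smul, LinearMap.add_apply, LinearMap.smul_apply, smul_eq_mul]
      rw [hsymm z v]
      intro h0
      refine h ?_
      field_simp at h0
      linear_combination h0
    · simp only [map_add, map_smul, smul_eq_mul]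
      rw [div_mul_cancel₀ _ hv]
      simpa using hs
  by_cases h : (1 : ℂ) ^ 2 = B v z ^ 2 - B z z * B v v
  · refine key 2 two_ne_zero fun h' => ?_
    rw [← h'] at h
    norm_num at h
  · exact key 1 one_ne_zero h

/-- For a real character, the vectors `v` to which `wedge_self_mem` applies span `V_χ`. -/
theorem exists_admissible_add_smul (hB : B.Nondegenerate) {ε : ℂ} (hε : ε = 1 ∨ ε = -1)
    (hsymm : ∀ x y, B x y = ε * B y x) {χ : Q.H →* ℂˣ} (hχ : χ⁻¹ = χ) {v : V}
    (hv : v ∈ weightSpace χ) (hv0 : v ≠ 0) (hvv : ε = 1 → B v v ≠ 0) :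
    ∃ v' ∈ weightSpace χ, (ε = 1 → B v' v' ≠ 0) ∧ (B v v' ≠ 0) ∧
      ∀ z ∈ weightSpace χ, ∃ t : ℂ,
        (ε = 1 → B (z + t • v') (z + t • v') ≠ 0) ∧ B v (z + t • v') ≠ 0 := by
  rcases hε with rfl | rfl
  · have hb := hvv rfl
    refine ⟨v, hv, hvv, hb, fun z _ => ?_⟩
    obtain ⟨t, h1, h2⟩ := exists_anisotropic_add_smul (fun x y => by rw [hsymm, one_mul]) hb z
    exact ⟨t, fun _ => h1, h2⟩
  · obtain ⟨u, hu, h1⟩ := Q.exists_pairing_eq_one hB χ hv hv0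
    rw [hχ] at hu
    refine ⟨u, hu, fun h => by norm_num at h, by simp [h1], fun z _ => ?_⟩
    refine ⟨1 - B v z, fun h => by norm_num at h, ?_⟩
    simp [h1]

/-- If v, u and v + u were all isotropic, polarization would give B(v, u) = 0. -/
theorem exists_anisotropic (hB : B.Nondegenerate) (hsymm : ∀ x y, B x y = B y x) {χ : Q.H →* ℂˣ}
    (hχ : χ⁻¹ = χ) {v : V} (hv : v ∈ weightSpace χ) (hv0 : v ≠ 0) :
    ∃ v₀ ∈ weightSpace χ, B v₀ v₀ ≠ 0 := by
  obtain ⟨u, hu, h1⟩ := Q.exists_pairing_eq_one hB χ hv hv0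
  rw [hχ] at hu
  by_contra! hcon
  have h := hcon (v + u) (add_mem hv hu)
  simp only [map_add, LinearMap.add_apply] at h
  rw [hcon v hv, hcon u hu, hsymm u v, h1] at h
  norm_num at h

theorem exists_admissible (hB : B.Nondegenerate) {ε : ℂ} (hε : ε = 1 ∨ ε = -1)
    (hsymm : ∀ x y, B x y = ε * B y x) {χ : Q.H →* ℂˣ} (hχ : χ⁻¹ = χ) {v : V}
    (hv : v ∈ weightSpace χ) (hv0 : v ≠ 0) :
    ∃ v₀ ∈ weightSpace χ, v₀ ≠ 0 ∧ (ε = 1 → B v₀ v₀ ≠ 0) := by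
  rcases hε with rfl | rfl
  · obtain ⟨v₀, h1, h2⟩ := exists_anisotropic hB (fun x y => by rw [hsymm, one_mul]) hχ hv hv0
    exact ⟨v₀, h1, fun h => h2 (by simp [h]), fun _ => h2⟩
  · exact ⟨v, hv, hv0, fun h => by norm_num at h⟩

theorem IsAdStable.wedge_apply_mem (hU : Q.IsAdStable U) (hB : B.Nondegenerate) {ε : ℂ}
    (hε : ε = 1 ∨ ε = -1) (hsymm : ∀ x y, B x y = ε * B y x) {χ μ : Q.H →* ℂˣ}
    (hχμ : χ ≠ μ) {X : V →ₗ[ℂ] V} (hXp : X ∈ liePiece B χ μ) (hX : X ∈ U) {x y : V}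
    (hx : x ∈ weightSpace χ) (hy : y ∈ weightSpace χ⁻¹) : wedge B ε y (X x) ∈ U := by
  by_cases hχ : χ = χ⁻¹
  swap
  · exact hU.wedge_apply_mem_of_ne hB hε hsymm hχ hχμ hXp hX hx hy
  have hχ' := hχ.symm
  rw [hχ'] at hy
  have h0 : ∀ v ∈ weightSpace χ, ∀ z ∈ weightSpace χ, B (X v) z = 0 := fun v hv z hz =>
    Q.form_eq_zero_of_ne μ χ (fun h => hχμ (by rw [← hχ', h, character_inv_inv]))
      (liePiece_mapsTo hXp hv) hz
  have step1 : ∀ v ∈ weightSpace χ, v ≠ 0 → (ε = 1 → B v v ≠ 0) → ∀ z ∈ weightSpace χ,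
      wedge B ε z (X v) ∈ U := by
    intro v hv hv0 hvv
    -- Applying `wedge_self_mem` with v and then with z turns X into z ∧ (v ∧ Xv)z = B(v, z) z ∧ Xv;
    -- the other term vanishes because χ ≠ μ gives B(Xv, z) = 0.
    have good : ∀ z ∈ weightSpace χ, (ε = 1 → B z z ≠ 0) → B v z ≠ 0 →
        wedge B ε z (X v) ∈ U := by
      intro z hz hzz hvz
      have h1 := hU.wedge_self_mem hε hsymm hχ' hz hzz (wedge_mem_isometryLie hε hsymm v (X v))
        (hU.wedge_self_mem hε hsymm hχ' hv hvv hXp.1 hX)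
      rw [wedge_apply, h0 v hv z hz, zero_smul, smul_zero, sub_zero, map_smul] at h1
      exact (Submodule.smul_mem_iff _ hvz).1 h1
    obtain ⟨v', hv', h1, h2, h3⟩ := exists_admissible_add_smul hB hε hsymm hχ' hv hv0 hvv
    intro z hz
    obtain ⟨t, ht1, ht2⟩ := h3 z hz
    have h4 := sub_mem (good _ (add_mem hz (Submodule.smul_mem _ t hv')) ht1 ht2)
      (Submodule.smul_mem _ t (good v' hv' h1 h2))
    rwa [map_add, map_smul, LinearMap.add_apply, LinearMap.smul_apply, add_sub_cancel_right] at h4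
  by_cases hx0 : x = 0
  · simp [hx0]
  -- x itself may be isotropic, so it is written as the difference of the vectors x + tv' and tv',
  -- with x + tv' and v' both covered by `step1`.
  obtain ⟨v, hv, hv0, hvv⟩ := exists_admissible hB hε hsymm hχ' hx hx0
  obtain ⟨v', hv', h1, h2, h3⟩ := exists_admissible_add_smul hB hε hsymm hχ' hv hv0 hvv
  obtain ⟨t, ht1, ht2⟩ := h3 x hx
  have hm := step1 _ (add_mem hx (Submodule.smul_mem _ t hv')) (fun h => ht2 (by rw [h, map_zero]))
    ht1 y hy
  have hm' := step1 v' hv' (fun h => h2 (by rw [h, map_zero])) h1 y hy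
  have h4 := sub_mem hm (Submodule.smul_mem _ t hm')
  rwa [map_add, map_smul, map_add, map_smul, add_sub_cancel_right] at h4

/-- Irreducibility of `liePiece χ μ` for `χ ≠ μ`. -/
theorem IsAdStable.wedge_mem_of_ne (hU : Q.IsAdStable U) (hB : B.Nondegenerate) {ε : ℂ}
    (hε : ε = 1 ∨ ε = -1) (hsymm : ∀ x y, B x y = ε * B y x) {χ μ : Q.H →* ℂˣ}
    (hχμ : χ ≠ μ) {X : V →ₗ[ℂ] V} (hXp : X ∈ liePiece B χ μ) (hX : X ∈ U) (hX0 : X ≠ 0) {x y : V}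
    (hx : x ∈ weightSpace χ⁻¹) (hy : y ∈ weightSpace μ) : wedge B ε x y ∈ U := by
  obtain ⟨a, ha, ha0⟩ : ∃ a ∈ weightSpace χ, X a ≠ 0 := by
    by_contra! hcon
    exact hX0 (Q.liePiece_ext hB hXp (zero_mem _) fun x hx => by rw [hcon x hx]; rfl)
  set w := X a with hw
  have hwμ : w ∈ weightSpace μ := liePiece_mapsTo hXp ha
  have h1 : ∀ x ∈ weightSpace χ⁻¹, wedge B ε x w ∈ U := fun x hx =>
    hU.wedge_apply_mem hB hε hsymm hχμ hXp hX ha hx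
  -- x ∧ w also lies in the piece for (μ⁻¹, χ⁻¹), so the same procedure at z replaces w: it yields y
  -- ∧ (x ∧ w)z = B(x, z) y ∧ w - ε y ∧ x. The first term is zero unless χ = μ⁻¹, and in that case y
  -- ∈ V_{χ⁻¹} and the term is already in U.
  obtain ⟨z, hz, hwz⟩ := Q.exists_pairing_eq_one hB μ hwμ ha0
  have h2 : wedge B ε x w ∈ liePiece B μ⁻¹ χ⁻¹ := by
    rw [liePiece_swap]
    exact Q.wedge_mem_liePiece hε hsymm hx hwμ
  have h3 : wedge B ε y (wedge B ε x w z) ∈ U :=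
    hU.wedge_apply_mem hB hε hsymm (fun h => hχμ (by
      rw [← character_inv_inv χ, ← h, character_inv_inv])) h2 (h1 x hx) hz
      (by rwa [character_inv_inv])
  have h4 : B x z • wedge B ε y w ∈ U := by
    by_cases h : χ = μ⁻¹
    · refine Submodule.smul_mem _ _ (h1 y ?_)
      rwa [h, character_inv_inv]
    · rw [Q.form_eq_zero_of_ne χ⁻¹ μ⁻¹ (by rw [character_inv_inv]; exact fun h' => h h'.symm) hx hz,
        zero_smul]
      exact zero_mem _
  rw [wedge_apply, map_sub, map_smul, map_smul, map_smul, hwz, one_smul,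
    wedge_swap hε x y, smul_smul] at h3
  have h5 := sub_mem h4 h3
  rw [sub_sub_cancel] at h5
  refine (Submodule.smul_mem_iff _ ?_).1 h5
  rcases hε with rfl | rfl <;> norm_num

end GeneralizedQuiver

/-! ### Stable subspaces for χ = μ: symplectic, orthogonal and general linear pieces -/

namespace GeneralizedQuiver

variable {V : Type u} [NormedAddCommGroup V] [NormedSpace ℂ V] {B : LinearMap.BilinForm ℂ V}
  {Q : GeneralizedQuiver.{u, v, w} B} [FiniteDimensional ℂ V] {U : Submodule ℂ (V →ₗ[ℂ] V)}

/-- Irreducibility of `𝔰𝔭(V_χ)`. -/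
theorem IsAdStable.wedge_mem_symplectic (hU : Q.IsAdStable U) (hB : B.Nondegenerate)
    (hsymm : ∀ x y, B x y = -1 * B y x) {χ : Q.H →* ℂˣ} (hχ : χ⁻¹ = χ)
    {X : V →ₗ[ℂ] V} (hXp : X ∈ liePiece B χ χ) (hX : X ∈ U) (hX0 : X ≠ 0) {x y : V}
    (hx : x ∈ weightSpace χ) (hy : y ∈ weightSpace χ) : wedge B (-1) x y ∈ U := by
  have hself : ∀ v, B v v = 0 := fun v => by linear_combination (1 / 2) * hsymm v v
  have hnil : ∀ v ∈ weightSpace χ, ∀ Y ∈ U, rankOne B v v ∘ₗ Y ∘ₗ rankOne B v v ∈ U := by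
    intro v hv Y hY
    refine (hU.comp_nilpotent_mem ?_ (by simp [hself]) (fun ν z hz => ?_) hY).2
    · rw [mem_isometryLie]
      intro x y
      simp only [rankOne_apply, map_smul, LinearMap.smul_apply, smul_eq_mul]
      rw [hsymm x v]
      ring
    · rw [rankOne_apply]
      by_cases h : ν = χ
      · exact Submodule.smul_mem _ _ (h ▸ hv)
      · rw [Q.form_eq_zero_of_ne χ ν (by rwa [hχ]) hv hz, zero_smul]
        exact zero_mem _
  -- For N = B(v, ·)v, NYN is a multiple of N, so a single Y in U with B(v, Yv) ≠ 0 puts N in U.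
  have hcomp : ∀ v Y, rankOne B v v ∘ₗ Y ∘ₗ rankOne B v v = B v (Y v) • rankOne B v v := by
    intro v Y
    ext z
    simp [smul_smul, mul_comm]
  -- The form B(·, X·) is symmetric here, so it is determined by its quadratic form.
  obtain ⟨v, hv, hvX⟩ : ∃ v ∈ weightSpace χ, B v (X v) ≠ 0 := by
    by_contra! hcon
    refine hX0 (Q.liePiece_ext hB hXp (zero_mem _) fun a ha => ?_)
    refine Q.nondegenerate_weightSpace hB χ (liePiece_mapsTo hXp ha) fun b hb => ?_
    rw [hχ] at hb
    have h := hcon (a + b) (add_mem ha hb)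
    simp only [map_add, LinearMap.add_apply] at h
    rw [hcon a ha, hcon b hb, ← neg_eq_iff_eq_neg.2 (liePiece_skew hXp a b), hsymm b (X a)] at h
    linear_combination (-1 / 2) * h
  have hv0 : v ≠ 0 := fun h => hvX (by simp [h])
  have h1 : rankOne B v v ∈ U := by
    have := hnil v hv X hX
    rw [hcomp] at this
    exact (Submodule.smul_mem_iff _ hvX).1 this
  have step : ∀ v ∈ weightSpace χ, rankOne B v v ∈ U → ∀ w ∈ weightSpace χ, B v w ≠ 0 →
      rankOne B w w ∈ U := by
    intro v _ h w hw hvw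
    have := hnil w hw _ h
    rw [hcomp, rankOne_apply, map_smul, smul_eq_mul, hsymm w v] at this
    exact (Submodule.smul_mem_iff _ (mul_ne_zero hvw (by simpa using hvw))).1 this
  have all : ∀ w ∈ weightSpace χ, rankOne B w w ∈ U := by
    intro w hw
    by_cases hw0 : w = 0
    · simp [hw0]
    obtain ⟨u₁, hu₁, h₁⟩ := Q.exists_pairing_eq_one hB χ hv hv0
    obtain ⟨u₂, hu₂, h₂⟩ := Q.exists_pairing_eq_one' hB (Or.inr rfl) hsymm χ hw hw0
    rw [hχ] at hu₁ hu₂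
    -- Any nonzero w is reached from v through some u orthogonal to neither; if `u₁` and `u₂` both
    -- fail, their sum works.
    have key : ∀ u ∈ weightSpace χ, B v u ≠ 0 → B u w ≠ 0 → rankOne B w w ∈ U :=
      fun u hu h h' => step u hu (step v hv h1 u hu h) w hw h'
    by_cases h3 : B u₁ w = 0
    · by_cases h4 : B v u₂ = 0
      · exact key (u₁ + u₂) (add_mem hu₁ hu₂) (by simp [h₁, h4]) (by simp [h₂, h3])
      · exact key u₂ hu₂ h4 (by simp [h₂])
    · exact key u₁ hu₁ (by simp [h₁]) h3
  -- For ε = -1, x ∧ y is the polarization of v ↦ B(v, ·)v.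
  have h := sub_mem (sub_mem (all _ (add_mem hx hy)) (all x hx)) (all y hy)
  convert h using 1
  simp only [wedge, map_add, LinearMap.add_apply, LinearMap.sub_apply, LinearMap.smul_apply,
    LinearMap.flip_apply]
  module

/-- Irreducibility of `𝔬(V_χ)`. -/
theorem IsAdStable.wedge_mem_orthogonal (hU : Q.IsAdStable U) (hB : B.Nondegenerate)
    (hsymm : ∀ x y, B x y = 1 * B y x) {χ : Q.H →* ℂˣ} (hχ : χ⁻¹ = χ)
    {X : V →ₗ[ℂ] V} (hXp : X ∈ liePiece B χ χ) (hX : X ∈ U) (hX0 : X ≠ 0) {x y : V}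
    (hx : x ∈ weightSpace χ) (hy : y ∈ weightSpace χ) : wedge B 1 x y ∈ U := by
  have hε : (1 : ℂ) = 1 ∨ (1 : ℂ) = -1 := Or.inl rfl
  let C : LinearMap.BilinForm ℂ (weightSpace χ) :=
    B.domRestrict₁₂ (weightSpace χ) (weightSpace χ)
  have hCs : LinearMap.IsSymm C := ⟨fun a b => by
    have := hsymm a b
    rwa [one_mul] at this⟩
  have hCn : ∀ a : weightSpace χ, (∀ b, C a b = 0) → a = 0 := fun a ha =>
    Subtype.ext (Q.nondegenerate_weightSpace hB χ a.2 fun b hb => ha ⟨b, hχ ▸ hb⟩)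
  obtain ⟨e, he⟩ := LinearMap.BilinForm.exists_orthogonal_basis (B := C) hCs
  have horth : ∀ i j, i ≠ j → B (e i) (e j) = 0 := fun i j h => he h
  have hanis : ∀ i, B (e i) (e i) ≠ 0 := by
    intro i h0
    refine e.ne_zero i (hCn _ fun b => ?_)
    have : C (e i) = 0 := e.ext fun j => by
      by_cases h : i = j
      · subst h
        exact h0
      · exact horth i j h
    rw [this, LinearMap.zero_apply]
  -- Using reflections, and not just the identity component, is what covers dimension 4, where 𝔰𝔬(4)
  -- is not simple.
  have refl : ∀ v ∈ weightSpace χ, B v v ≠ 0 → ∀ Y ∈ U, Y ∈ isometryLie B →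
      wedge B 1 v (Y v) ∈ U := fun v hv hvv Y hY hYB =>
    hU.wedge_self_mem hε hsymm hχ hv (fun _ => hvv) hYB hY
  have hswap : ∀ i j, wedge B 1 (e i : V) (e j) ∈ U → wedge B 1 (e j : V) (e i) ∈ U := by
    intro i j h
    rw [wedge_swap hε]
    exact Submodule.smul_mem _ _ h
  have hwl := wedge_mem_isometryLie hε hsymm
  obtain ⟨i, j, hij⟩ : ∃ i j, B (X (e j)) (e i) ≠ 0 := by
    by_contra! hcon
    refine hX0 (Q.liePiece_ext hB hXp (zero_mem _) fun a ha => ?_)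
    let D : weightSpace χ →ₗ[ℂ] weightSpace χ →ₗ[ℂ] ℂ :=
      (B ∘ₗ X).domRestrict₁₂ (weightSpace χ) (weightSpace χ)
    have hD : D = 0 := e.ext fun j => e.ext fun i => hcon i j
    refine Q.nondegenerate_weightSpace hB χ (liePiece_mapsTo hXp ha) fun b hb => ?_
    rw [hχ] at hb
    exact LinearMap.congr_fun₂ hD ⟨a, ha⟩ ⟨b, hb⟩
  have hne : i ≠ j := by
    rintro rfl
    have := liePiece_skew hXp (e i) (e i)
    rw [hsymm (e i) (X (e i))] at this
    exact hij (by linear_combination (1 / 2) * this)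
  -- Reflecting in e_j and then in e_i sends X to -B(Xe_j, e_i) e_i ∧ e_j, which isolates a nonzero
  -- matrix entry.
  have h1 : wedge B 1 (e i : V) (e j) ∈ U := by
    have h2 := refl _ (e i).2 (hanis i) _ (refl _ (e j).2 (hanis j) X hX hXp.1) (hwl _ _)
    rw [wedge_apply, horth j i hne.symm, zero_smul, zero_sub, one_smul, map_neg, map_smul] at h2
    exact (Submodule.smul_mem_iff _ hij).1 ((Submodule.neg_mem_iff _).1 h2)
  have step : ∀ i j, i ≠ j → wedge B 1 (e i : V) (e j) ∈ U → ∀ k, wedge B 1 (e k : V) (e j) ∈ U := by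
    intro i j hij h k
    by_cases hkj : k = j
    · subst hkj
      have : wedge B 1 (e k : V) (e k) = 0 := by ext v; simp
      rw [this]
      exact zero_mem _
    by_cases hki : k = i
    · rwa [hki]
    -- Applied to e_i ∧ e_j, the reflection in v = e_i + te_k gives B(e_i, e_i) v ∧ e_j, and hence
    -- e_k ∧ e_j. If t = 1 makes v isotropic, t = 2 gives B(v, v) = 3B(e_k, e_k) ≠ 0.
    obtain ⟨t, ht, htz⟩ : ∃ t : ℂ, t ≠ 0 ∧
        B ((e i : V) + t • (e k : V)) ((e i : V) + t • (e k : V)) ≠ 0 := by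
      simp only [map_add, map_smul, LinearMap.add_apply, LinearMap.smul_apply, smul_eq_mul,
        horth i k (Ne.symm hki), horth k i hki]
      by_cases h : B (e i) (e i) + B (e k) (e k) = 0
      · refine ⟨2, two_ne_zero, fun h' => hanis k ?_⟩
        linear_combination (1 / 3) * h' - (1 / 3) * h
      · exact ⟨1, one_ne_zero, fun h' => h (by linear_combination h')⟩
    have h2 := refl _ (add_mem (e i).2 (Submodule.smul_mem _ t (e k).2)) htz _ h (hwl _ _)
    simp only [wedge_apply, map_add, map_smul, LinearMap.add_apply, LinearMap.smul_apply,
      horth i k (Ne.symm hki), horth j i hij.symm, horth j k (Ne.symm hkj), smul_zero, add_zero,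
      zero_smul, sub_zero] at h2
    have h3 := sub_mem ((Submodule.smul_mem_iff _ (hanis i)).1 h2) h
    rw [add_sub_cancel_left] at h3
    exact (Submodule.smul_mem_iff _ ht).1 h3
  have all : ∀ k l, wedge B 1 (e k : V) (e l) ∈ U := by
    intro k l
    by_cases hl : l = j
    · rw [hl]
      exact step i j hne h1 k
    · exact step j l (Ne.symm hl) (hswap _ _ (step i j hne h1 l)) k
  let D : weightSpace χ →ₗ[ℂ] weightSpace χ →ₗ[ℂ] ((V →ₗ[ℂ] V) ⧸ U) :=
    ((wedge B 1).compr₂ U.mkQ).domRestrict₁₂ (weightSpace χ) (weightSpace χ)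
  have hD : D = 0 := e.ext fun k => e.ext fun l => (Submodule.Quotient.mk_eq_zero U).2 (all k l)
  exact (Submodule.Quotient.mk_eq_zero U).1 (LinearMap.congr_fun₂ hD ⟨x, hx⟩ ⟨y, hy⟩)

/-- A bilinear map on `V_{χ⁻¹} × V_χ` which vanishes where the form does is a multiple of it. -/
theorem exists_eq_form_smul (hB : B.Nondegenerate) {ε : ℂ} (hε : ε = 1 ∨ ε = -1)
    (hsymm : ∀ x y, B x y = ε * B y x) (χ : Q.H →* ℂˣ) {N : Type*} [AddCommGroup N] [Module ℂ N]
    (C : V →ₗ[ℂ] V →ₗ[ℂ] N)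
    (hC : ∀ x ∈ weightSpace χ⁻¹, ∀ y ∈ weightSpace χ, B x y = 0 → C x y = 0) :
    ∃ c : N, ∀ x ∈ weightSpace χ⁻¹, ∀ y ∈ weightSpace χ, C x y = B x y • c := by
  by_cases hbot : weightSpace χ = ⊥
  · refine ⟨0, fun x _ y hy => ?_⟩
    rw [hbot, Submodule.mem_bot] at hy
    simp [hy]
  obtain ⟨y₀, hy₀, hne⟩ := (Submodule.ne_bot_iff _).1 hbot
  obtain ⟨x₀, hx₀, h₀⟩ := Q.exists_pairing_eq_one' hB hε hsymm χ hy₀ hne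
  have hl : ∀ y ∈ weightSpace χ, C x₀ y = B x₀ y • C x₀ y₀ := by
    intro y hy
    have := hC x₀ hx₀ (y - B x₀ y • y₀) (sub_mem hy (Submodule.smul_mem _ _ hy₀)) (by simp [h₀])
    rwa [map_sub, map_smul, sub_eq_zero] at this
  have hr : ∀ x ∈ weightSpace χ⁻¹, C x y₀ = B x y₀ • C x₀ y₀ := by
    intro x hx
    have := hC (x - B x y₀ • x₀) (sub_mem hx (Submodule.smul_mem _ _ hx₀)) y₀ hy₀ (by simp [h₀])
    rwa [map_sub, map_smul, LinearMap.sub_apply, LinearMap.smul_apply, sub_eq_zero] at this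
  refine ⟨C x₀ y₀, fun x hx y hy => ?_⟩
  obtain ⟨s, hs⟩ : ∃ s : ℂ, B x y₀ + s ≠ 0 := by
    by_cases h : B x y₀ = 0
    · exact ⟨1, by simp [h]⟩
    · exact ⟨0, by simpa using h⟩
  -- Chosen so that B(x + sx₀, y + ty₀) = 0. Expanding C at this pair leaves C(x, y) as the only
  -- term not yet known; s keeps the denominator nonzero.
  let t : ℂ := -(B x y + s * B x₀ y) / (B x y₀ + s)
  have ht : t * (B x y₀ + s) = -(B x y + s * B x₀ y) := div_mul_cancel₀ _ hs
  have h := hC (x + s • x₀) (add_mem hx (Submodule.smul_mem _ _ hx₀)) (y + t • y₀)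
    (add_mem hy (Submodule.smul_mem _ _ hy₀)) (by
      simp only [map_add, map_smul, LinearMap.add_apply, LinearMap.smul_apply, smul_eq_mul, h₀]
      linear_combination ht)
  simp only [map_add, map_smul, LinearMap.add_apply, LinearMap.smul_apply] at h
  rw [hl y hy, hr x hx] at h
  rw [← sub_eq_zero, ← h]
  match_scalars
  · ring
  · linear_combination -ht

/-- The subspace generated by a non-scalar element of `𝔤𝔩(V_χ)` contains `𝔰𝔩(V_χ)`. -/
theorem IsAdStable.wedge_mem_of_form_eq_zero (hU : Q.IsAdStable U) (hB : B.Nondegenerate) {ε : ℂ}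
    (hε : ε = 1 ∨ ε = -1) (hsymm : ∀ x y, B x y = ε * B y x) {χ : Q.H →* ℂˣ} (hχ : χ ≠ χ⁻¹)
    {X : V →ₗ[ℂ] V} (hXp : X ∈ liePiece B χ χ) (hX : X ∈ U) {r : Q.R} (hr : adRep Q.R r X ≠ X)
    {x y : V} (hx : x ∈ weightSpace χ⁻¹) (hy : y ∈ weightSpace χ) (hxy : B x y = 0) :
    wedge B ε x y ∈ U := by
  have hε2 : ε * ε = 1 := by rcases hε with rfl | rfl <;> ring
  have hyy : ∀ y ∈ weightSpace χ, ∀ z ∈ weightSpace χ, B y z = 0 := fun y hy z hz =>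
    Q.form_eq_zero_of_ne _ _ hχ hy hz
  have hxx : ∀ x ∈ weightSpace χ⁻¹, ∀ z ∈ weightSpace χ⁻¹, B x z = 0 := fun x hx z hz =>
    Q.form_eq_zero_of_ne _ _ (by rw [character_inv_inv]; exact hχ.symm) hx hz
  -- When B(x, y) = 0, N = x ∧ y has square zero and NYN = B(x, Yy)N.
  have hnil : ∀ x ∈ weightSpace χ⁻¹, ∀ y ∈ weightSpace χ, B x y = 0 → ∀ Y ∈ U,
      Y ∈ liePiece B χ χ → B x (Y y) ≠ 0 → wedge B ε x y ∈ U := by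
    intro x hx y hy hxy Y hY hYp h
    have hyx : B y x = 0 := by rw [hsymm, hxy, mul_zero]
    have hw := Q.wedge_mem_liePiece hε hsymm hx hy
    have h1 := (hU.comp_nilpotent_mem hw.1 (fun v => by
      simp [hxx x hx x hx, hyy y hy y hy, hxy, hyx]) (fun ν z hz => by
      rw [wedge_apply]
      refine sub_mem ?_ (Submodule.smul_mem _ _ ?_)
      · by_cases h : ν = χ
        · exact Submodule.smul_mem _ _ (h ▸ hy)
        · rw [Q.form_eq_zero_of_ne χ⁻¹ ν (by rwa [character_inv_inv]) hx hz, zero_smul]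
          exact zero_mem _
      · by_cases h : ν = χ⁻¹
        · exact Submodule.smul_mem _ _ (h ▸ hx)
        · rw [Q.form_eq_zero_of_ne χ ν h hy hz, zero_smul]
          exact zero_mem _) hY).2
    refine (Submodule.smul_mem_iff _ h).1 ?_
    convert h1 using 1
    ext v
    have e1 : B y (Y x) = -ε * B x (Y y) := by
      rw [← neg_eq_iff_eq_neg.2 (liePiece_skew hYp y x), hsymm]; ring
    simp only [LinearMap.comp_apply, LinearMap.smul_apply, wedge_apply, map_sub, map_smul,
      hyy y hy _ (liePiece_mapsTo hYp hy),
      hxx x hx _ (liePiece_mapsTo' hYp hx), e1]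
    match_scalars
    · ring
    · linear_combination (ε * B x (Y y) * B y v) * hε2
  -- If B(x, Xy) vanished whenever B(x, y) does, X would be scalar on V_χ and hence fixed by R.
  obtain ⟨x₀, hx₀, y₀, hy₀, h₀, hX₀⟩ : ∃ x ∈ weightSpace χ⁻¹, ∃ y ∈ weightSpace χ,
      B x y = 0 ∧ B x (X y) ≠ 0 := by
    by_contra! hcon
    obtain ⟨c, hc⟩ := exists_eq_form_smul hB hε hsymm χ (B.compl₂ X) hcon
    have hXs : ∀ y ∈ weightSpace χ, X y = c • y := by
      intro y hy
      rw [← sub_eq_zero]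
      refine Q.nondegenerate_weightSpace hB χ
        (sub_mem (liePiece_mapsTo hXp hy) (Submodule.smul_mem _ _ hy)) fun x hx => ?_
      have := hc x hx y hy
      rw [LinearMap.compl₂_apply, smul_eq_mul] at this
      rw [hsymm, map_sub, map_smul, this, smul_eq_mul]
      ring
    refine hr (Q.liePiece_ext hB (Q.adRep_mem_liePiece r hXp) hXp fun y hy => ?_)
    by_cases hbot : weightSpace χ = ⊥
    · rw [hbot, Submodule.mem_bot] at hy
      simp [hy]
    rw [adRep_apply, hXs _ (Q.act_mem r⁻¹ ⟨χ, hbot⟩ y hy), hXs y hy, map_smul,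
      ← LinearEquiv.mul_apply, ← Subgroup.coe_mul, mul_inv_cancel]
    rfl
  -- Uses B(x', (x ∧ y)y') = B(x, y')B(x', y). When B(x', y) = 0, x' is shifted by x₁ with B(x₁, y')
  -- = 0 and B(x₁, y) = 1.
  have claim₁ : ∀ x ∈ weightSpace χ⁻¹, ∀ y ∈ weightSpace χ, B x y = 0 → y ≠ 0 →
      wedge B ε x y ∈ U → ∀ y' ∈ weightSpace χ, B x y' ≠ 0 → ∀ x' ∈ weightSpace χ⁻¹,
      B x' y' = 0 → wedge B ε x' y' ∈ U := by
    intro x hx y hy hxy hy0 hw y' hy' hxy'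
    have hwp := Q.wedge_mem_liePiece hε hsymm hx hy
    have good : ∀ x' ∈ weightSpace χ⁻¹, B x' y' = 0 → B x' y ≠ 0 → wedge B ε x' y' ∈ U := by
      intro x' hx' h h'
      refine hnil x' hx' y' hy' h _ hw hwp ?_
      rw [wedge_apply, hyy y hy y' hy', zero_smul, smul_zero, sub_zero, map_smul, smul_eq_mul]
      exact mul_ne_zero hxy' h'
    obtain ⟨a, ha, hay⟩ := Q.exists_pairing_eq_one' hB hε hsymm χ hy hy0
    let x₁ := a - (B a y' / B x y') • x
    have hx₁ : x₁ ∈ weightSpace χ⁻¹ := sub_mem ha (Submodule.smul_mem _ _ hx)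
    have h1 : B x₁ y' = 0 := by
      simp only [x₁, map_sub, map_smul, LinearMap.sub_apply, LinearMap.smul_apply, smul_eq_mul]
      rw [div_mul_cancel₀ _ hxy', sub_self]
    have h2 : B x₁ y = 1 := by
      simp only [x₁, map_sub, map_smul, LinearMap.sub_apply, LinearMap.smul_apply, smul_eq_mul, hxy,
        hay]
      ring
    intro x' hx' h
    by_cases h' : B x' y = 0
    · have h3 := sub_mem (good (x' + x₁) (add_mem hx' hx₁) (by simp [h, h1]) (by simp [h', h2]))
        (good x₁ hx₁ h1 (by simp [h2]))
      rwa [map_add, LinearMap.add_apply, add_sub_cancel_right] at h3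
    · exact good x' hx' h h'
  -- Removes the condition B(x, y') ≠ 0 by shifting y' by y₁.
  have claim₂ : ∀ x ∈ weightSpace χ⁻¹, ∀ y ∈ weightSpace χ, B x y = 0 → y ≠ 0 →
      wedge B ε x y ∈ U → ∀ x' ∈ weightSpace χ⁻¹, (∃ y₁ ∈ weightSpace χ, B x' y₁ = 0 ∧
      B x y₁ ≠ 0) → ∀ y' ∈ weightSpace χ, B x' y' = 0 → wedge B ε x' y' ∈ U := by
    rintro x hx y hy hxy hy0 hw x' hx' ⟨y₁, hy₁, h1, h2⟩ y' hy' h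
    have c := claim₁ x hx y hy hxy hy0 hw
    by_cases h' : B x y' = 0
    · have h3 := sub_mem (c (y' + y₁) (add_mem hy' hy₁) (by simpa [h'] using h2) x' hx'
        (by simp [h, h1])) (c y₁ hy₁ h2 x' hx' h1)
      rwa [map_add, add_sub_cancel_right] at h3
    · exact c y' hy' h' x' hx' h
  have hw₀ := hnil x₀ hx₀ y₀ hy₀ h₀ X hX hXp hX₀
  have hy₀0 : y₀ ≠ 0 := fun h => hX₀ (by simp [h])
  have hx₀0 : x₀ ≠ 0 := fun h => hX₀ (by simp [h])
  by_cases hex : ∃ y₁ ∈ weightSpace χ, B x y₁ = 0 ∧ B x₀ y₁ ≠ 0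
  · exact claim₂ x₀ hx₀ y₀ hy₀ h₀ hy₀0 hw₀ x hx hex y hy hxy
  -- Here every y orthogonal to x is orthogonal to x₀, so the two define the same hyperplane. A
  -- detour through x₁ ∧ y₂, with x₁ not orthogonal to y₀, avoids this.
  push Not at hex
  obtain ⟨y₂, hy₂, h₂⟩ := Q.exists_pairing_eq_one hB χ⁻¹ hx₀ hx₀0
  rw [character_inv_inv] at hy₂
  have hy₂0 : y₂ ≠ 0 := fun h => by simp [h] at h₂
  have hxy₂ : B x y₂ ≠ 0 := fun h => by
    have := hex y₂ hy₂ h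
    rw [h₂] at this
    exact one_ne_zero this
  have hxy₀ : B x y₀ = 0 := by
    have h := hex (y₀ - (B x y₀ / B x y₂) • y₂) (sub_mem hy₀ (Submodule.smul_mem _ _ hy₂)) (by
      rw [map_sub, map_smul, smul_eq_mul, div_mul_cancel₀ _ hxy₂, sub_self])
    rw [map_sub, map_smul, h₀, h₂, smul_eq_mul, mul_one, zero_sub, neg_eq_zero,
      div_eq_zero_iff] at h
    exact h.resolve_right hxy₂
  obtain ⟨a, ha, hay⟩ := Q.exists_pairing_eq_one' hB hε hsymm χ hy₀ hy₀0
  let x₁ := a - B a y₂ • x₀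
  have hx₁ : x₁ ∈ weightSpace χ⁻¹ := sub_mem ha (Submodule.smul_mem _ _ hx₀)
  have h1 : B x₁ y₂ = 0 := by
    simp [x₁, h₂]
  have h2 : B x₁ y₀ = 1 := by
    simp [x₁, h₀, hay]
  have hw₁ := claim₁ x₀ hx₀ y₀ hy₀ h₀ hy₀0 hw₀ y₂ hy₂ (by simp [h₂]) x₁ hx₁ h1
  exact claim₂ x₁ hx₁ y₂ hy₂ h1 hy₂0 hw₁ x hx ⟨y₀, hy₀, hxy₀, by simp [h2]⟩ y hy hxy

/-- An `R`-submodule of a piece of the Lie algebra on which `R` acts non-trivially contains all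
elements of the piece, except that for `χ = μ ≠ χ⁻¹` it may only contain those which are traceless
on `V_χ`. -/
theorem IsAdStable.mem_of_mem_liePiece (hU : Q.IsAdStable U) (hB : B.Nondegenerate) {ε : ℂ}
    (hε : ε = 1 ∨ ε = -1) (hsymm : ∀ x y, B x y = ε * B y x) {χ μ : Q.Weight}
    (hUp : U ≤ liePiece B χ.1 μ.1) {Y : V →ₗ[ℂ] V} (hY : Y ∈ U) {r : Q.R}
    (hr : adRep Q.R r Y ≠ Y) {X : V →ₗ[ℂ] V} (hX : X ∈ liePiece B χ.1 μ.1)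
    (htr : χ = μ → LinearMap.trace ℂ (Q.space χ)
      (Q.proj χ ∘ₗ X ∘ₗ (weightSpace χ.1).subtype) = 0) : X ∈ U := by
  have hY0 : Y ≠ 0 := fun h => hr (by rw [h, map_zero])
  by_cases hχμ : χ = μ
  swap
  · exact Q.mem_of_wedge_mem hB hε hsymm hX U fun x hx y hy =>
      hU.wedge_mem_of_ne hB hε hsymm (fun h => hχμ (Subtype.ext h)) (hUp hY) hY hY0 hx hy
  subst hχμ
  by_cases hχ : χ.1 = χ.1⁻¹
  · refine Q.mem_of_wedge_mem hB hε hsymm hX U fun x hx y hy => ?_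
    rw [← hχ] at hx
    rcases hε with rfl | rfl
    · exact hU.wedge_mem_orthogonal hB hsymm hχ.symm (hUp hY) hY hY0 hx hy
    · exact hU.wedge_mem_symplectic hB hsymm hχ.symm (hUp hY) hY hY0 hx hy
  -- Modulo U, x ∧ y equals B(x, y)c. Writing a nonzero multiple of X as Σ e_i* ∧ Xe_i shows that
  -- its class is tr(X|V_χ)c, which is zero.
  · obtain ⟨c, hc⟩ := exists_eq_form_smul (N := (V →ₗ[ℂ] V) ⧸ U) hB hε hsymm χ.1
      ((wedge B ε).compr₂ U.mkQ) fun x hx y hy hxy => (Submodule.Quotient.mk_eq_zero U).2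
        (hU.wedge_mem_of_form_eq_zero hB hε hsymm hχ (hUp hY) hY hr hx hy hxy)
    obtain ⟨k, hk, hsum⟩ := Q.sum_wedge_eq hB hε hsymm hX
    refine (Submodule.smul_mem_iff _ hk).1 ((Submodule.Quotient.mk_eq_zero U).1 ?_)
    change U.mkQ (k • X) = 0
    rw [← hsum, map_sum]
    have h1 : ∀ i, U.mkQ (wedge B ε (Q.dualWeightBasis hB χ.1 i) (X (Q.weightBasis χ.1 i))) =
        B (Q.dualWeightBasis hB χ.1 i) (X (Q.weightBasis χ.1 i)) • c := fun i =>
      hc _ (Q.dualWeightBasis hB χ.1 i).2 _ (liePiece_mapsTo hX (Q.weightBasis χ.1 i).2)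
    rw [Finset.sum_congr rfl fun i _ => h1 i, ← Finset.sum_smul]
    have h2 : ∑ i, B (Q.dualWeightBasis hB χ.1 i) (X (Q.weightBasis χ.1 i)) = 0 := by
      rw [← htr rfl, LinearMap.trace_eq_matrix_trace ℂ (Q.weightBasis χ.1), Matrix.trace]
      refine Finset.sum_congr rfl fun i _ => ?_
      rw [Matrix.diag_apply, LinearMap.toMatrix_apply, ← Q.form_dualWeightBasis hB]
      congr 1
      exact (Q.proj_of_mem (liePiece_mapsTo hX (Q.weightBasis χ.1 i).2)).symm
    rw [h2, zero_smul]

end GeneralizedQuiver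

/-! ### The arrows with a given label -/

namespace GeneralizedQuiver

variable {V : Type u} [NormedAddCommGroup V] [NormedSpace ℂ V] {B : LinearMap.BilinForm ℂ V}
  (Q : GeneralizedQuiver.{u, v, w} B)

/-- The action of an element of `R` on an isotypic component as a linear equivalence. -/
def actEquiv (r : Q.R) (χ : Q.Weight) : Q.space χ ≃ₗ[ℂ] Q.space χ :=
  LinearEquiv.ofLinearMap (Q.act r χ) (Q.act r⁻¹ χ) (LinearMap.ext fun x => Q.act_act_inv r χ x)
    (LinearMap.ext fun x => Q.act_inv_act r χ x)

theorem actEquiv_apply (r : Q.R) (χ : Q.Weight) (x : Q.space χ) :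
    Q.actEquiv r χ x = Q.act r χ x := rfl

variable [FiniteDimensional ℂ V]

/-- The adjoint action on `liePiece χ μ` depends only on the action on `V_χ` and `V_μ`. -/
theorem adRep_congr (hB : B.Nondegenerate) {χ μ : Q.Weight} {X : V →ₗ[ℂ] V}
    (hX : X ∈ liePiece B χ.1 μ.1) {r s : Q.R} (hχ : Q.act r χ = Q.act s χ)
    (hμ : Q.act r μ = Q.act s μ) : adRep Q.R r X = adRep Q.R s X := by
  refine Q.liePiece_ext hB (Q.adRep_mem_liePiece r hX) (Q.adRep_mem_liePiece s hX) fun x hx => ?_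
  lift x to Q.space χ using hx
  have h1 : Q.act r⁻¹ χ x = Q.act s⁻¹ χ x := by
    rw [← Q.act_inv_act r χ (Q.act s⁻¹ χ x), hχ, Q.act_act_inv]
  have h2 := congrArg Subtype.val h1
  rw [act_coe, act_coe] at h2
  rw [adRep_apply, adRep_apply, h2]
  have h3 : X (((s⁻¹ : Q.R) : V ≃ₗ[ℂ] V) x) ∈ weightSpace μ.1 :=
    liePiece_mapsTo hX (Q.act_mem _ _ _ x.2)
  exact congrArg Subtype.val (LinearMap.congr_fun hμ ⟨_, h3⟩)

/-- The element of `R` which acts on `V_χ` by the scalar `c χ`. -/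
def scalarElement (hB : B.Nondegenerate) (c : Q.Weight → ℂˣ)
    (hc : ∀ χ, c (Q.inv hB χ) = (c χ)⁻¹) : Q.R :=
  Q.ofFamily (fun χ => LinearEquiv.smulOfUnit (c χ)) (by
    intro χ μ x y
    by_cases h : μ.1 = χ.1⁻¹
    · obtain rfl : μ = Q.inv hB χ := Subtype.ext h
      change Q.form _ _ ((c χ : ℂ) • x) ((c (Q.inv hB χ) : ℂ) • y) = _
      rw [hc, map_smul, map_smul, LinearMap.smul_apply, smul_smul]
      simp
    · exact (Q.form_eq_zero_of_ne _ _ h (Subtype.property _) (Subtype.property _)).trans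
        (Q.form_eq_zero_of_ne _ _ h x.2 y.2).symm)

theorem adRep_scalarElement (hB : B.Nondegenerate) (c : Q.Weight → ℂˣ)
    (hc : ∀ χ, c (Q.inv hB χ) = (c χ)⁻¹) {χ μ : Q.Weight} {X : V →ₗ[ℂ] V}
    (hX : X ∈ liePiece B χ.1 μ.1) :
    adRep Q.R (Q.scalarElement hB c hc) X = ((c μ : ℂ) * (c (Q.inv hB χ) : ℂ)) • X := by
  have hact : ∀ χ (x : Q.space χ), Q.act (Q.scalarElement hB c hc) χ x = (c χ : ℂ) • x :=
    fun χ x => Q.act_ofFamily _ _ χ x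
  refine Q.liePiece_ext hB (Q.adRep_mem_liePiece _ hX) (Submodule.smul_mem _ _ hX) fun x hx => ?_
  lift x to Q.space χ using hx
  have h1 : Q.act (Q.scalarElement hB c hc)⁻¹ χ x = (c (Q.inv hB χ) : ℂ) • x := by
    have h := Q.act_inv_act (Q.scalarElement hB c hc) χ ((((c χ)⁻¹ : ℂˣ) : ℂ) • x)
    rwa [hact, smul_smul, Units.mul_inv, one_smul, ← hc] at h
  have h2 := congrArg Subtype.val h1
  rw [act_coe] at h2
  have h3 : ∀ y ∈ weightSpace μ.1, ((Q.scalarElement hB c hc : Q.R) : V ≃ₗ[ℂ] V) y =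
      (c μ : ℂ) • y := fun y hy => congrArg Subtype.val (hact μ ⟨y, hy⟩)
  rw [adRep_apply, h2, h3 _ (liePiece_mapsTo hX (Subtype.property _)), LinearMap.smul_apply,
    mul_smul]
  simp

variable {Q}

omit [FiniteDimensional ℂ V] in
theorem exists_ne_zero (α : Q.A) : ∃ z : Q.Z α, z ≠ 0 := by
  obtain ⟨r, z, h⟩ := Q.nontrivial α
  exact ⟨z, fun h0 => h (by rw [h0, map_zero])⟩

/-- A scalar element of R acts on Z_α by a number that can be read off from either piece. -/
theorem scalar_eq_of_embeds (hB : B.Nondegenerate) {α : Q.A} {χ μ χ' μ' : Q.Weight}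
    (h : Q.EmbedsInPiece α χ.1 μ.1) (h' : Q.EmbedsInPiece α χ'.1 μ'.1) (c : Q.Weight → ℂˣ)
    (hc : ∀ χ, c (Q.inv hB χ) = (c χ)⁻¹) :
    c μ * c (Q.inv hB χ) = c μ' * c (Q.inv hB χ') := by
  obtain ⟨z, hz⟩ := exists_ne_zero α
  have key : ∀ {χ μ : Q.Weight}, Q.EmbedsInPiece α χ.1 μ.1 →
      Q.ρ α (Q.scalarElement hB c hc) z = ((c μ : ℂ) * (c (Q.inv hB χ) : ℂ)) • z := by
    rintro χ μ ⟨e, he, hm⟩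
    apply he
    rw [e.isIntertwining, Q.adRep_scalarElement hB c hc (hm z)]
    exact (map_smul e.toLinearMap _ z).symm
  have h1 := (key h).symm.trans (key h')
  exact Units.ext (smul_left_injective ℂ hz h1)

open scoped Classical in
/-- A family of scalars which separates `ν` from the other characters. -/
def separatingScalar (hB : B.Nondegenerate) (ν χ : Q.Weight) : ℂˣ :=
  if Q.inv hB ν = ν then (if χ = ν then -1 else 1) else
    if χ = ν then Units.mk0 2 two_ne_zero else
      if χ = Q.inv hB ν then (Units.mk0 2 two_ne_zero)⁻¹ else 1

omit [FiniteDimensional ℂ V] in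
theorem inv_eq_comm {hB : B.Nondegenerate} {χ μ : Q.Weight} :
    Q.inv hB χ = μ ↔ χ = Q.inv hB μ := by
  constructor
  · rintro rfl
    exact (Q.inv_inv hB χ).symm
  · rintro rfl
    exact Q.inv_inv hB μ

omit [FiniteDimensional ℂ V] in
theorem separatingScalar_inv (hB : B.Nondegenerate) (ν χ : Q.Weight) :
    separatingScalar hB ν (Q.inv hB χ) = (separatingScalar hB ν χ)⁻¹ := by
  have e1 : Q.inv hB χ = ν ↔ χ = Q.inv hB ν := inv_eq_comm
  have e2 : Q.inv hB χ = Q.inv hB ν ↔ χ = ν := by rw [inv_eq_comm, Q.inv_inv]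
  unfold separatingScalar
  by_cases h : Q.inv hB ν = ν
  · rw [if_pos h, if_pos h]
    by_cases h1 : χ = ν
    · rw [if_pos h1, if_pos (e1.2 (h1.trans h.symm)), inv_neg, inv_one]
    · rw [if_neg h1, if_neg (fun h' => h1 ((e1.1 h').trans h)), inv_one]
  · rw [if_neg h, if_neg h]
    by_cases h1 : χ = ν
    · have h2 : χ ≠ Q.inv hB ν := fun h' => h (by rw [← h', h1])
      rw [if_pos h1, if_neg (fun h' => h2 (e1.1 h')), if_pos (e2.2 h1)]
    · rw [if_neg h1]
      by_cases h2 : χ = Q.inv hB ν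
      · rw [if_pos h2, if_pos (e1.2 h2), _root_.inv_inv]
      · rw [if_neg h2, if_neg (fun h' => h2 (e1.1 h')), if_neg (fun h' => h1 (e2.1 h')), inv_one]

omit [FiniteDimensional ℂ V] in
-- If p is self-inverse, the left side is -1, which needs an occurrence of p on the right. Otherwise
-- it is 2, or 4 if q = p, while characters other than p contribute only 1 or 1/2.
theorem eq_or_eq_of_separatingScalar (hB : B.Nondegenerate) {p q p' q' : Q.Weight}
    (hpq : q ≠ Q.inv hB p)
    (h : separatingScalar hB p p * separatingScalar hB p q =
      separatingScalar hB p p' * separatingScalar hB p q') :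
    (p' = p ∨ q' = p) ∧ (q = p → p' = p ∧ q' = p) := by
  have h2 := congrArg (fun x : ℂˣ => (x : ℂ)) h
  clear h
  unfold separatingScalar at h2
  by_cases hp : Q.inv hB p = p
  · rw [hp] at hpq
    simp only [hp, if_true, if_neg hpq] at h2
    refine ⟨?_, fun h => absurd h hpq⟩
    by_contra! hcon
    simp only [hcon.1, hcon.2, if_false] at h2
    norm_num at h2
  · simp only [hp, if_false, if_true, hpq] at h2
    constructor
    · by_contra! hcon
      simp only [hcon.1, hcon.2, if_false] at h2
      split_ifs at h2 <;> norm_num at h2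
    · intro hq
      simp only [hq, if_true] at h2
      by_contra hcon
      split_ifs at h2 <;> first | exact hcon ⟨by assumption, by assumption⟩ | norm_num at h2

omit [FiniteDimensional ℂ V] in
theorem pair_eq_of_separatingScalar (hB : B.Nondegenerate) {p q p' q' : Q.Weight}
    (hpq : q ≠ Q.inv hB p)
    (h : ∀ ν, separatingScalar hB ν p * separatingScalar hB ν q =
      separatingScalar hB ν p' * separatingScalar hB ν q') :
    (p' = p ∧ q' = q) ∨ (p' = q ∧ q' = p) := by
  obtain ⟨h1, h2⟩ := eq_or_eq_of_separatingScalar hB hpq (h p)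
  by_cases hqp : q = p
  · left
    rw [hqp]
    exact h2 hqp
  obtain ⟨h3, -⟩ := eq_or_eq_of_separatingScalar hB (p := q) (q := p) (p' := p') (q' := q')
    (fun h' => hpq (by rw [h', Q.inv_inv])) (by rw [mul_comm]; exact h q)
  rcases h1 with rfl | rfl
  · exact Or.inl ⟨rfl, h3.resolve_left (Ne.symm hqp)⟩
  · exact Or.inr ⟨h3.resolve_right (Ne.symm hqp), rfl⟩

/-- A summand embeds in one piece of the Lie algebra only. -/
theorem EmbedsInPiece.eq_or_eq (hB : B.Nondegenerate) {α : Q.A} {χ μ χ' μ' : Q.Weight}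
    (h : Q.EmbedsInPiece α χ.1 μ.1) (h' : Q.EmbedsInPiece α χ'.1 μ'.1) :
    (χ' = χ ∧ μ' = μ) ∨ (χ' = Q.inv hB μ ∧ μ' = Q.inv hB χ) := by
  classical
  have hs : ∀ ν, separatingScalar hB ν μ * separatingScalar hB ν (Q.inv hB χ) =
      separatingScalar hB ν μ' * separatingScalar hB ν (Q.inv hB χ') := fun ν =>
    scalar_eq_of_embeds hB h h' _ (separatingScalar_inv hB ν)
  have inj : ∀ {a b : Q.Weight}, Q.inv hB a = Q.inv hB b → a = b := by
    intro a b hab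
    rw [← Q.inv_inv hB a, hab, Q.inv_inv]
  -- Scalar elements recover the unordered pair {μ, χ⁻¹} unless χ = μ, when they act trivially and
  -- carry no information.
  by_cases h1 : Q.inv hB χ = Q.inv hB μ
  swap
  · rcases pair_eq_of_separatingScalar hB h1 hs with ⟨h2, h3⟩ | ⟨h2, h3⟩
    · exact Or.inl ⟨inj h3, h2⟩
    · exact Or.inr ⟨(inv_eq_comm.1 h3), h2⟩
  by_cases h2 : Q.inv hB χ' = Q.inv hB μ'
  swap
  · rcases pair_eq_of_separatingScalar hB h2 fun ν => (hs ν).symm with ⟨h3, h4⟩ | ⟨h3, h4⟩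
    · exact Or.inl ⟨(inj h4).symm, h3.symm⟩
    · exact Or.inr ⟨by rw [h3, Q.inv_inv], h4.symm⟩
  obtain rfl := inj h1
  obtain rfl := inj h2
  by_cases h3 : χ' = χ
  · exact Or.inl ⟨h3, h3⟩
  by_cases h4 : χ' = Q.inv hB χ
  · exact Or.inr ⟨h4, h4⟩
  -- What is left are loops at χ and at χ' with χ' ≠ χ, χ⁻¹. The element `s` acts as `r` on V_χ and
  -- V_{χ⁻¹} and as 1 elsewhere. On Z_α it acts as `r` by the first embedding and trivially by the
  -- second, contradicting the choice of `r`.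
  exfalso
  obtain ⟨r, z, hrz⟩ := Q.nontrivial α
  let P : Q.Weight → Prop := fun ν => ν = χ ∨ ν = Q.inv hB χ
  have hP : ∀ ν, P (Q.inv hB ν) ↔ P ν := by
    intro ν
    simp only [P, inv_eq_comm, Q.inv_inv]
    exact or_comm
  let s : Q.R := Q.ofFamily (fun ν => if P ν then Q.actEquiv r ν else LinearEquiv.refl ℂ _) (by
    intro ν κ x y
    by_cases h : κ.1 = ν.1⁻¹
    · obtain rfl : κ = Q.inv hB ν := Subtype.ext h
      by_cases hν : P ν
      · rw [if_pos hν, if_pos ((hP ν).2 hν)]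
        exact Q.form_act r _ _ x y
      · rw [if_neg hν, if_neg (fun h => hν ((hP ν).1 h))]
        rfl
    · exact (Q.form_eq_zero_of_ne _ _ h (Subtype.property _) (Subtype.property _)).trans
        (Q.form_eq_zero_of_ne _ _ h x.2 y.2).symm)
  have hsχ : Q.act s χ = Q.act r χ := by
    ext1 x
    rw [Q.act_ofFamily, if_pos (Or.inl rfl), actEquiv_apply]
  have hsχ' : Q.act s χ' = Q.act 1 χ' := by
    ext1 x
    rw [Q.act_ofFamily, if_neg (not_or.2 ⟨h3, h4⟩), act_one]
    rfl
  obtain ⟨e, he, hm⟩ := h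
  obtain ⟨e', he', hm'⟩ := h'
  have e1 : Q.ρ α s z = Q.ρ α r z := by
    apply he
    rw [e.isIntertwining, e.isIntertwining, Q.adRep_congr hB (hm z) hsχ hsχ]
  have e2 : Q.ρ α s z = Q.ρ α 1 z := by
    apply he'
    rw [e'.isIntertwining, e'.isIntertwining, Q.adRep_congr hB (hm' z) hsχ' hsχ']
  exact hrz (by rw [← e1, e2, map_one]; rfl)

/-- The component of an endomorphism in `Hom(V_χ, V_μ) + Hom(V_{μ⁻¹}, V_{χ⁻¹})` (multiplied by two
for `μ = χ⁻¹`). -/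
def pieceProj (hB : B.Nondegenerate) (χ μ : Q.Weight) (X : V →ₗ[ℂ] V) : V →ₗ[ℂ] V :=
  (weightSpace μ.1).subtype ∘ₗ Q.proj μ ∘ₗ X ∘ₗ (weightSpace χ.1).subtype ∘ₗ Q.proj χ +
  (weightSpace (Q.inv hB χ).1).subtype ∘ₗ Q.proj (Q.inv hB χ) ∘ₗ X ∘ₗ
    (weightSpace (Q.inv hB μ).1).subtype ∘ₗ Q.proj (Q.inv hB μ)

theorem pieceProj_apply (hB : B.Nondegenerate) (χ μ : Q.Weight) (X : V →ₗ[ℂ] V) (v : V) :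
    pieceProj hB χ μ X v = Q.proj μ (X (Q.proj χ v)) +
      Q.proj (Q.inv hB χ) (X (Q.proj (Q.inv hB μ) v)) := rfl

theorem form_proj (hB : B.Nondegenerate) (χ : Q.Weight) (x y : V) :
    B (Q.proj χ x) y = B x (Q.proj (Q.inv hB χ) y) := by
  have : B ∘ₗ (weightSpace χ.1).subtype ∘ₗ Q.proj χ =
      B.compl₂ ((weightSpace (Q.inv hB χ).1).subtype ∘ₗ Q.proj (Q.inv hB χ)) := by
    refine ext_weight (Q := Q) fun ν x hx => ext_weight (Q := Q) fun κ y hy => ?_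
    simp only [LinearMap.comp_apply, LinearMap.compl₂_apply, Submodule.subtype_apply]
    by_cases h1 : ν = χ
    · subst h1
      rw [Q.proj_of_mem hx]
      by_cases h2 : κ = Q.inv hB ν
      · subst h2
        rw [Q.proj_of_mem hy]
      · rw [Q.proj_of_ne h2 hy, Submodule.coe_zero, map_zero]
        exact Q.form_eq_zero_of_ne _ _ (fun h => h2 (Subtype.ext h)) hx hy
    · rw [Q.proj_of_ne h1 hx, Submodule.coe_zero, map_zero, LinearMap.zero_apply]
      by_cases h2 : κ = Q.inv hB χ
      · subst h2
        rw [Q.proj_of_mem hy, Q.form_eq_zero_of_ne _ _ (fun h => h1 ?_) hx hy]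
        have h' : Q.inv hB χ = Q.inv hB ν := Subtype.ext h
        rw [inv_eq_comm, Q.inv_inv] at h'
        exact h'.symm
      · rw [Q.proj_of_ne h2 hy, Submodule.coe_zero, map_zero]
  exact LinearMap.congr_fun₂ this x y

/-- The projections to V_χ and V_{χ⁻¹} are adjoint (`form_proj`), so for skew X each of the two
summands is minus the adjoint of the other. -/
theorem pieceProj_mem (hB : B.Nondegenerate) (χ μ : Q.Weight) {X : V →ₗ[ℂ] V}
    (hX : X ∈ isometryLie B) : pieceProj hB χ μ X ∈ liePiece B χ.1 μ.1 := by
  have hχ := Q.inv_val hB χ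
  have hμ := Q.inv_val hB μ
  rw [mem_isometryLie] at hX
  refine Q.mem_liePiece_of ?_ (fun x hx => ?_) (fun x hx => ?_) fun ν h1 h2 x hx => ?_
  · rw [mem_isometryLie]
    intro x y
    simp only [pieceProj_apply, map_add, LinearMap.add_apply]
    rw [form_proj hB, hX, form_proj hB, form_proj hB, hX, form_proj hB, Q.inv_inv, Q.inv_inv]
    ring
  · rw [pieceProj_apply]
    refine add_mem (Subtype.property _) ?_
    by_cases h : χ = Q.inv hB μ
    · subst h
      have := (Q.proj (Q.inv hB (Q.inv hB μ)) (X (Q.proj (Q.inv hB μ) x))).2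
      rwa [Q.inv_inv] at this ⊢
    · rw [Q.proj_of_ne h hx]
      simp
  · rw [← hμ] at hx
    rw [pieceProj_apply, ← hχ]
    refine add_mem ?_ (Subtype.property _)
    by_cases h : Q.inv hB μ = χ
    · subst h
      have := (Q.proj μ (X (Q.proj (Q.inv hB μ) x))).2
      rwa [Q.inv_inv]
    · rw [Q.proj_of_ne h hx]
      simp
  · by_cases hν : weightSpace ν = ⊥
    · rw [hν, Submodule.mem_bot] at hx
      rw [hx, map_zero]
    · rw [pieceProj_apply, Q.proj_of_ne (χ := ⟨ν, hν⟩) (fun h => h1 (congrArg Subtype.val h)) hx,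
        Q.proj_of_ne (χ := ⟨ν, hν⟩) (fun h => h2 (congrArg Subtype.val h)) hx]
      simp

theorem pieceProj_adRep (hB : B.Nondegenerate) (χ μ : Q.Weight) (r : Q.R) (X : V →ₗ[ℂ] V) :
    pieceProj hB χ μ (adRep Q.R r X) = adRep Q.R r (pieceProj hB χ μ X) := by
  ext v
  simp only [pieceProj_apply, adRep_apply, Q.proj_apply_R, map_add, act_coe]

theorem exists_pieceProj_ne_zero (hB : B.Nondegenerate) {X : V →ₗ[ℂ] V} (hX : X ≠ 0) :
    ∃ χ μ : Q.Weight, pieceProj hB χ μ X ≠ 0 := by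
  by_contra! hcon
  refine hX (ext_weight (Q := Q) fun χ x hx => ?_)
  rw [LinearMap.zero_apply, ← Q.sum_proj (X x)]
  refine Finset.sum_eq_zero fun μ _ => ?_
  have h := LinearMap.congr_fun (hcon χ μ) x
  rw [pieceProj_apply, Q.proj_of_mem hx, LinearMap.zero_apply] at h
  by_cases h1 : χ = Q.inv hB μ
  · subst h1
    rw [Q.proj_of_mem hx, Q.inv_inv, ← two_smul ℂ, smul_eq_zero] at h
    exact h.resolve_left two_ne_zero
  · rw [Q.proj_of_ne h1 hx] at h
    simpa using h

/-- Every summand embeds in a piece of the Lie algebra. -/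
theorem exists_embedding (hB : B.Nondegenerate) (α : Q.A) : ∃ (χ μ : Q.Weight)
    (e : (Q.ρ α).IntertwiningMap (adRep Q.R)), Function.Injective e ∧
      (∀ z, e z ∈ liePiece B χ.1 μ.1) ∧
      ((Q.ρ α).IsIrreducible ∨ Set.range e = (liePiece B χ.1 μ.1 : Set (V →ₗ[ℂ] V))) := by
  obtain ⟨z, hz⟩ := exists_ne_zero α
  rcases Q.factor α with ⟨hirr, e, he, hm⟩ | ⟨χ, μ, e, he, hm⟩
  · have he0 : e z ≠ 0 := fun h => hz (he (h.trans (map_zero e.toLinearMap).symm))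
    -- The projection to a suitable piece, composed with `e`, is equivariant and nonzero, hence
    -- injective on the irreducible Z_α.
    obtain ⟨χ, μ, hne⟩ := exists_pieceProj_ne_zero (Q := Q) hB he0
    let P : (V →ₗ[ℂ] V) →ₗ[ℂ] (V →ₗ[ℂ] V) :=
      { toFun := pieceProj hB χ μ
        map_add' := fun X Y => by
          ext v
          simp only [pieceProj_apply, LinearMap.add_apply, map_add, Submodule.coe_add]
          abel
        map_smul' := fun c X => by
          ext v
          simp only [pieceProj_apply, LinearMap.smul_apply, map_smul, Submodule.coe_smul,
            RingHom.id_apply, smul_add] }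
    let e' : (Q.ρ α).IntertwiningMap (adRep Q.R) :=
      ⟨P ∘ₗ e.toLinearMap, fun r => LinearMap.ext fun z => by
        change pieceProj hB χ μ (e (Q.ρ α r z)) = adRep Q.R r (pieceProj hB χ μ (e z))
        rw [e.isIntertwining, pieceProj_adRep]⟩
    refine ⟨χ, μ, e', ?_, fun z => pieceProj_mem hB χ μ (hm z), Or.inl hirr⟩
    rcases Representation.IsIrreducible.injective_or_eq_zero e' with h | h
    · exact h
    · exact absurd (congrArg (fun k : (Q.ρ α).IntertwiningMap (adRep Q.R) => k z) h) hne
  · have he0 : e z ≠ 0 := fun h => hz (he (h.trans (map_zero e.toLinearMap).symm))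
    have hmem : ∀ z, e z ∈ liePiece B χ μ := fun z => by
      change e z ∈ (liePiece B χ μ : Set (V →ₗ[ℂ] V))
      rw [← hm]
      exact ⟨z, rfl⟩
    -- Here χ and μ are arbitrary characters of H; they occur in V because the piece is nonzero.
    have hχ : weightSpace χ ≠ ⊥ := fun h => he0 (Q.liePiece_ext hB (hmem z) (zero_mem _) (by
      intro x hx
      rw [h, Submodule.mem_bot] at hx
      simp [hx]))
    have hμ : weightSpace μ ≠ ⊥ := fun h => he0 (Q.liePiece_ext hB (hmem z) (zero_mem _) (by
      intro x hx
      have := liePiece_mapsTo (hmem z) hx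
      rw [h, Submodule.mem_bot] at this
      rw [this]
      rfl))
    exact ⟨⟨χ, hχ⟩, ⟨μ, hμ⟩, e, he, hmem, Or.inr hm⟩

end GeneralizedQuiver

/-! ### The finite-dimensional correspondence -/

/-- An invariant functional on a non-trivial irreducible representation vanishes. -/
theorem invariant_functional_eq_zero {G Z : Type*} [Group G] [AddCommGroup Z] [Module ℂ Z]
    {ρ : Representation ℂ G Z} (hirr : ρ.IsIrreducible) (hnt : ∃ r z, ρ r z ≠ z)
    (l : Z →ₗ[ℂ] ℂ) (hl : ∀ r z, l (ρ r z) = l z) : l = 0 := by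
  let K : Subrepresentation ρ := ⟨LinearMap.ker l, fun g x hx => by
    rw [LinearMap.mem_ker] at hx ⊢
    rw [hl, hx]⟩
  -- The kernel contains every ρ(r)z - z, so it cannot be zero.
  rcases eq_bot_or_eq_top K with h | h
  · obtain ⟨r, z, hrz⟩ := hnt
    have h1 : ρ r z - z ∈ K.toSubmodule := by
      change l _ = 0
      rw [map_sub, hl, sub_self]
    rw [h] at h1
    exact absurd (sub_eq_zero.1 h1) hrz
  · have h1 : K.toSubmodule = ⊤ := by rw [h]; rfl
    exact LinearMap.ker_eq_top.1 h1

theorem SymmetricQuiver.IsOrthogonalRep.apply_of_eq {S : SymmetricQuiver.{u, v}}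
    {W : S.Vertex → Type w} [∀ i, AddCommGroup (W i)] [∀ i, Module ℂ (W i)]
    {C : ∀ i j, W i →ₗ[ℂ] W j →ₗ[ℂ] ℂ} {ψ : ∀ a, W (S.tail a) →ₗ[ℂ] W (S.head a)}
    (h : S.IsOrthogonalRep C ψ) {a b : S.Arrow} (hb : b = S.σA a) (x : W (S.tail a))
    (y : W (S.tail b)) : C (S.head a) (S.tail b) (ψ a x) y + C (S.tail a) (S.head b) x (ψ b y) = 0 := by
  subst hb
  exact h a x y

/-- The trace of an endomorphism, up to an identification of the indices, is invariant under
conjugation. -/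
theorem trace_cast_comp_conj {ι : Type*} {M N : ι → Type*} [∀ i, AddCommGroup (M i)]
    [∀ i, Module ℂ (M i)] [∀ i, AddCommGroup (N i)] [∀ i, Module ℂ (N i)]
    (g : ∀ i, M i ≃ₗ[ℂ] N i) {i j : ι} (e : j = i) (T : M i →ₗ[ℂ] M j) (T' : N i →ₗ[ℂ] N j)
    (h : ∀ x, T' (g i x) = g j (T x)) :
    LinearMap.trace ℂ (N i) ((LinearEquiv.cast (R := ℂ) (M := N) e).toLinearMap ∘ₗ T') =
      LinearMap.trace ℂ (M i) ((LinearEquiv.cast (R := ℂ) (M := M) e).toLinearMap ∘ₗ T) := by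
  subst e
  rw [← LinearMap.trace_conj' _ (g j)]
  congr 1
  ext x
  have := h ((g j).symm x)
  rw [LinearEquiv.apply_symm_apply] at this
  exact this

namespace GeneralizedQuiver

variable {V : Type u} [NormedAddCommGroup V] [NormedSpace ℂ V] {B : LinearMap.BilinForm ℂ V}
  {Q : GeneralizedQuiver.{u, v, w} B} [FiniteDimensional ℂ V]

/-- An orthogonal map `V_χ → V_μ` is the restriction of an element of the Lie algebra. -/
theorem exists_mem_liePiece_of_orthogonal (hB : B.Nondegenerate) {ε : ℂ} (hε : ε = 1 ∨ ε = -1)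
    (hsymm : ∀ x y, B x y = ε * B y x) {χ μ : Q.Weight} (T : Q.space χ →ₗ[ℂ] Q.space μ)
    (hT : χ.1 = μ.1⁻¹ → ∀ x y : Q.space χ,
      B (T x : V) (y : V) + B (x : V) (T y : V) = 0) :
    ∃ X ∈ liePiece B χ.1 μ.1, ∀ x : Q.space χ, X x = T x := by
  have hε2 : ε * ε = 1 := by rcases hε with rfl | rfl <;> ring
  let X := ∑ i, wedge B ε (Q.dualWeightBasis hB χ.1 i) (T (Q.weightBasis χ.1 i))
  have hX : X ∈ liePiece B χ.1 μ.1 := Submodule.sum_mem _ fun i _ =>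
    Q.wedge_mem_liePiece hε hsymm (Q.dualWeightBasis hB χ.1 i).2 (T _).2
  have h1 : ∀ v : Q.space χ, ∑ i, B (Q.dualWeightBasis hB χ.1 i) v •
      (T (Q.weightBasis χ.1 i) : V) = T v := by
    intro v
    have e : ∑ i, B (Q.dualWeightBasis hB χ.1 i) v • Q.weightBasis χ.1 i = v := by
      simp_rw [form_dualWeightBasis]
      exact (Q.weightBasis χ.1).sum_repr v
    have e' := congrArg ((weightSpace μ.1).subtype ∘ₗ T) e
    rw [map_sum] at e'
    simp only [map_smul] at e'
    exact e'
  have hXv : ∀ v : Q.space χ, X v = T v -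
      ∑ i, (ε * B (T (Q.weightBasis χ.1 i) : V) v) • (Q.dualWeightBasis hB χ.1 i : V) := by
    intro v
    rw [← h1 v, ← Finset.sum_sub_distrib, LinearMap.sum_apply]
    refine Finset.sum_congr rfl fun i _ => ?_
    rw [wedge_apply, smul_smul]
  -- As in `sum_wedge_eq`, for χ = μ⁻¹ orthogonality of T makes the two terms of the wedges
  -- contribute T each, whence the factor 1/2.
  by_cases h : χ.1 = μ.1⁻¹
  · refine ⟨(1 / 2 : ℂ) • X, Submodule.smul_mem _ _ hX, fun v => ?_⟩
    have h2 : ∑ i, (ε * B (T (Q.weightBasis χ.1 i) : V) v) • (Q.dualWeightBasis hB χ.1 i : V) =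
        -(T v : V) := by
      have hm : (T v : V) ∈ weightSpace χ.1⁻¹ := by
        have key : ∀ w ∈ weightSpace μ.1, w ∈ weightSpace χ.1⁻¹ := fun w hw => by
          rwa [h, character_inv_inv]
        exact key _ (T v).2
      conv_rhs => rw [← Q.sum_form_smul_dualWeightBasis hB χ.1 hm]
      rw [← Finset.sum_neg_distrib]
      refine Finset.sum_congr rfl fun i _ => ?_
      rw [eq_neg_of_add_eq_zero_left (hT h (Q.weightBasis χ.1 i) v), hsymm _ (T v : V), mul_neg,
        ← mul_assoc, hε2, one_mul, neg_smul]
    rw [LinearMap.smul_apply, hXv, h2]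
    module
  · refine ⟨X, hX, fun v => ?_⟩
    rw [hXv, Finset.sum_eq_zero, sub_zero]
    intro i _
    rw [Q.form_eq_zero_of_ne μ.1 χ.1 h (T _).2 v.2, mul_zero, zero_smul]

theorem exists_finiteCorrespondence (hB : B.Nondegenerate) {ε : ℂ} (hε : ε = 1 ∨ ε = -1)
    (hsymm : ∀ x y, B x y = ε * B y x) (Q : GeneralizedQuiver.{u, v, w} B) :
    ∃ f : Q.ArrowMaps hB, Q.IsFiniteCorrespondence hB f := by
  choose χ μ e he hm hfull using exists_embedding (Q := Q) hB
  have hemb : ∀ α, Q.EmbedsInPiece α (χ α).1 (μ α).1 := fun α => ⟨e α, he α, hm α⟩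
  -- One embedding per label serves all arrows with that label, since these belong to the same
  -- piece.
  have hpiece : ∀ (a : (Q.symmetricQuiver hB).Arrow) z, e (Q.label hB a) z ∈
      liePiece B ((Q.symmetricQuiver hB).tail a).1 ((Q.symmetricQuiver hB).head a).1 := by
    rintro ⟨⟨α, ν, κ⟩, ha⟩ z
    change e α z ∈ liePiece B ν.1 κ.1
    rcases EmbedsInPiece.eq_or_eq hB (hemb α) ha with ⟨rfl, rfl⟩ | ⟨rfl, rfl⟩
    · exact hm α z
    · rw [inv_val, inv_val, liePiece_swap]
      exact hm α z
  let f : Q.ArrowMaps hB := fun a =>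
    { toFun := fun z => (e (Q.label hB a) z).restrict fun x hx => liePiece_mapsTo (hpiece a z) hx
      map_add' := fun z z' => by
        ext x
        exact congrArg (fun k : V →ₗ[ℂ] V => k x) (map_add (e (Q.label hB a)).toLinearMap z z')
      map_smul' := fun c z => by
        ext x
        exact congrArg (fun k : V →ₗ[ℂ] V => k x) (map_smul (e (Q.label hB a)).toLinearMap c z) }
  have hf : ∀ a z x, (f a z x : V) = e (Q.label hB a) z x := fun a z x => rfl
  have heq : ∀ a (r : Q.R) z v, f a (Q.ρ _ r z) (Q.act r _ v) = Q.act r _ (f a z v) := by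
    intro a r z v
    apply Subtype.ext
    have h1 : (e (Q.label hB a)) (Q.ρ _ r z) = adRep Q.R r (e (Q.label hB a) z) :=
      Representation.IntertwiningMap.isIntertwining _ _ (e _) r z
    have h2 : (r : V ≃ₗ[ℂ] V)⁻¹ ((r : V ≃ₗ[ℂ] V) (v : V)) = v := by
      rw [← LinearEquiv.mul_apply, inv_mul_cancel]
      rfl
    change e (Q.label hB a) (Q.ρ _ r z) ((r : V ≃ₗ[ℂ] V) (v : V)) =
      (r : V ≃ₗ[ℂ] V) (e (Q.label hB a) z v)
    rw [h1, adRep_apply]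
    exact congrArg (fun w => (r : V ≃ₗ[ℂ] V) (e (Q.label hB a) z w)) h2
  have horth : ∀ z : ∀ α, Q.Z α, (Q.symmetricQuiver hB).IsOrthogonalRep (W := Q.space) Q.form
      fun a => f a (z (Q.label hB a)) := by
    intro z a x y
    change B (e (Q.label hB a) (z (Q.label hB a)) x) y + B x (e (Q.label hB a) (z _) y) = 0
    rw [liePiece_skew (hpiece a _)]
    exact neg_add_cancel _
  refine ⟨f, heq, ⟨fun z _ => ⟨horth z, fun a ha ed => ?_⟩, fun z _ z' _ h => ?_, ?_⟩⟩
  -- The trace along an irreducible loop is an R-invariant functional on a non-trivial irreducible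
  -- representation.
  · let l : Q.Z (Q.label hB a) →ₗ[ℂ] ℂ :=
      LinearMap.trace ℂ _ ∘ₗ LinearMap.llcomp ℂ _ _ _
        (LinearEquiv.cast (R := ℂ) (M := Q.space) ed).toLinearMap ∘ₗ f a
    have hl : l = 0 := invariant_functional_eq_zero ha (Q.nontrivial _) l fun r z =>
      trace_cast_comp_conj (M := Q.space) (N := Q.space) (Q.actEquiv r) ed (f a z)
        (f a (Q.ρ _ r z)) fun x => heq a r z x
    exact LinearMap.congr_fun hl _
  · funext α
    let a : (Q.symmetricQuiver hB).Arrow := ⟨(α, χ α, μ α), hemb α⟩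
    refine he α (Q.liePiece_ext hB (hm α _) (hm α _) fun x hx => ?_)
    have h1 := LinearMap.congr_fun (congrFun h a) ⟨x, hx⟩
    exact congrArg Subtype.val h1
  · rintro ψ ⟨hψ, htr⟩
    -- z is found from one representative arrow. The only other arrow that can have this label is
    -- its image under σ, where orthogonality forces the value.
    have key : ∀ α, ∃ z : Q.Z α, ∀ (a : (Q.symmetricQuiver hB).Arrow) (h : Q.label hB a = α),
        f a (h ▸ z) = ψ a := by
      intro α
      let a : (Q.symmetricQuiver hB).Arrow := ⟨(α, χ α, μ α), hemb α⟩
      obtain ⟨X, hX, hXT⟩ := exists_mem_liePiece_of_orthogonal hB hε hsymm (χ := χ α) (μ := μ α)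
        (ψ a) (by
          intro h x y
          -- For χ = μ⁻¹ the involution fixes this arrow, so orthogonality of ψ becomes a condition
          -- on ψ_a alone.
          refine hψ.apply_of_eq (a := a) (b := a) ?_ x y
          refine ((Q.symmetricQuiver hB).σA_of_tail_eq a ?_).symm
          exact Subtype.ext h)
      obtain ⟨z, hz⟩ : ∃ z, e α z = X := by
        rcases hfull α with hirr | hfull
        · obtain ⟨r, z₀, hrz⟩ := Q.nontrivial α
          let U := LinearMap.range (e α).toLinearMap
          have hU : Q.IsAdStable U := by
            rintro r _ ⟨z, rfl⟩
            exact ⟨Q.ρ α r z, Representation.IntertwiningMap.isIntertwining _ _ (e α) r z⟩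
          refine hU.mem_of_mem_liePiece hB hε hsymm (χ := χ α) (μ := μ α) ?_ (Y := e α z₀) ⟨z₀, rfl⟩
            (r := r) ?_ hX ?_
          · rintro _ ⟨z, rfl⟩
            exact hm α z
          · rw [← (e α).isIntertwining]
            exact fun h => hrz (he α h)
          · intro hχμ
            rw [← htr a hirr hχμ.symm]
            congr 1
            ext x
            change (Q.proj (χ α) (X x) : V) = _
            rw [hXT]
            have : ∀ {i j : Q.Weight} (h : j = i) (y : Q.space j),
                (Q.proj i y : V) = LinearEquiv.cast (R := ℂ) (M := Q.space) h y := by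
              intro i j h y
              subst h
              rw [Q.proj_coe]
              rfl
            exact this hχμ.symm _
        · have : X ∈ (liePiece B (χ α).1 (μ α).1 : Set (V →ₗ[ℂ] V)) := hX
          rw [← hfull] at this
          exact this
      refine ⟨z, ?_⟩
      have haz : f a z = ψ a := by
        ext x
        exact (congrArg (fun k : V →ₗ[ℂ] V => k (x : V)) hz).trans (hXT x)
      rintro ⟨⟨β, ν, κ⟩, hb⟩ h
      change β = α at h
      subst h
      change f (⟨(β, ν, κ), hb⟩ : (Q.symmetricQuiver hB).Arrow) (z : Q.Z β) = _
      rcases EmbedsInPiece.eq_or_eq hB (hemb β) hb with ⟨rfl, rfl⟩ | ⟨rfl, rfl⟩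
      · exact haz
      -- For the σ-image arrow: both values satisfy the same adjunction with ψ_a, and V_χ separates
      -- the points of V_{χ⁻¹}.
      · ext y
        rw [← sub_eq_zero]
        refine Q.nondegenerate_weightSpace hB (χ β).1⁻¹ (sub_mem (Subtype.property _)
          (Subtype.property _)) fun x hx => ?_
        rw [character_inv_inv] at hx
        have h1 := hψ a ⟨x, hx⟩ y
        have h2 : B (e β z x) y + B x (e β z y) = 0 := by
          rw [liePiece_skew (hm β z)]
          exact neg_add_cancel _
        have h3 : (ψ a ⟨x, hx⟩ : V) = e β z x := by
          rw [← haz]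
          rfl
        have h4 : B (ψ a ⟨x, hx⟩ : V) y + B x (ψ ((Q.symmetricQuiver hB).σA a) y : V) = 0 := h1
        rw [h3] at h4
        have h5 : B x ((e β z y : V) - (ψ ((Q.symmetricQuiver hB).σA a) y : V)) = 0 := by
          rw [map_sub]
          linear_combination h2 - h4
        rw [hsymm]
        refine (congrArg (ε * ·) h5).trans (mul_zero ε)
    choose z hz using key
    exact ⟨z, trivial, funext fun a => hz _ a rfl⟩

end GeneralizedQuiver

/-! ### Holomorphic maps and sections -/

section Holomorphic

variable {EX : Type*} [NormedAddCommGroup EX] [NormedSpace ℂ EX]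
  {X : Type*} [TopologicalSpace X] [ChartedSpace EX X]
  {F F' : Type*} [NormedAddCommGroup F] [NormedSpace ℂ F] [NormedAddCommGroup F'] [NormedSpace ℂ F']

theorem HolOn.mono {U U' : Set X} {f : X → F} (h : HolOn EX U f) (hU : U' ⊆ U) : HolOn EX U' f :=
  ContMDiffOn.mono h hU

theorem HolOn.congr {U : Set X} {f f' : X → F} (h : HolOn EX U f) (hf : ∀ x ∈ U, f' x = f x) :
    HolOn EX U f' :=
  ContMDiffOn.congr h hf

theorem HolOn.congr_iff {U : Set X} {f f' : X → F} (hf : ∀ x ∈ U, f' x = f x) :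
    HolOn EX U f' ↔ HolOn EX U f :=
  ⟨fun h => h.congr fun x hx => (hf x hx).symm, fun h => h.congr hf⟩

theorem holOn_of_locally {U : Set X} {f : X → F}
    (h : ∀ x ∈ U, ∃ U', IsOpen U' ∧ x ∈ U' ∧ HolOn EX (U ∩ U') f) : HolOn EX U f :=
  contMDiffOn_of_locally_contMDiffOn h

theorem holOn_const {U : Set X} (c : F) : HolOn EX U fun _ => c :=
  contMDiffOn_const

theorem HolOn.add {U : Set X} {f f' : X → F} (h : HolOn EX U f) (h' : HolOn EX U f') :
    HolOn EX U fun x => f x + f' x :=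
  ContMDiffOn.add h h'

theorem HolOn.sum {ι : Type*} {s : Finset ι} {U : Set X} {f : ι → X → F}
    (h : ∀ i ∈ s, HolOn EX U (f i)) : HolOn EX U fun x => ∑ i ∈ s, f i x :=
  contMDiffOn_finsetSum h

theorem HolOn.smul {U : Set X} {a : X → ℂ} {f : X → F} (ha : HolOn EX U a) (hf : HolOn EX U f) :
    HolOn EX U fun x => a x • f x :=
  ContMDiffOn.smul ha hf

theorem HolOn.clm {U : Set X} {f : X → F} (h : HolOn EX U f) (L : F →L[ℂ] F') :
    HolOn EX U fun x => L (f x) :=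
  L.contMDiff.comp_contMDiffOn h

theorem HolOn.linear [FiniteDimensional ℂ F] {U : Set X} {f : X → F} (h : HolOn EX U f)
    (L : F →ₗ[ℂ] F') : HolOn EX U fun x => L (f x) :=
  h.clm (LinearMap.toContinuousLinearMap L)

theorem HolOn.of_coord {ι : Type*} [Fintype ι] (b : Module.Basis ι ℂ F) {U : Set X} {f : X → F}
    (h : ∀ i, HolOn EX U fun x => b.coord i (f x)) : HolOn EX U f :=
  (HolOn.sum (s := Finset.univ) fun i _ => (h i).smul (holOn_const (b i))).congr fun x _ =>
    (b.sum_repr (f x)).symm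

/-- Holomorphic families of linear maps, applied to holomorphic maps. -/
theorem HolOn.linear_apply [FiniteDimensional ℂ F] {U : Set X} {T : X → F →ₗ[ℂ] F'} {f : X → F}
    (hT : ∀ y, HolOn EX U fun x => T x y) (hf : HolOn EX U f) : HolOn EX U fun x => T x (f x) := by
  let b := Module.finBasis ℂ F
  refine (HolOn.sum (s := Finset.univ) fun i _ => (hf.linear (b.coord i)).smul (hT (b i))).congr
    fun x _ => ?_
  conv_lhs => rw [← b.sum_repr (f x)]
  rw [map_sum]
  exact Finset.sum_congr rfl fun i _ => map_smul _ _ _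

/-- A pointwise holomorphic family of operators is holomorphic. -/
theorem HolOn.of_apply [FiniteDimensional ℂ F] {U : Set X} {T : X → F →L[ℂ] F'}
    (hT : ∀ y, HolOn EX U fun x => T x y) : HolOn EX U T := by
  let b := Module.finBasis ℂ F
  refine (HolOn.sum (s := Finset.univ) fun i _ => (hT (b i)).clm
    (ContinuousLinearMap.smulRightL ℂ F F' (LinearMap.toContinuousLinearMap (b.coord i)))).congr
    fun x _ => ?_
  ext v
  conv_lhs => rw [← b.sum_repr v]
  rw [map_sum, sum_apply]
  exact Finset.sum_congr rfl fun i _ => map_smul _ _ _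

/-- A map is holomorphic if all its pairings by a bilinear form non-degenerate on the left are. -/
theorem HolOn.of_pairing [FiniteDimensional ℂ F] {G : Type*} [AddCommGroup G] [Module ℂ G]
    [FiniteDimensional ℂ G] (C : F →ₗ[ℂ] G →ₗ[ℂ] ℂ) (hC : ∀ y, (∀ z, C y z = 0) → y = 0)
    {U : Set X} {f : X → F} (h : ∀ z, HolOn EX U fun x => C (f x) z) : HolOn EX U f := by
  let b := Module.finBasis ℂ G
  -- Pairing with a basis of G embeds F in a coordinate space; a linear left inverse brings
  -- holomorphy back.
  let L : F →ₗ[ℂ] (Fin (Module.finrank ℂ G) → ℂ) := LinearMap.pi fun i => C.flip (b i)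
  have hL : LinearMap.ker L = ⊥ := LinearMap.ker_eq_bot'.2 fun y hy => hC y fun z => by
    have : C y = 0 := b.ext fun i => congrFun hy i
    rw [this, LinearMap.zero_apply]
  obtain ⟨P, hP⟩ := L.exists_leftInverse_of_injective hL
  have h1 : HolOn EX U fun x => L (f x) := by
    refine HolOn.of_coord (Pi.basisFun ℂ _) fun i => ?_
    exact (h (b i)).congr fun x _ => by simp [L]
  exact (h1.linear P).congr fun x _ => (LinearMap.congr_fun hP (f x)).symm

/-- Composition of a holomorphic map with a map that is analytic at all its values. -/
theorem HolOn.comp_contDiffAt {U : Set X} {f : X → F} {k : F → F'} (h : HolOn EX U f)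
    (hk : ∀ x ∈ U, ContDiffAt ℂ ω k (f x)) : HolOn EX U fun x => k (f x) := fun x hx =>
  (hk x hx).contMDiffAt.comp_contMDiffWithinAt x (h x hx)

namespace HolVectorBundle

variable (E : HolVectorBundle EX X F) {U U' : Set X}

theorem IsHolOn.mono {E : HolVectorBundle EX X F} {s : ∀ x, E.Fib x} (h : E.IsHolOn U s)
    (hU : U' ⊆ U) : E.IsHolOn U' s :=
  ContMDiffOn.mono h hU

theorem IsHolOn.congr {E : HolVectorBundle EX X F} {s s' : ∀ x, E.Fib x} (h : E.IsHolOn U s)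
    (hs : ∀ x ∈ U, s' x = s x) : E.IsHolOn U s' :=
  ContMDiffOn.congr h fun x hx => by rw [hs x hx]

theorem isHolOn_of_locally {s : ∀ x, E.Fib x}
    (h : ∀ x ∈ U, ∃ U', IsOpen U' ∧ x ∈ U' ∧ E.IsHolOn (U ∩ U') s) : E.IsHolOn U s :=
  contMDiffOn_of_locally_contMDiffOn h

/-- A family of linear coordinates of the fibres over `U` which detects holomorphic sections. -/
def IsFrameOn (U : Set X) (f : ∀ x, F ≃ₗ[ℂ] E.Fib x) : Prop :=
  ∀ U' ⊆ U, IsOpen U' → ∀ s, E.IsHolOn U' s ↔ HolOn EX U' fun x => (f x).symm (s x)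

variable {E} in
theorem IsFrameOn.mono {f : ∀ x, F ≃ₗ[ℂ] E.Fib x} (hf : E.IsFrameOn U f) (hU : U' ⊆ U) :
    E.IsFrameOn U' f :=
  fun U'' h => hf U'' (h.trans hU)

variable {E} in
theorem IsFrameOn.isHolOn_apply {f : ∀ x, F ≃ₗ[ℂ] E.Fib x} (hf : E.IsFrameOn U f) (hU : IsOpen U)
    {t : X → F} (ht : HolOn EX U t) : E.IsHolOn U fun x => f x (t x) :=
  (hf U subset_rfl hU _).2 (ht.congr fun x _ => (f x).symm_apply_apply _)

theorem exists_isFrameOn (x₀ : X) : ∃ U, IsOpen U ∧ x₀ ∈ U ∧ ∃ f, E.IsFrameOn U f := by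
  classical
  let e := trivializationAt F E.Fib x₀
  -- Frames are total functions of the base point; off the trivializing set the value is an
  -- arbitrary fibre coordinate.
  let f : ∀ x, F ≃ₗ[ℂ] E.Fib x := fun x =>
    if h : x ∈ e.baseSet then (e.continuousLinearEquivAt ℂ x h).symm.toLinearEquiv
    else (VectorBundle.continuousLinearEquivAt ℂ F E.Fib x).symm.toLinearEquiv
  refine ⟨e.baseSet, e.open_baseSet, FiberBundle.mem_baseSet_trivializationAt' x₀, f,
    fun U' hU' ho s => ?_⟩
  refine (e.contMDiffOn_section_iff ho hU').trans (HolOn.congr_iff fun x hx => ?_)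
  have : f x = (e.continuousLinearEquivAt ℂ x (hU' hx)).symm.toLinearEquiv := dif_pos (hU' hx)
  rw [this]
  rfl

/-- Sections which are locally holomorphic combinations of holomorphic sections are holomorphic. -/
theorem IsHolOn.sum_smul {E : HolVectorBundle EX X F} {ι : Type*} {I : Finset ι} {a : ι → X → ℂ}
    {s : ι → ∀ x, E.Fib x} (hU : IsOpen U) (ha : ∀ i, HolOn EX U (a i))
    (hs : ∀ i, E.IsHolOn U (s i)) : E.IsHolOn U fun x => ∑ i ∈ I, a i x • s i x := by
  refine E.isHolOn_of_locally fun x hx => ?_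
  obtain ⟨U', hU', hx', f, hf⟩ := E.exists_isFrameOn x
  refine ⟨U', hU', hx', ?_⟩
  have hUU : IsOpen (U ∩ U') := hU.inter hU'
  rw [hf _ Set.inter_subset_right hUU]
  refine (HolOn.sum (s := I) fun i _ => ((ha i).mono Set.inter_subset_left).smul
    ((hf _ Set.inter_subset_right hUU (s i)).1 ((hs i).mono Set.inter_subset_left))).congr
    fun y _ => ?_
  simp

theorem IsHolOn.linear_apply {E : HolVectorBundle EX X F} [FiniteDimensional ℂ F'] (hU : IsOpen U)
    {T : ∀ x, F' →ₗ[ℂ] E.Fib x} {t : X → F'} (hT : ∀ y, E.IsHolOn U fun x => T x y)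
    (ht : HolOn EX U t) : E.IsHolOn U fun x => T x (t x) := by
  let b := Module.finBasis ℂ F'
  refine (IsHolOn.sum_smul (I := Finset.univ) hU (fun i => ht.linear (b.coord i))
    (fun i => hT (b i))).congr fun x _ => ?_
  conv_lhs => rw [← b.sum_repr (t x)]
  rw [map_sum]
  exact Finset.sum_congr rfl fun i _ => map_smul _ _ _

end HolVectorBundle

end Holomorphic

/-! ### Principal bundles -/

namespace HolPrincipalBundle

variable {EX : Type*} [NormedAddCommGroup EX] [NormedSpace ℂ EX]
  {X : Type v} [TopologicalSpace X] [ChartedSpace EX X]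
  {V : Type u} [NormedAddCommGroup V] [NormedSpace ℂ V] {R : Subgroup (V ≃ₗ[ℂ] V)}
  (E : HolPrincipalBundle EX X R)

theorem act_div {x : X} (p q : E.Fib x) : E.act x p (E.div p q) = q :=
  (E.torsor x p q).choose_spec.1

theorem div_eq {x : X} {p q : E.Fib x} {r : R} (h : E.act x p r = q) : E.div p q = r :=
  ((E.torsor x p q).choose_spec.2 r h).symm

theorem div_self {x : X} (p : E.Fib x) : E.div p p = 1 :=
  E.div_eq (E.act_one x p)

theorem div_mul_div {x : X} (p q q' : E.Fib x) : E.div p q * E.div q q' = E.div p q' :=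
  (E.div_eq (by rw [E.act_mul, E.act_div, E.act_div])).symm

theorem div_act {x : X} (p q : E.Fib x) (r : R) : E.div p (E.act x q r) = E.div p q * r :=
  E.div_eq (by rw [E.act_mul, E.act_div])

theorem isHolOn_atlas {c : Set X × (∀ x, E.Fib x)} (hc : c ∈ E.atlas) : E.IsHolOn c.1 c.2 :=
  fun c' hc' y => (E.transition c' hc' c hc y).mono fun _ hx => ⟨hx.2, hx.1⟩

theorem IsHolOn.mono {E : HolPrincipalBundle EX X R} {U U' : Set X} {s : ∀ x, E.Fib x}
    (h : E.IsHolOn U s) (hU : U' ⊆ U) : E.IsHolOn U' s :=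
  fun c hc y => (h c hc y).mono (Set.inter_subset_inter_left _ hU)

end HolPrincipalBundle

namespace GeneralizedQuiver

variable {EX : Type*} [NormedAddCommGroup EX] [NormedSpace ℂ EX]
  {X : Type v} [TopologicalSpace X] [ChartedSpace EX X]
  {V : Type u} [NormedAddCommGroup V] [NormedSpace ℂ V] [FiniteDimensional ℂ V]
  {B : LinearMap.BilinForm ℂ V} {Q : GeneralizedQuiver.{u} B} {hB : B.Nondegenerate} {ε : ℂ}

/-! ### Isometric frames -/

/-- A family of isometric frames of the bundles of an orthogonal vertex bundle. -/
def IsIsometricFrame (W : OrthVertexBundle EX X (Q.symmetricQuiver hB) ε Q.space) (x : X)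
    (c : ∀ χ : Q.Weight, Q.space χ ≃ₗ[ℂ] (W.bdl χ).Fib x) : Prop :=
  ∀ (χ μ : Q.Weight) v w, W.g x χ μ (c χ v) (c μ w) = Q.form χ μ v w

/-- Holomorphic isometric frames detect holomorphic sections. -/
theorem isFrameOn_of_isometric (W : OrthVertexBundle EX X (Q.symmetricQuiver hB) ε Q.space)
    {U : Set X} {c : ∀ x, ∀ χ : Q.Weight, Q.space χ ≃ₗ[ℂ] (W.bdl χ).Fib x}
    (hc : ∀ x ∈ U, IsIsometricFrame W x (c x))
    (hol : ∀ (χ : Q.Weight) v, (W.bdl χ).IsHolOn U fun x => c x χ v) (χ : Q.Weight) :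
    (W.bdl χ).IsFrameOn U fun x => c x χ := by
  intro U' hU' ho s
  constructor
  · intro hs
    -- The coordinates of s are detected by pairing s, under the holomorphic form g, with the frame
    -- vectors at χ⁻¹. No inverse of the frame has to be shown holomorphic.
    refine HolOn.of_pairing (Q.form χ (Q.inv hB χ))
      (fun y hy => Subtype.ext (Q.form_nondegenerate hB χ y.2 fun z hz => hy ⟨z, hz⟩)) fun z => ?_
    refine (W.g_hol U' χ (Q.inv hB χ) s _ ho hs ((hol _ z).mono hU')).congr fun x hx => ?_
    have h := hc x (hU' hx) χ (Q.inv hB χ) ((c x χ).symm (s x)) z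
    rw [LinearEquiv.apply_symm_apply] at h
    exact h.symm
  · intro hs
    refine (HolVectorBundle.IsHolOn.linear_apply ho (T := fun x => (c x χ).toLinearMap)
      (fun y => (hol χ y).mono hU') hs).congr fun x _ => ?_
    exact ((c x χ).apply_symm_apply _).symm

/-- Isometric frames at the same point differ by an element of `R`. -/
theorem exists_act_of_isometric (W : OrthVertexBundle EX X (Q.symmetricQuiver hB) ε Q.space)
    {x : X} {c c' : ∀ χ : Q.Weight, Q.space χ ≃ₗ[ℂ] (W.bdl χ).Fib x}
    (hc : IsIsometricFrame W x c) (hc' : IsIsometricFrame W x c') :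
    ∃ r : Q.R, ∀ χ v, c χ (Q.act r χ v) = c' χ v := by
  let a : ∀ χ : Q.Weight, Q.space χ ≃ₗ[ℂ] Q.space χ := fun χ => (c' χ).trans (c χ).symm
  have hca : ∀ χ v, c χ (a χ v) = c' χ v := fun χ v => (c χ).apply_symm_apply _
  have ha : ∀ (χ μ : Q.Weight) (v : Q.space χ) (w : Q.space μ),
      Q.form χ μ (a χ v) (a μ w) = Q.form χ μ v w := fun χ μ v w => by
    rw [← hc, hca, hca, hc']
  exact ⟨Q.ofFamily a ha, fun χ v => by rw [act_ofFamily, hca]⟩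

/-- A family of elements of `R` is holomorphic if its actions on the isotypic components are. -/
theorem holOn_of_act {U : Set X} {r : X → Q.R}
    (h : ∀ (χ : Q.Weight) v, HolOn EX U fun x => Q.act (r x) χ v) (y : V) :
    HolOn EX U fun x => (r x : V ≃ₗ[ℂ] V) y := by
  refine (HolOn.sum (s := Finset.univ) fun χ _ =>
    (h χ (Q.proj χ y)).linear (weightSpace χ.1).subtype).congr fun x _ => ?_
  conv_lhs => rw [← Q.sum_proj y]
  rw [map_sum]
  rfl

theorem holOn_act {U : Set X} {r : X → Q.R}
    (h : ∀ y : V, HolOn EX U fun x => (r x : V ≃ₗ[ℂ] V) y) (χ : Q.Weight) (v : Q.space χ) :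
    HolOn EX U fun x => Q.act (r x) χ v := by
  refine ((h v).linear (Q.proj χ)).congr fun x _ => ?_
  exact (Q.proj_coe χ _).symm

namespace VertexIdentification

variable {E : HolPrincipalBundle EX X Q.R}
  {W : OrthVertexBundle EX X (Q.symmetricQuiver hB) ε Q.space} (u : Q.VertexIdentification E W)

omit [FiniteDimensional ℂ V] in
theorem isIsometricFrame {x : X} (p : E.Fib x) : IsIsometricFrame W x (u.frame x p) :=
  u.isometry x p

/-- R acts faithfully on ⊕ V_χ. -/
theorem frame_injective {x : X} {p q : E.Fib x} (h : ∀ χ v, u.frame x p χ v = u.frame x q χ v) :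
    p = q := by
  have : E.div p q = 1 := Q.R_ext fun χ v => by
    have h1 := h χ v
    conv_rhs at h1 => rw [← E.act_div p q]
    rw [u.equivariant] at h1
    rw [act_one]
    exact ((u.frame x p χ).injective h1).symm
  rw [← E.act_div p q, this, E.act_one]

theorem exists_frame_eq {x : X} (hne : Nonempty (E.Fib x))
    {c : ∀ χ : Q.Weight, Q.space χ ≃ₗ[ℂ] (W.bdl χ).Fib x}
    (hc : IsIsometricFrame W x c) : ∃ p, ∀ χ v, u.frame x p χ v = c χ v := by
  obtain ⟨p⟩ := hne
  obtain ⟨r, hr⟩ := exists_act_of_isometric W (u.isIsometricFrame p) hc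
  exact ⟨E.act x p r, fun χ v => by rw [u.equivariant, hr]⟩

theorem isFrameOn {U : Set X} (hU : IsOpen U) {s : ∀ x, E.Fib x} (hs : E.IsHolOn U s)
    (χ : Q.Weight) : (W.bdl χ).IsFrameOn U fun x => u.frame x (s x) χ :=
  isFrameOn_of_isometric W (fun x _ => u.isIsometricFrame (s x)) (fun χ v => u.hol U s hU hs χ v) χ

/-- A section of the principal bundle is holomorphic if and only if its frames are. -/
theorem isHolOn_iff {U : Set X} (hU : IsOpen U) (s : ∀ x, E.Fib x) :
    E.IsHolOn U s ↔ ∀ (χ : Q.Weight) v, (W.bdl χ).IsHolOn U fun x => u.frame x (s x) χ v := by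
  refine ⟨u.hol U s hU, fun h c hc => holOn_of_act fun χ v => ?_⟩
  -- In the frame of an atlas section, the coordinates of the frame of s are given by the action of
  -- the group element relating the two sections.
  have hf := u.isFrameOn (E.isOpen c hc) (E.isHolOn_atlas hc) χ
  refine ((hf _ Set.inter_subset_right (hU.inter (E.isOpen c hc)) _).1
    ((h χ v).mono Set.inter_subset_left)).congr fun x _ => ?_
  rw [LinearEquiv.eq_symm_apply]
  conv_rhs => rw [← E.act_div (c.2 x) (s x)]
  rw [u.equivariant]

end VertexIdentification

/-! ### The orthogonal bundle of a principal bundle -/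

variable (Q) in
/-- The action of `R` on an isotypic component by continuous maps. -/
def actL (r : Q.R) (χ : Q.Weight) : Q.space χ →L[ℂ] Q.space χ :=
  LinearMap.toContinuousLinearMap (Q.act r χ)

/-- The gluing data of the vector bundle `E ×_R V_χ`. -/
def associatedCore (E : HolPrincipalBundle EX X Q.R) (χ : Q.Weight) :
    VectorBundleCore ℂ X (Q.space χ) E.atlas where
  baseSet i := i.1.1
  isOpen_baseSet i := E.isOpen _ i.2
  indexAt x := ⟨(E.cover x).choose, (E.cover x).choose_spec.1⟩
  mem_baseSet_at x := (E.cover x).choose_spec.2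
  coordChange i j x := Q.actL (E.div (j.1.2 x) (i.1.2 x)) χ
  coordChange_self i x _ v := by
    rw [E.div_self]
    exact Q.act_one χ v
  continuousOn_coordChange i j := ContMDiffOn.continuousOn (HolOn.of_apply (EX := EX) fun v =>
    holOn_act (fun y => (E.transition _ j.2 _ i.2 y).mono fun _ hx => ⟨hx.2, hx.1⟩) χ v)
  coordChange_comp i j k x _ v := by
    rw [← E.div_mul_div (k.1.2 x) (j.1.2 x) (i.1.2 x)]
    exact (Q.act_mul _ _ χ v).symm

instance (E : HolPrincipalBundle EX X Q.R) (χ : Q.Weight) :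
    (associatedCore E χ).IsContMDiff 𝓘(ℂ, EX) ω where
  contMDiffOn_coordChange i j := HolOn.of_apply (EX := EX) fun v =>
    holOn_act (fun y => (E.transition _ j.2 _ i.2 y).mono fun _ hx => ⟨hx.2, hx.1⟩) χ v

/-- The vector bundle `E ×_R V_χ`. -/
def associatedBundle (E : HolPrincipalBundle EX X Q.R) (χ : Q.Weight) :
    HolVectorBundle.{u} EX X (Q.space χ) where
  Fib := (associatedCore E χ).Fiber

/-- The local section of the principal bundle used for coordinates at a point. -/
def baseFrame (E : HolPrincipalBundle EX X Q.R) (x : X) : E.Fib x := (E.cover x).choose.2 x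

/-- The fibre at x is V_χ read in the frame `baseFrame E x`, which need not vary continuously with
x. The group element relating it to the section of the chart converts to chart coordinates. -/
theorem associatedBundle_isHolOn_iff (E : HolPrincipalBundle EX X Q.R) (χ : Q.Weight)
    {c : Set X × (∀ x, E.Fib x)} (hc : c ∈ E.atlas) {U : Set X} (hU : IsOpen U) (hUc : U ⊆ c.1)
    (s : X → Q.space χ) :
    (associatedBundle E χ).IsHolOn U s ↔
      HolOn EX U fun x => Q.act (E.div (c.2 x) (baseFrame E x)) χ (s x) :=
  haveI : MemTrivializationAtlas ((associatedCore E χ).localTriv ⟨c, hc⟩) := ⟨⟨⟨c, hc⟩, rfl⟩⟩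
  ((associatedCore E χ).localTriv ⟨c, hc⟩).contMDiffOn_section_iff hU hUc

/-- The orthogonal bundle `E ×_R V`. -/
def associatedOrthBundle (hB : B.Nondegenerate) (hsymm : ∀ x y, B x y = ε * B y x)
    (E : HolPrincipalBundle EX X Q.R) :
    OrthVertexBundle EX X (Q.symmetricQuiver hB) ε Q.space where
  bdl χ := associatedBundle E χ
  g _ χ μ := Q.form χ μ
  g_form _ := Q.form_isOrthogonalForm hB hsymm
  g_hol U χ μ s t hU hs ht := by
    refine holOn_of_locally fun x hx => ?_
    obtain ⟨c, hc, hxc⟩ := E.cover x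
    refine ⟨c.1, E.isOpen c hc, hxc, ?_⟩
    have hUc := hU.inter (E.isOpen c hc)
    have hs' := (associatedBundle_isHolOn_iff E χ hc hUc Set.inter_subset_right s).1
      (hs.mono Set.inter_subset_left)
    have ht' := (associatedBundle_isHolOn_iff E μ hc hUc Set.inter_subset_right t).1
      (ht.mono Set.inter_subset_left)
    -- In chart coordinates the form is the constant form B.
    refine (HolOn.linear_apply (T := fun x =>
      Q.form χ μ (Q.act (E.div (c.2 x) (baseFrame E x)) χ (s x))) (fun y => hs'.linear ((Q.form χ μ).flip y)) ht').congr fun x _ => ?_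
    exact (Q.form_act _ χ μ _ _).symm

theorem exists_associatedOrthBundle (hB : B.Nondegenerate) (hsymm : ∀ x y, B x y = ε * B y x)
    (E : HolPrincipalBundle EX X Q.R) :
    ∃ W : OrthVertexBundle EX X (Q.symmetricQuiver hB) ε Q.space,
      Nonempty (Q.VertexIdentification E W) := by
  refine ⟨associatedOrthBundle hB hsymm E, ⟨{
    frame := fun x p χ => Q.actEquiv (E.div (baseFrame E x) p) χ
    equivariant := fun x p r χ v => ?_
    isometry := fun x p χ μ v w => Q.form_act _ χ μ v w
    hol := fun U s hU hs χ v => ?_ }⟩⟩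
  · rw [E.div_act]
    exact Q.act_mul _ _ χ v
  · refine HolVectorBundle.isHolOn_of_locally _ fun x hx => ?_
    obtain ⟨c, hc, hxc⟩ := E.cover x
    refine ⟨c.1, E.isOpen c hc, hxc, ?_⟩
    refine (associatedBundle_isHolOn_iff E χ hc (hU.inter (E.isOpen c hc))
      Set.inter_subset_right _).2 ?_
    refine (holOn_act (hs c hc) χ v).congr fun x _ => ?_
    rw [← E.div_mul_div (c.2 x) (baseFrame E x) (s x)]
    exact (Q.act_mul _ _ χ v).symm

end GeneralizedQuiver

/-! ### Square roots -/

section SquareRoots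

open Polynomial in
/-- The class of `X` is a square modulo a polynomial which does not vanish at zero. -/
theorem Polynomial.exists_dvd_sq_sub_X {m : ℂ[X]} (hm : m.coeff 0 ≠ 0) : ∃ p : ℂ[X], m ∣ p ^ 2 - X := by
  classical
  have hm0 : m ≠ 0 := by rintro rfl; simp at hm
  choose sq hsq using fun z : ℂ => IsAlgClosed.exists_pow_nat_eq z (n := 2) two_pos
  -- Interpolating square roots at the roots of m gives q with q² - X vanishing at every root, so q²
  -- - X is nilpotent modulo m.
  let q : ℂ[X] := Lagrange.interpolate m.roots.toFinset id sq
  have hq : ∀ z ∈ m.roots, (q ^ 2 - X).IsRoot z := by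
    intro z hz
    have h1 : q.eval z = sq z := Lagrange.eval_interpolate_at_node (s := m.roots.toFinset)
      (v := id) sq (Set.injOn_id _) (Multiset.mem_toFinset.2 hz)
    simp [IsRoot.def, h1, hsq]
  have hnil : m ∣ (q ^ 2 - X) ^ Multiset.card m.roots := by
    have h1 : m = C m.leadingCoeff * (m.roots.map fun a => X - C a).prod :=
      (IsAlgClosed.splits m).eq_prod_roots
    have h2 : (m.roots.map fun a => X - C a).prod ∣
        (m.roots.map fun _ => q ^ 2 - X).prod :=
      Multiset.prod_dvd_prod_of_dvd _ _ fun a ha => dvd_iff_isRoot.2 (hq a ha)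
    rw [Multiset.map_const', Multiset.prod_replicate] at h2
    rw [h1]
    have hu : IsUnit (C m.leadingCoeff) := isUnit_C.2 (leadingCoeff_ne_zero.2 hm0).isUnit
    refine (hu.mul_left_dvd).2 ?_
    rw [← h1]
    exact h2
  let K := AdjoinRoot m
  have hX : IsUnit (AdjoinRoot.mk m X) := by
    have hc : IsCoprime X m := irreducible_X.coprime_iff_not_dvd.2 (by rwa [X_dvd_iff])
    obtain ⟨a, b, hab⟩ := hc
    refine IsUnit.of_mul_eq_one (AdjoinRoot.mk m a) ?_
    have := congrArg (AdjoinRoot.mk m) hab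
    rw [map_add, map_mul, map_mul, AdjoinRoot.mk_self, mul_zero, add_zero, map_one] at this
    rwa [mul_comm]
  -- Newton lifting corrects q to an exact root of T² = X in ℂ[X]/(m); the derivative 2q is a unit
  -- since X is a unit modulo m.
  let P : K[X] := X ^ 2 - C (AdjoinRoot.mk m X)
  have hP : IsNilpotent (aeval (AdjoinRoot.mk m q) P) := by
    refine ⟨Multiset.card m.roots, ?_⟩
    have : aeval (AdjoinRoot.mk m q) P = AdjoinRoot.mk m (q ^ 2 - X) := by
      simp [P, K]
    rw [this, ← map_pow, AdjoinRoot.mk_eq_zero]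
    exact hnil
  have hunit : IsUnit (AdjoinRoot.mk m q) := by
    have h1 : IsNilpotent (AdjoinRoot.mk m (q ^ 2 - X)) :=
      ⟨_, by rw [← map_pow, AdjoinRoot.mk_eq_zero]; exact hnil⟩
    have h2 := h1.isUnit_add_left_of_commute hX (Commute.all _ _)
    rw [← map_add, add_sub_cancel, map_pow] at h2
    exact (isUnit_pow_iff two_ne_zero).1 h2
  have hP' : IsUnit (aeval (AdjoinRoot.mk m q) (derivative P)) := by
    have h2 : IsUnit (2 : K) := by
      have := (IsUnit.mk0 (2 : ℂ) two_ne_zero).map (algebraMap ℂ K)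
      rwa [map_ofNat] at this
    have : aeval (AdjoinRoot.mk m q) (derivative P) = 2 * AdjoinRoot.mk m q := by
      simp [P, one_add_one_eq_two]
    rw [this]
    exact h2.mul hunit
  obtain ⟨r, ⟨-, hr⟩, -⟩ := existsUnique_nilpotent_sub_and_aeval_eq_zero hP hP'
  obtain ⟨p, rfl⟩ := AdjoinRoot.mk_surjective r
  refine ⟨p, ?_⟩
  rw [← AdjoinRoot.mk_eq_zero, ← hr]
  simp [P, K]

open Polynomial in
/-- Invertible elements of finite-dimensional complex algebras have polynomial square roots. -/
theorem IsUnit.exists_aeval_sq_eq {A : Type*} [Ring A] [Algebra ℂ A] [FiniteDimensional ℂ A] {s : A}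
    (hs : IsUnit s) : ∃ p : ℂ[X], aeval s p ^ 2 = s := by
  have hint : IsIntegral ℂ s := Algebra.IsIntegral.isIntegral s
  -- Since s is invertible, the power of X dividing its minimal polynomial can be cancelled, and the
  -- remaining factor m still annihilates s.
  obtain ⟨m, hm, hdvd⟩ := (minpoly ℂ s).exists_eq_pow_rootMultiplicity_mul_and_not_dvd
    (minpoly.ne_zero hint) 0
  rw [C_0, sub_zero] at hm hdvd
  have hms : aeval s m = 0 := by
    have h := minpoly.aeval ℂ s
    rw [hm, map_mul, map_pow, aeval_X] at h
    exact ((hs.pow _).mul_right_eq_zero).1 h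
  rw [X_dvd_iff] at hdvd
  obtain ⟨p, c, hc⟩ := exists_dvd_sq_sub_X hdvd
  refine ⟨p, ?_⟩
  have h := congrArg (aeval s) hc
  rw [map_sub, map_pow, map_mul, hms, zero_mul, aeval_X] at h
  exact sub_eq_zero.1 h

open Filter Topology in
/-- Analytic square roots near `1` in a linear subspace of an algebra which is closed under
squares. -/
theorem exists_analytic_sqrt {A : Type*} [NormedRing A] [NormedAlgebra ℂ A] [FiniteDimensional ℂ A]
    (K : Submodule ℂ A) (h1 : 1 ∈ K) (hsq : ∀ a ∈ K, a * a ∈ K) :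
    ∃ r : A → A, ContDiffAt ℂ ω r 1 ∧ r 1 = 1 ∧ (∀ a, r a ∈ K) ∧
      ∀ᶠ a in 𝓝 1, a ∈ K → r a * r a = a := by
  obtain ⟨P₀, hP₀⟩ := K.subtype.exists_leftInverse_of_injective K.ker_subtype
  let P : A →L[ℂ] K := LinearMap.toContinuousLinearMap P₀
  have hP : ∀ a (ha : a ∈ K), P a = ⟨a, ha⟩ := fun a ha => LinearMap.congr_fun hP₀ ⟨a, ha⟩
  -- Squaring restricted to K has derivative 2 at 1, so it has an analytic local inverse there. The
  -- linear projection P to K makes the root a function on all of A.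
  let f : K → K := fun a => P ((a : A) * a)
  let e : K := ⟨1, h1⟩
  have hfe : f e = e := by
    change P (1 * 1) = e
    rw [mul_one, hP 1 h1]
  have hf : ContDiff ℂ ω f :=
    P.contDiff.comp (K.subtypeL.contDiff.mul K.subtypeL.contDiff)
  let f' : K ≃L[ℂ] K := ContinuousLinearEquiv.smulLeft (Units.mk0 (2 : ℂ) two_ne_zero)
  have hf' : HasFDerivAt f (f' : K →L[ℂ] K) e := by
    have h2 := P.hasFDerivAt.comp e ((K.subtypeL.hasFDerivAt (x := e)).mul'
      (K.subtypeL.hasFDerivAt (x := e)))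
    refine h2.congr_fderiv ?_
    ext a : 1
    have h3 : P ((1 : A) * (a : A) + (a : A) * 1) = (2 : ℂ) • a := by
      rw [one_mul, mul_one, map_add, hP a a.2, two_smul]
    exact h3
  have hω : (ω : WithTop ℕ∞) ≠ 0 := by simp
  let l := hf.contDiffAt.localInverse hf' hω
  have hl : ContDiffAt ℂ ω l e := by
    have := hf.contDiffAt.to_localInverse hf' hω
    rwa [hfe] at this
  have hPe : P 1 = e := hP 1 h1
  refine ⟨fun a => l (P a), ?_, ?_, fun a => (l (P a)).2, ?_⟩
  · refine K.subtypeL.contDiff.contDiffAt.comp (1 : A) (ContDiffAt.comp (1 : A) ?_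
      P.contDiff.contDiffAt)
    rwa [hPe]
  · have : l (f e) = e := hf.contDiffAt.localInverse_apply_image hf' hω
    rw [hfe] at this
    simp only [hPe, this]
    rfl
  · have h4 : ∀ᶠ b in 𝓝 e, f (l b) = b := by
      have := (hf.contDiffAt.hasStrictFDerivAt' hf' hω).eventually_right_inverse
      rwa [hfe] at this
    rw [← hPe] at h4
    filter_upwards [P.continuous.continuousAt.eventually h4] with a ha haK
    have h5 : f (l (P a)) = ⟨_, hsq _ (l (P a)).2⟩ := hP _ _
    have h6 := ha.symm.trans h5
    rw [hP a haK] at h6 ⊢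
    exact (congrArg Subtype.val h6).symm

end SquareRoots

/-! ### Symmetric operators -/

section SymmetricOperators

variable {V : Type u} [NormedAddCommGroup V] [NormedSpace ℂ V]

/-- The endomorphisms which are symmetric with respect to `B` and commute with `H`. -/
def symmetricOperators (B : LinearMap.BilinForm ℂ V) (H : Subgroup (V ≃ₗ[ℂ] V)) :
    Submodule ℂ (V →L[ℂ] V) where
  carrier := {T | (∀ v w, B (T v) w = B v (T w)) ∧ ∀ h ∈ H, ∀ v, T (h v) = h (T v)}
  add_mem' := by
    rintro S T ⟨hS, hS'⟩ ⟨hT, hT'⟩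
    exact ⟨fun v w => by simp [hS, hT], fun h hh v => by simp [hS' h hh, hT' h hh]⟩
  zero_mem' := ⟨fun v w => by simp, fun h hh v => by simp⟩
  smul_mem' := by
    rintro c S ⟨hS, hS'⟩
    exact ⟨fun v w => by simp [hS], fun h hh v => by simp [hS' h hh]⟩

variable {B : LinearMap.BilinForm ℂ V} {H : Subgroup (V ≃ₗ[ℂ] V)} {T : V →L[ℂ] V}

theorem one_mem_symmetricOperators : 1 ∈ symmetricOperators B H :=
  ⟨fun _ _ => rfl, fun _ _ _ => rfl⟩

/-- Products of symmetric operators need not be symmetric, but powers are. Polynomials in one such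
operator, and the squaring map, therefore stay in the space. -/
theorem pow_mem_symmetricOperators (hT : T ∈ symmetricOperators B H) (n : ℕ) :
    T ^ n ∈ symmetricOperators B H := by
  induction n with
  | zero => exact one_mem_symmetricOperators
  | succ n ih =>
    refine ⟨fun v w => ?_, fun h hh v => ?_⟩
    · conv_lhs => rw [pow_succ]
      rw [pow_succ']
      exact (ih.1 _ _).trans (hT.1 _ _)
    · rw [pow_succ]
      exact (congrArg _ (hT.2 h hh v)).trans (ih.2 h hh _)

theorem aeval_mem_symmetricOperators (hT : T ∈ symmetricOperators B H) (p : Polynomial ℂ) :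
    Polynomial.aeval T p ∈ symmetricOperators B H := by
  rw [Polynomial.aeval_eq_sum_range]
  exact Submodule.sum_mem _ fun i _ => Submodule.smul_mem _ _ (pow_mem_symmetricOperators hT i)

theorem mem_symmetricOperators_of_mul_eq_one {S : V →L[ℂ] V} (hT : T ∈ symmetricOperators B H)
    (hTS : T * S = 1) (hST : S * T = 1) : S ∈ symmetricOperators B H := by
  have h1 : ∀ v, T (S v) = v := fun v => congrArg (fun k : V →L[ℂ] V => k v) hTS
  have h2 : ∀ v, S (T v) = v := fun v => congrArg (fun k : V →L[ℂ] V => k v) hST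
  refine ⟨fun v w => ?_, fun h hh v => ?_⟩
  · conv_lhs => rw [← h1 w]
    rw [← hT.1, h1]
  · conv_lhs => rw [← h1 v]
    rw [← hT.2 h hh, h2]

end SymmetricOperators

namespace GeneralizedQuiver

variable {EX : Type*} [NormedAddCommGroup EX] [NormedSpace ℂ EX]
  {X : Type v} [TopologicalSpace X] [ChartedSpace EX X]
  {V : Type u} [NormedAddCommGroup V] [NormedSpace ℂ V] [FiniteDimensional ℂ V]
  {B : LinearMap.BilinForm ℂ V} {Q : GeneralizedQuiver.{u} B} {hB : B.Nondegenerate} {ε : ℂ}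
  (W : OrthVertexBundle EX X (Q.symmetricQuiver hB) ε Q.space)

/-! ### Gram operators of frames -/

/-- The bilinear form on `V` obtained by transport along a frame. -/
def gram {x : X} (c : ∀ χ : Q.Weight, Q.space χ ≃ₗ[ℂ] (W.bdl χ).Fib x) :
    LinearMap.BilinForm ℂ V :=
  ∑ χ : Q.Weight, ∑ μ : Q.Weight,
    (W.g x χ μ).compl₁₂ ((c χ).toLinearMap ∘ₗ Q.proj χ) ((c μ).toLinearMap ∘ₗ Q.proj μ)

variable {W}

theorem gram_apply {x : X} (c : ∀ χ : Q.Weight, Q.space χ ≃ₗ[ℂ] (W.bdl χ).Fib x) (v w : V) :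
    gram W c v w = ∑ χ : Q.Weight, ∑ μ : Q.Weight,
      W.g x χ μ (c χ (Q.proj χ v)) (c μ (Q.proj μ w)) := by
  simp only [gram, LinearMap.sum_apply]
  rfl

theorem gram_coe {x : X} (c : ∀ χ : Q.Weight, Q.space χ ≃ₗ[ℂ] (W.bdl χ).Fib x) (χ μ : Q.Weight)
    (v : Q.space χ) (w : Q.space μ) : gram W c v w = W.g x χ μ (c χ v) (c μ w) := by
  rw [gram_apply, Finset.sum_eq_single χ, Finset.sum_eq_single μ, proj_coe, proj_coe]
  · intro ν _ hν
    rw [Q.proj_of_ne hν.symm w.2, map_zero, map_zero]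
  · intro h
    exact absurd (Finset.mem_univ _) h
  · intro ν _ hν
    refine Finset.sum_eq_zero fun κ _ => ?_
    rw [Q.proj_of_ne hν.symm v.2, map_zero, map_zero, LinearMap.zero_apply]
  · intro h
    exact absurd (Finset.mem_univ _) h

theorem gram_symm {x : X} (c : ∀ χ : Q.Weight, Q.space χ ≃ₗ[ℂ] (W.bdl χ).Fib x) (v w : V) :
    gram W c v w = ε * gram W c w v := by
  rw [gram_apply, gram_apply, Finset.sum_comm, Finset.mul_sum]
  refine Finset.sum_congr rfl fun χ _ => ?_
  rw [Finset.mul_sum]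
  exact Finset.sum_congr rfl fun μ _ => (W.g_form x).symm _ _ _ _

theorem gram_invariant {x : X} (c : ∀ χ : Q.Weight, Q.space χ ≃ₗ[ℂ] (W.bdl χ).Fib x)
    {h : V ≃ₗ[ℂ] V} (hh : h ∈ Q.H) (v w : V) : gram W c (h v) (h w) = gram W c v w := by
  have key : (gram W c).compl₁₂ (h : V →ₗ[ℂ] V) (h : V →ₗ[ℂ] V) = gram W c := by
    refine ext_weight (Q := Q) fun χ v hv => ?_
    refine ext_weight (Q := Q) fun μ w hw => ?_
    change gram W c (h v) (h w) = gram W c v w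
    rw [hv ⟨h, hh⟩, hw ⟨h, hh⟩, map_smul, map_smul, LinearMap.smul_apply, smul_eq_mul, smul_eq_mul]
    lift v to Q.space χ using hv
    lift w to Q.space μ using hw
    rw [gram_coe]
    by_cases hμ : μ = Q.inv hB χ
    · subst hμ
      have e : (Q.inv hB χ).1 ⟨h, hh⟩ = (χ.1 ⟨h, hh⟩)⁻¹ := rfl
      rw [e, ← mul_assoc]
      simp
    · rw [show W.g x χ μ = 0 from (W.g_form x).eq_zero χ μ hμ]
      simp
  exact LinearMap.congr_fun₂ key v w

theorem gram_nondegenerate {x : X} (c : ∀ χ : Q.Weight, Q.space χ ≃ₗ[ℂ] (W.bdl χ).Fib x) {v : V}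
    (hv : ∀ w, gram W c v w = 0) : v = 0 := by
  rw [← Q.sum_proj v]
  refine Finset.sum_eq_zero fun χ _ => ?_
  have : c χ (Q.proj χ v) = 0 := by
    refine (W.g_form x).nondegenerate χ _ fun y => ?_
    have h := hv ((c (Q.inv hB χ)).symm y : Q.space (Q.inv hB χ))
    rw [gram_apply, Finset.sum_eq_single χ, Finset.sum_eq_single (Q.inv hB χ), proj_coe] at h
    · exact (congrArg (W.g x χ (Q.inv hB χ) _) ((c (Q.inv hB χ)).apply_symm_apply y)).symm.trans h
    · intro μ _ hμ
      rw [show W.g x χ μ = 0 from (W.g_form x).eq_zero χ μ hμ]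
      rfl
    · intro h
      exact absurd (Finset.mem_univ _) h
    · intro ν _ hν
      rw [Finset.sum_eq_single (Q.inv hB χ)]
      · rw [show W.g x ν (Q.inv hB χ) = 0 from (W.g_form x).eq_zero ν _ fun h => hν ?_]
        · rfl
        · exact (Q.inv_inv hB ν).symm.trans ((congrArg (Q.inv hB) h.symm).trans (Q.inv_inv hB χ))
      · intro κ _ hκ
        rw [Q.proj_of_ne hκ.symm (Subtype.property _), map_zero, map_zero]
      · intro h
        exact absurd (Finset.mem_univ _) h
    · intro h
      exact absurd (Finset.mem_univ _) h
  rw [(c χ).map_eq_zero_iff.1 this]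
  rfl

/-- The operator relating the form transported along a frame with the form of `V`. -/
def gramOperator {x : X} (c : ∀ χ : Q.Weight, Q.space χ ≃ₗ[ℂ] (W.bdl χ).Fib x) : V →L[ℂ] V :=
  LinearMap.toContinuousLinearMap ((B.toDual hB).symm.toLinearMap ∘ₗ gram W c)

theorem form_gramOperator {x : X} (c : ∀ χ : Q.Weight, Q.space χ ≃ₗ[ℂ] (W.bdl χ).Fib x) (v w : V) :
    B (gramOperator c v) w = gram W c v w :=
  LinearMap.BilinForm.apply_toDual_symm_apply (hB := hB) _ _

theorem gramOperator_mem_symmetricOperators (hsymm : ∀ x y, B x y = ε * B y x) {x : X}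
    (c : ∀ χ : Q.Weight, Q.space χ ≃ₗ[ℂ] (W.bdl χ).Fib x) :
    gramOperator c ∈ symmetricOperators B Q.H := by
  constructor
  · intro v w
    rw [form_gramOperator, gram_symm, hsymm, form_gramOperator]
  · intro h hh v
    refine sub_eq_zero.1 (hB.1 _ fun w => ?_)
    obtain ⟨w, rfl⟩ := h.surjective w
    rw [map_sub, LinearMap.sub_apply, form_gramOperator, gram_invariant c hh, Q.H_le hh,
      form_gramOperator, sub_self]

theorem isUnit_gramOperator {x : X} (c : ∀ χ : Q.Weight, Q.space χ ≃ₗ[ℂ] (W.bdl χ).Fib x) :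
    IsUnit (gramOperator c) := by
  have hinj : Function.Injective (gramOperator c).toLinearMap := by
    rw [← LinearMap.ker_eq_bot, LinearMap.ker_eq_bot']
    intro v hv
    refine gram_nondegenerate c fun w => ?_
    rw [← form_gramOperator]
    exact (congrArg (fun y => B y w) hv).trans (by simp)
  let e := (LinearEquiv.ofInjectiveEndo _ hinj).toContinuousLinearEquiv
  refine ⟨ContinuousLinearEquiv.toUnit e, ?_⟩
  ext v
  rfl

theorem gramOperator_eq_one {x : X} {c : ∀ χ : Q.Weight, Q.space χ ≃ₗ[ℂ] (W.bdl χ).Fib x}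
    (hc : IsIsometricFrame W x c) : gramOperator c = 1 := by
  have hg : gram W c = B := by
    refine ext_weight (Q := Q) fun χ v hv => ?_
    refine ext_weight (Q := Q) fun μ w hw => ?_
    lift v to Q.space χ using hv
    lift w to Q.space μ using hw
    rw [gram_coe, hc]
    rfl
  ext v
  refine sub_eq_zero.1 (hB.1 _ fun w => ?_)
  rw [map_sub, LinearMap.sub_apply, form_gramOperator, hg]
  exact sub_self _

/-- A frame becomes isometric after composition with a symmetric square root of the inverse of
its Gram operator. -/
theorem exists_isometric_of_sqrt {x : X} (c : ∀ χ : Q.Weight, Q.space χ ≃ₗ[ℂ] (W.bdl χ).Fib x)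
    {P : V →L[ℂ] V} (hP : P ∈ symmetricOperators B Q.H)
    (hPS : P * P = Ring.inverse (gramOperator c)) :
    ∃ c' : ∀ χ : Q.Weight, Q.space χ ≃ₗ[ℂ] (W.bdl χ).Fib x, IsIsometricFrame W x c' ∧
      ∀ χ v, c' χ v = c χ (Q.proj χ (P v)) := by
  have hu := isUnit_gramOperator c
  have h1 : P * P * gramOperator c = 1 := by rw [hPS, Ring.inverse_mul_cancel _ hu]
  have h2 : gramOperator c * (P * P) = 1 := by rw [hPS, Ring.mul_inverse_cancel _ hu]
  -- Derived from P²S = 1 = SP², without assuming that P and S commute. Since P is symmetric, B(SPv,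
  -- Pw) = B(PSPv, w) = B(v, w), so the new frame is isometric.
  have h3 : P * gramOperator c * P = 1 := by
    calc P * gramOperator c * P = P * gramOperator c * P * (P * P * gramOperator c) := by
          rw [h1, mul_one]
      _ = P * (gramOperator c * (P * P)) * (P * gramOperator c) := by noncomm_ring
      _ = 1 := by rw [h2, mul_one, ← mul_assoc, h1]
  have h4 : ∀ v, P (gramOperator c (P v)) = v := fun v =>
    congrArg (fun k : V →L[ℂ] V => k v) h3
  have hmem : ∀ (χ : Q.Weight) v, v ∈ weightSpace χ.1 → P v ∈ weightSpace χ.1 := by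
    intro χ v hv h
    rw [← hP.2 h h.2, hv h, map_smul]
  let a : ∀ χ : Q.Weight, Q.space χ ≃ₗ[ℂ] Q.space χ := fun χ =>
    LinearEquiv.ofInjectiveEndo (P.toLinearMap.restrict (hmem χ)) (by
      intro v w hvw
      have hvw' : P v = P w := congrArg Subtype.val hvw
      apply Subtype.ext
      rw [← h4 v, ← h4 w]
      rw [hvw'])
  have ha : ∀ χ v, (a χ v : V) = P v := fun χ v => rfl
  refine ⟨fun χ => (a χ).trans (c χ), fun χ μ v w => ?_, fun χ v => ?_⟩
  · rw [LinearEquiv.trans_apply, LinearEquiv.trans_apply, ← gram_coe, ← form_gramOperator, ha, ha,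
      ← hP.1, h4]
    rfl
  · rw [LinearEquiv.trans_apply, ← ha, proj_coe]

theorem ringInverse_gramOperator_mem (hsymm : ∀ x y, B x y = ε * B y x) {x : X}
    (c : ∀ χ : Q.Weight, Q.space χ ≃ₗ[ℂ] (W.bdl χ).Fib x) :
    Ring.inverse (gramOperator c) ∈ symmetricOperators B Q.H :=
  mem_symmetricOperators_of_mul_eq_one (gramOperator_mem_symmetricOperators hsymm c)
    (Ring.mul_inverse_cancel _ (isUnit_gramOperator c))
    (Ring.inverse_mul_cancel _ (isUnit_gramOperator c))

/-- At a single point, S⁻¹ has a square root that is a polynomial in S⁻¹, hence still symmetric and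
commuting with H. -/
theorem exists_isIsometricFrame (hsymm : ∀ x y, B x y = ε * B y x)
    (W : OrthVertexBundle EX X (Q.symmetricQuiver hB) ε Q.space) (x : X) :
    ∃ c, IsIsometricFrame W x c := by
  let c : ∀ χ : Q.Weight, Q.space χ ≃ₗ[ℂ] (W.bdl χ).Fib x := fun χ =>
    ((W.bdl χ).exists_isFrameOn x).choose_spec.2.2.choose x
  obtain ⟨p, hp⟩ := (isUnit_gramOperator c).ringInverse.exists_aeval_sq_eq
  obtain ⟨c', hc', -⟩ := exists_isometric_of_sqrt c
    (aeval_mem_symmetricOperators (ringInverse_gramOperator_mem hsymm c) p) ((sq _).symm.trans hp)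
  exact ⟨c', hc'⟩

/-- Orthogonal vertex bundles have local holomorphic isometric frames. -/
theorem exists_local_isometricFrame (hsymm : ∀ x y, B x y = ε * B y x)
    (W : OrthVertexBundle EX X (Q.symmetricQuiver hB) ε Q.space) (x₀ : X) :
    ∃ U, IsOpen U ∧ x₀ ∈ U ∧ ∃ c : ∀ x, ∀ χ : Q.Weight, Q.space χ ≃ₗ[ℂ] (W.bdl χ).Fib x,
      (∀ x, IsIsometricFrame W x (c x)) ∧
      ∀ (χ : Q.Weight) v, (W.bdl χ).IsHolOn U fun x => c x χ v := by
  classical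
  choose U hU hxU f hf using fun χ : Q.Weight => (W.bdl χ).exists_isFrameOn x₀
  obtain ⟨c₀, hc₀⟩ := exists_isIsometricFrame hsymm W x₀
  let O : Set X := ⋂ χ, U χ
  have hO : IsOpen O := isOpen_iInter_of_finite hU
  have hxO : x₀ ∈ O := Set.mem_iInter.2 hxU
  -- The isometric frame at x₀ is spread out as constant in local trivializations. Its Gram operator
  -- is then holomorphic and equals 1 at x₀, the centre of the analytic square root.
  let c : ∀ x, ∀ χ : Q.Weight, Q.space χ ≃ₗ[ℂ] (W.bdl χ).Fib x := fun x χ =>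
    ((c₀ χ).trans (f χ x₀).symm).trans (f χ x)
  have hcx₀ : c x₀ = c₀ := by
    funext χ
    ext v
    exact (f χ x₀).apply_symm_apply _
  have hc : ∀ U' ⊆ O, IsOpen U' → ∀ (χ : Q.Weight) (t : X → Q.space χ), HolOn EX U' t →
      (W.bdl χ).IsHolOn U' fun x => c x χ (t x) := fun U' hU' ho χ t ht =>
    ((hf χ).mono (hU'.trans (Set.iInter_subset _ χ))).isHolOn_apply ho
      (ht.linear ((c₀ χ).trans (f χ x₀).symm).toLinearMap)
  have hS : HolOn EX O fun x => gramOperator (c x) := by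
    refine HolOn.of_apply fun v => HolOn.of_pairing B (fun y hy => hB.1 y hy) fun w => ?_
    refine HolOn.congr (f := fun x => ∑ χ : Q.Weight, ∑ μ : Q.Weight,
      W.g x χ μ (c x χ (Q.proj χ v)) (c x μ (Q.proj μ w))) ?_ fun x _ => ?_
    · refine HolOn.sum fun χ _ => HolOn.sum fun μ _ => ?_
      exact W.g_hol O χ μ _ _ hO (hc O subset_rfl hO χ _ (holOn_const _))
        (hc O subset_rfl hO μ _ (holOn_const _))
    · rw [form_gramOperator, gram_apply]
  have hS' : HolOn EX O fun x => Ring.inverse (gramOperator (c x)) :=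
    hS.comp_contDiffAt fun x _ => by
      obtain ⟨s, hs⟩ := isUnit_gramOperator (c x)
      rw [← hs]
      exact contDiffAt_ringInverse ℂ s
  obtain ⟨r, hr, hr1, hrK, hrsq⟩ := exists_analytic_sqrt (symmetricOperators B Q.H)
    one_mem_symmetricOperators fun T hT => by
      rw [← sq]
      exact pow_mem_symmetricOperators hT 2
  -- On N the root is analytic and squares to its argument; U' is where the inverse Gram operator
  -- lies in N.
  obtain ⟨N, hN, hNo, h1N⟩ := eventually_nhds_iff.1 ((hr.eventually (by simp)).and hrsq)
  let U' := O ∩ (fun x => Ring.inverse (gramOperator (c x))) ⁻¹' N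
  have hU' : IsOpen U' := (ContMDiffOn.continuousOn hS').isOpen_inter_preimage hO hNo
  have hx₀ : x₀ ∈ U' := by
    refine ⟨hxO, ?_⟩
    change Ring.inverse (gramOperator (c x₀)) ∈ N
    rw [hcx₀, gramOperator_eq_one hc₀, Ring.inverse_one]
    exact h1N
  have hP : HolOn EX U' fun x => r (Ring.inverse (gramOperator (c x))) :=
    (hS'.mono Set.inter_subset_left).comp_contDiffAt fun x hx => (hN _ hx.2).1
  choose c' hc' hc'c using fun x (hx : x ∈ U') => exists_isometric_of_sqrt (c x) (hrK _)
    ((hN _ hx.2).2 (ringInverse_gramOperator_mem hsymm (c x)))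
  -- Sections in an atlas are total, so outside U' some isometric frame must be supplied; its
  -- regularity is irrelevant.
  choose d hd using exists_isIsometricFrame hsymm W
  refine ⟨U', hU', hx₀, fun x => if hx : x ∈ U' then c' x hx else d x, fun x => ?_, fun χ v => ?_⟩
  · by_cases hx : x ∈ U'
    · simp only [dif_pos hx]
      exact hc' x hx
    · simp only [dif_neg hx]
      exact hd x
  · refine (hc U' Set.inter_subset_left hU' χ
      (fun x => Q.proj χ (r (Ring.inverse (gramOperator (c x))) v)) ?_).congr fun x hx => ?_
    · exact (hP.clm (ContinuousLinearMap.apply ℂ V (v : V))).linear (Q.proj χ)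
    · simp only [dif_pos hx]
      exact hc'c x hx χ v

/-! ### The principal bundle of isometric frames -/

/-- The action of `R` on isometric frames. -/
def frameAct {x : X} (c : {c : ∀ χ : Q.Weight, Q.space χ ≃ₗ[ℂ] (W.bdl χ).Fib x //
    IsIsometricFrame W x c}) (r : Q.R) :
    {c : ∀ χ : Q.Weight, Q.space χ ≃ₗ[ℂ] (W.bdl χ).Fib x // IsIsometricFrame W x c} :=
  ⟨fun χ => (Q.actEquiv r χ).trans (c.1 χ), fun χ μ v w =>
    (c.2 χ μ _ _).trans (Q.form_act r χ μ v w)⟩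

/-- The principal `R`-bundle of isometric frames of an orthogonal vertex bundle. -/
def frameBundle (hsymm : ∀ x y, B x y = ε * B y x)
    (W : OrthVertexBundle EX X (Q.symmetricQuiver hB) ε Q.space) : HolPrincipalBundle EX X Q.R where
  Fib x := {c : ∀ χ : Q.Weight, Q.space χ ≃ₗ[ℂ] (W.bdl χ).Fib x // IsIsometricFrame W x c}
  act x c r := frameAct c r
  act_one x c := by
    refine Subtype.ext (funext fun χ => ?_)
    ext v
    rfl
  act_mul x c r s := by
    refine Subtype.ext (funext fun χ => ?_)
    ext v
    exact congrArg (c.1 χ) (Q.act_mul r s χ v)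
  torsor x c c' := by
    obtain ⟨r, hr⟩ := exists_act_of_isometric W c.2 c'.2
    refine ⟨r, Subtype.ext (funext fun χ => LinearEquiv.ext fun v => hr χ v), fun s hs => ?_⟩
    refine Q.R_ext fun χ v => (c.1 χ).injective ?_
    rw [hr]
    exact congrArg (fun k => k.1 χ v) hs
  -- All holomorphic isometric frames are admitted. Transition functions are coordinates of one
  -- frame in another, holomorphic by `isFrameOn_of_isometric`.
  atlas := {c | IsOpen c.1 ∧
    ∀ (χ : Q.Weight) v, (W.bdl χ).IsHolOn c.1 fun x => (c.2 x).1 χ v}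
  isOpen c hc := hc.1
  cover x := by
    obtain ⟨U, hU, hx, c, hc, hol⟩ := exists_local_isometricFrame hsymm W x
    exact ⟨⟨U, fun x => ⟨c x, hc x⟩⟩, ⟨hU, hol⟩, hx⟩
  transition c hc c' hc' y := by
    refine holOn_of_act (fun χ v => ?_) y
    have hf := isFrameOn_of_isometric W (fun x _ => (c.2 x).2) hc.2 χ
    refine ((hf _ Set.inter_subset_left (hc.1.inter hc'.1) _).1
      ((hc'.2 χ v).mono Set.inter_subset_right)).congr fun x _ => ?_
    rw [LinearEquiv.eq_symm_apply]
    have key : ∀ h : ∃! r, frameAct (c.2 x) r = c'.2 x,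
        (c.2 x).1 χ (Q.act h.choose χ v) = (c'.2 x).1 χ v := fun h =>
      congrArg (fun k => k.1 χ v) h.choose_spec.1
    exact key _

theorem exists_frameBundle (hsymm : ∀ x y, B x y = ε * B y x)
    (W : OrthVertexBundle EX X (Q.symmetricQuiver hB) ε Q.space) :
    ∃ E : HolPrincipalBundle EX X Q.R, Nonempty (Q.VertexIdentification E W) := by
  refine ⟨frameBundle hsymm W, ⟨{
    frame := fun x p => p.1
    equivariant := fun x p r χ v => rfl
    isometry := fun x p => p.2
    hol := fun U s hU hs χ v => ?_ }⟩⟩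
  refine HolVectorBundle.isHolOn_of_locally _ fun x hx => ?_
  obtain ⟨c, hc, hxc⟩ := (frameBundle hsymm W).cover x
  refine ⟨c.1, hc.1, hxc, ?_⟩
  have hf := isFrameOn_of_isometric W (fun x _ => (c.2 x).2) hc.2 χ
  refine ((hf.mono Set.inter_subset_right).isHolOn_apply (hU.inter hc.1)
    (holOn_act (hs c hc) χ v)).congr fun y _ => ?_
  exact (congrArg (fun k => k.1 χ v) ((frameBundle hsymm W).act_div (c.2 y) (s y))).symm

end GeneralizedQuiver

/-! ### Bijections from relations -/

/-- A relation which is functional in both directions is the graph of a bijection. -/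
theorem exists_equiv_of_existsUnique {α β : Sort*} (r : α → β → Prop) (h : ∀ a, ∃! b, r a b)
    (h' : ∀ b, ∃! a, r a b) : ∃ e : α ≃ β, ∀ a, r a (e a) := by
  choose F hF hFu using h
  choose G hG hGu using h'
  exact ⟨⟨F, G, fun a => (hGu _ a (hF a)).symm, fun b => (hFu _ b (hG b)).symm⟩, hF⟩

/-- The relation need not be functional: it is enough that it is total on both sides and matches `r`
with `s`. Reflexivity then shows that different partners of one element have the same class. -/
theorem exists_quot_equiv {α β : Sort*} {r : α → α → Prop} {s : β → β → Prop} (rel : α → β → Prop)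
    (hr : ∀ a, r a a) (hs : ∀ b, s b b) (hα : ∀ a, ∃ b, rel a b) (hβ : ∀ b, ∃ a, rel a b)
    (hrs : ∀ a b a' b', rel a b → rel a' b' → (r a a' ↔ s b b')) :
    ∃ e : Quot r ≃ Quot s, ∀ a b, rel a b → e (Quot.mk _ a) = Quot.mk _ b := by
  choose F hF using hα
  choose G hG using hβ
  refine ⟨⟨Quot.lift (fun a => Quot.mk _ (F a)) fun a a' h =>
    Quot.sound ((hrs _ _ _ _ (hF a) (hF a')).1 h),
    Quot.lift (fun b => Quot.mk _ (G b)) fun b b' h =>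
      Quot.sound ((hrs _ _ _ _ (hG b) (hG b')).2 h), ?_, ?_⟩, fun a b h => ?_⟩
  · rintro ⟨a⟩
    exact Quot.sound ((hrs _ _ _ _ (hG _) (hF a)).2 (hs _))
  · rintro ⟨b⟩
    exact Quot.sound ((hrs _ _ _ _ (hF _) (hG b)).1 (hr _))
  · exact Quot.sound ((hrs _ _ _ _ (hF a) h).1 (hr a))

/-- A map to a finite-dimensional space is holomorphic if its images under a jointly injective
family of linear maps are. -/
theorem HolOn.of_jointly_injective {EX : Type*} [NormedAddCommGroup EX] [NormedSpace ℂ EX]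
    {X : Type*} [TopologicalSpace X] [ChartedSpace EX X] {F : Type*} [NormedAddCommGroup F]
    [NormedSpace ℂ F] [FiniteDimensional ℂ F] {ι : Type*} {G : ι → Type*}
    [∀ i, NormedAddCommGroup (G i)] [∀ i, NormedSpace ℂ (G i)] [∀ i, FiniteDimensional ℂ (G i)]
    (L : ∀ i, F →ₗ[ℂ] G i) (hL : ∀ y, (∀ i, L i y = 0) → y = 0) {U : Set X} {f : X → F}
    (h : ∀ i, HolOn EX U fun x => L i (f x)) : HolOn EX U f := by
  -- The functionals l for which l ∘ f is holomorphic form a finite-dimensional space even if the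
  -- index set is infinite. It contains all pullbacks along the `L i`, so it separates points.
  let D : Submodule ℂ (Module.Dual ℂ F) :=
    { carrier := {l | HolOn EX U fun x => l (f x)}
      add_mem' := fun ha hb => HolOn.add ha hb
      zero_mem' := holOn_const 0
      smul_mem' := fun c _ hl => HolOn.smul (holOn_const c) hl }
  refine HolOn.of_pairing (G := D) D.subtype.flip (fun y hy => hL y fun i => ?_) fun l => l.2
  exact (Module.forall_dual_apply_eq_zero_iff ℂ _).1 fun m =>
    hy ⟨m ∘ₗ L i, (h i).linear m⟩

namespace GeneralizedQuiver

variable {EX : Type*} [NormedAddCommGroup EX] [NormedSpace ℂ EX]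
  {X : Type v} [TopologicalSpace X] [ChartedSpace EX X]
  {V : Type u} [NormedAddCommGroup V] [NormedSpace ℂ V]
  {B : LinearMap.BilinForm ℂ V} {Q : GeneralizedQuiver.{u} B} {hB : B.Nondegenerate} {ε : ℂ}
  {E E' : HolPrincipalBundle EX X Q.R}
  {W W' : OrthVertexBundle EX X (Q.symmetricQuiver hB) ε Q.space}

/-! ### Isomorphisms -/

theorem principalIso_ext {k k' : E.Iso E'} (h : ∀ x p, k.toFun x p = k'.toFun x p) : k = k' := by
  cases k
  cases k'
  congr
  funext x p
  exact h x p

theorem vertexIso_ext {l l' : W.Iso W'} (h : ∀ x (χ : Q.Weight) v, l.toFun x χ v = l'.toFun x χ v) :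
    l = l' := by
  cases l
  cases l'
  congr
  funext x χ
  ext v
  exact h x χ v

theorem fib_nonempty (E : HolPrincipalBundle EX X Q.R) (x : X) : Nonempty (E.Fib x) :=
  ⟨(E.cover x).choose.2 x⟩

variable [FiniteDimensional ℂ V]

/-- l is the frame of k(p) composed with the inverse of the frame of p; equivariance makes this
independent of p. -/
theorem existsUnique_vertexIso (u : Q.VertexIdentification E W) (u' : Q.VertexIdentification E' W')
    (k : E.Iso E') : ∃! l : W.Iso W', ∀ x p (χ : Q.Weight) v,
      l.toFun x χ (u.frame x p χ v) = u'.frame x (k.toFun x p) χ v := by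
  have b : ∀ x, E.Fib x := fun x => (fib_nonempty E x).some
  let l : ∀ x, ∀ χ : Q.Weight, (W.bdl χ).Fib x ≃ₗ[ℂ] (W'.bdl χ).Fib x := fun x χ =>
    (u.frame x (b x) χ).symm.trans (u'.frame x (k.toFun x (b x)) χ)
  have hl : ∀ x p (χ : Q.Weight) v,
      l x χ (u.frame x p χ v) = u'.frame x (k.toFun x p) χ v := by
    intro x p χ v
    have h1 : u.frame x p χ v = u.frame x (b x) χ (Q.act (E.div (b x) p) χ v) := by
      rw [← u.equivariant, E.act_div]
    have h2 : u'.frame x (k.toFun x p) χ v =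
        u'.frame x (k.toFun x (b x)) χ (Q.act (E.div (b x) p) χ v) := by
      rw [← u'.equivariant, ← k.equivariant, E.act_div]
    rw [h1, h2]
    exact congrArg (u'.frame x (k.toFun x (b x)) χ) ((u.frame x (b x) χ).symm_apply_apply _)
  have huniq : ∀ l' : W.Iso W', (∀ x p (χ : Q.Weight) v,
      l'.toFun x χ (u.frame x p χ v) = u'.frame x (k.toFun x p) χ v) →
      ∀ x (χ : Q.Weight) v, l'.toFun x χ v = l x χ v := by
    intro l' hl' x χ v
    obtain ⟨w, hw⟩ := (u.frame x (b x) χ).surjective v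
    rw [← hw, hl]
    exact hl' x (b x) χ w
  refine ⟨⟨l, fun x χ μ v w => ?_, fun U χ s hU => ?_⟩, hl, fun l' hl' => vertexIso_ext
    (huniq l' hl')⟩
  · obtain ⟨v, rfl⟩ := (u.frame x (b x) χ).surjective v
    obtain ⟨w, rfl⟩ := (u.frame x (b x) μ).surjective w
    refine (congrArg₂ (fun a b => W'.g x χ μ a b) (hl x _ χ v) (hl x _ μ w)).trans ?_
    exact (u'.isometry x _ χ μ v w).trans (u.isometry x _ χ μ v w).symm
  -- A section and its image under l have equal coordinates in the frames of an atlas section and of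
  -- its image under k.
  · have key : ∀ c ∈ E.atlas, (W'.bdl χ).IsHolOn (U ∩ c.1) (fun x => l x χ (s x)) ↔
        (W.bdl χ).IsHolOn (U ∩ c.1) s := by
      intro c hc
      have hf := u.isFrameOn (E.isOpen c hc) (E.isHolOn_atlas hc) χ
      have hf' := u'.isFrameOn (E.isOpen c hc)
        ((k.hol _ _ (E.isOpen c hc)).2 (E.isHolOn_atlas hc)) χ
      rw [hf _ Set.inter_subset_right (hU.inter (E.isOpen c hc)),
        hf' _ Set.inter_subset_right (hU.inter (E.isOpen c hc))]
      refine HolOn.congr_iff fun x _ => ?_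
      rw [LinearEquiv.symm_apply_eq]
      exact (congrArg (l x χ) ((u.frame x (c.2 x) χ).apply_symm_apply (s x)).symm).trans
        (hl x _ χ _)
    refine ⟨fun h => HolVectorBundle.isHolOn_of_locally _ fun x hx => ?_,
      fun h => HolVectorBundle.isHolOn_of_locally _ fun x hx => ?_⟩
    · obtain ⟨c, hc, hxc⟩ := E.cover x
      exact ⟨c.1, E.isOpen c hc, hxc, (key c hc).1 (h.mono Set.inter_subset_left)⟩
    · obtain ⟨c, hc, hxc⟩ := E.cover x
      exact ⟨c.1, E.isOpen c hc, hxc, (key c hc).2 (h.mono Set.inter_subset_left)⟩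

/-- l carries isometric frames to isometric frames, and through u' the fibre of E' is the set of all
isometric frames. -/
theorem existsUnique_principalIso (u : Q.VertexIdentification E W)
    (u' : Q.VertexIdentification E' W') (l : W.Iso W') : ∃! k : E.Iso E', ∀ x p (χ : Q.Weight) v,
      l.toFun x χ (u.frame x p χ v) = u'.frame x (k.toFun x p) χ v := by
  have hex : ∀ x (p : E.Fib x), ∃ p' : E'.Fib x, ∀ (χ : Q.Weight) v,
      u'.frame x p' χ v = l.toFun x χ (u.frame x p χ v) := fun x p =>
    u'.exists_frame_eq (fib_nonempty E' x)
      (c := fun χ => (u.frame x p χ).trans (l.toFun x χ)) fun χ μ v w =>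
        (l.isometry x χ μ _ _).trans (u.isometry x p χ μ v w)
  choose k hk using hex
  refine ⟨⟨k, fun x p r => u'.frame_injective fun χ v => ?_, fun U s hU => ?_⟩,
    fun x p χ v => (hk x p χ v).symm, fun k' hk' => principalIso_ext fun x p =>
      u'.frame_injective fun χ v => (hk' x p χ v).symm.trans (hk x p χ v).symm⟩
  · rw [hk, u'.equivariant, hk, u.equivariant]
  · rw [u.isHolOn_iff hU, u'.isHolOn_iff hU]
    refine forall_congr' fun χ => forall_congr' fun v => ?_
    rw [← l.hol U χ _ hU]
    simp only [hk]

/-! ### Sections -/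

variable {f : Q.ArrowMaps hB}

omit [FiniteDimensional ℂ V] in
/-- Families of linear maps to the spaces `Z α` agree if their images under `f` do. -/
theorem IsFiniteCorrespondence.ext_of_apply (hf : Q.IsFiniteCorrespondence hB f)
    {N : Q.A → Type*} [∀ α, AddCommGroup (N α)] [∀ α, Module ℂ (N α)]
    {φ φ' : ∀ α, N α →ₗ[ℂ] Q.Z α}
    (h : ∀ a n v, f a (φ (Q.label hB a) n) v = f a (φ' (Q.label hB a) n) v) (α : Q.A) (n : N α) :
    φ α n = φ' α n := by
  classical
  -- Injectivity is known only for the total map on ∏ Z_β, so it is tested on tuples supported at α.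
  have h1 := hf.bijective.injOn (x₁ := fun β => φ β (Pi.single α n β))
    (x₂ := fun β => φ' β (Pi.single α n β)) trivial trivial
    (funext fun a => LinearMap.ext fun v => h a _ v)
  have h2 := congrFun h1 α
  simpa using h2

omit [FiniteDimensional ℂ V] in
theorem IsFiniteCorrespondence.act_apply (hf : Q.IsFiniteCorrespondence hB f)
    (a : (Q.symmetricQuiver hB).Arrow) (r : Q.R) (z : Q.Z (Q.label hB a))
    (v : Q.space ((Q.symmetricQuiver hB).tail a)) :
    Q.act r _ (f a (Q.ρ _ r⁻¹ z) v) = f a z (Q.act r _ v) := by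
  rw [← hf.equivariant, ← Module.End.mul_apply, ← map_mul, mul_inv_cancel, map_one,
    Module.End.one_apply]

section Transport

variable {x : X} {c : ∀ χ : Q.Weight, Q.space χ ≃ₗ[ℂ] (W.bdl χ).Fib x}
  {ψ : ∀ a, Q.space ((Q.symmetricQuiver hB).tail a) →ₗ[ℂ] Q.space ((Q.symmetricQuiver hB).head a)}
  {ψ' : ∀ a, (W.bdl ((Q.symmetricQuiver hB).tail a)).Fib x →ₗ[ℂ]
    (W.bdl ((Q.symmetricQuiver hB).head a)).Fib x}

omit [FiniteDimensional ℂ V] in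
theorem isOrthogonalRep_iff_of_frame (hc : IsIsometricFrame W x c)
    (h : ∀ a v, ψ' a (c _ v) = c _ (ψ a v)) :
    (Q.symmetricQuiver hB).IsOrthogonalRep (W.g x) ψ' ↔
      (Q.symmetricQuiver hB).IsOrthogonalRep (W := Q.space) Q.form ψ := by
  have key : ∀ a (v : Q.space ((Q.symmetricQuiver hB).tail a))
      (w : Q.space ((Q.symmetricQuiver hB).tail ((Q.symmetricQuiver hB).σA a))),
      W.g x _ _ (ψ' a (c _ v)) (c _ w) + W.g x _ _ (c _ v) (ψ' _ (c _ w)) =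
      Q.form _ _ (ψ a v) w + Q.form _ _ v (ψ _ w) := by
    intro a v w
    rw [h, h]
    exact congrArg₂ (· + ·) (hc _ _ _ _) (hc _ _ _ _)
  refine ⟨fun H a v w => (key a v w).symm.trans (H a _ _), fun H a v w => ?_⟩
  obtain ⟨v, rfl⟩ := (c _).surjective v
  obtain ⟨w, rfl⟩ := (c _).surjective w
  exact (key a v w).trans (H a v w)

omit [FiniteDimensional ℂ V] in
theorem isTracelessOn_iff_of_frame (L : Set (Q.symmetricQuiver hB).Arrow)
    (h : ∀ a v, ψ' a (c _ v) = c _ (ψ a v)) :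
    (Q.symmetricQuiver hB).IsTracelessOn (W := fun i => (W.bdl i).Fib x) L ψ' ↔
      (Q.symmetricQuiver hB).IsTracelessOn (W := Q.space) L ψ := by
  refine forall_congr' fun a => forall_congr' fun _ => forall_congr' fun e => ?_
  exact Eq.congr_left (trace_cast_comp_conj (ι := (Q.symmetricQuiver hB).Vertex) (M := Q.space)
    (N := fun i => (W.bdl i).Fib x) c e (ψ a) (ψ' a) (h a))

end Transport

end GeneralizedQuiver

/-! ### The bijection between twisted sections and admissible families of morphisms -/

namespace GeneralizedQuiver

variable {EX : Type*} [NormedAddCommGroup EX] [NormedSpace ℂ EX]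
  {X : Type v} [TopologicalSpace X] [ChartedSpace EX X]
  {V : Type u} [NormedAddCommGroup V] [NormedSpace ℂ V]
  {B : LinearMap.BilinForm ℂ V} {Q : GeneralizedQuiver.{u} B} {hB : B.Nondegenerate} {ε : ℂ}
  {E E' : HolPrincipalBundle EX X Q.R}
  {W W' : OrthVertexBundle EX X (Q.symmetricQuiver hB) ε Q.space}
  {f : Q.ArrowMaps hB}
  {MF : Q.A → Type*} [∀ α, NormedAddCommGroup (MF α)] [∀ α, NormedSpace ℂ (MF α)]
  {M : ∀ α, HolVectorBundle EX X (MF α)}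

theorem twistedSection_ext {φ φ' : Q.TwistedSection E M}
    (h : ∀ x p m α n, φ.φ x p m α n = φ'.φ x p m α n) : φ = φ' := by
  cases φ
  cases φ'
  congr
  funext x p m α
  ext n
  exact h x p m α n

theorem orthMorphisms_ext {Ψ Ψ' : W.OrthMorphisms M (Q.label hB)}
    (h : ∀ x a v n, Ψ.ψ x a v n = Ψ'.ψ x a v n) : Ψ = Ψ' := by
  cases Ψ
  cases Ψ'
  congr
  funext x a
  ext v n
  exact h x a v n

/-- Local holomorphic frames of the twisting bundles. -/
theorem exists_isFrameOn_twisting (M : ∀ α, HolVectorBundle EX X (MF α)) (x₀ : X) :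
    ∃ U, IsOpen U ∧ x₀ ∈ U ∧ ∃ m : ∀ x α, MF α ≃ₗ[ℂ] (M α).Fib x,
      ∀ α, (M α).IsFrameOn U fun x => m x α := by
  have := Q.finite_A
  choose U hU hxU m hm using fun α => (M α).exists_isFrameOn x₀
  exact ⟨⋂ α, U α, isOpen_iInter_of_finite hU, Set.mem_iInter.2 hxU, fun x α => m α x,
    fun α => (hm α).mono (Set.iInter_subset _ α)⟩

theorem exists_frame_twisting (M : ∀ α, HolVectorBundle EX X (MF α)) (x : X) :
    Nonempty (∀ α, MF α ≃ₗ[ℂ] (M α).Fib x) := by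
  obtain ⟨U, -, -, m, -⟩ := exists_isFrameOn_twisting (Q := Q) M x
  exact ⟨m x⟩

/-- The correspondence of sections and morphisms intertwines the actions of isomorphisms. -/
theorem carriedBy_iff_carries (hf : Q.IsFiniteCorrespondence hB f)
    {u : Q.VertexIdentification E W} {u' : Q.VertexIdentification E' W'} {k : E.Iso E'}
    {l : W.Iso W'} (hkl : ∀ x p (χ : Q.Weight) v,
      l.toFun x χ (u.frame x p χ v) = u'.frame x (k.toFun x p) χ v)
    {φ : Q.TwistedSection E M} {φ' : Q.TwistedSection E' M}
    {Ψ : W.OrthMorphisms M (Q.label hB)} {Ψ' : W'.OrthMorphisms M (Q.label hB)}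
    (h : u.Corresponds f φ Ψ) (h' : u'.Corresponds f φ' Ψ') :
    φ.CarriedBy k φ' ↔ l.Carries Ψ Ψ' := by
  constructor
  · intro hk x a v n
    obtain ⟨p⟩ := fib_nonempty E x
    obtain ⟨m⟩ := exists_frame_twisting (Q := Q) M x
    obtain ⟨v, rfl⟩ := (u.frame x p _).surjective v
    obtain ⟨n, rfl⟩ := (m _).surjective n
    rw [h x p m a n v]
    refine (congrArg (fun y => Ψ'.ψ x a y (m _ n)) (hkl x p _ v)).trans ?_
    refine Eq.trans ?_ (hkl x p _ _).symm
    rw [h' x (k.toFun x p) m a n v, hk x p m]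
  · intro hl x p m
    funext α
    ext n
    refine hf.ext_of_apply (fun a n v => ?_) α n
    refine (u'.frame x (k.toFun x p) _).injective ?_
    rw [← h' x (k.toFun x p) m a n v]
    refine Eq.trans ?_ (hkl x p _ _)
    rw [← h x p m a n v, ← hl x a]
    exact congrArg (fun y => Ψ'.ψ x a y (m _ n)) (hkl x p _ v).symm

theorem TwistedBundle.isIsomorphic_refl (P : Q.TwistedBundle M) : P.IsIsomorphic P :=
  ⟨⟨fun _ p => p, fun _ _ _ => rfl, fun _ _ _ => Iff.rfl⟩, fun _ _ _ => rfl⟩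

theorem TwistedOrthBundle.isIsomorphic_refl (P : Q.TwistedOrthBundle hB ε M) : P.IsIsomorphic P :=
  ⟨⟨fun _ _ => LinearEquiv.refl ℂ _, fun _ _ _ _ _ => rfl, fun _ _ _ _ => Iff.rfl⟩,
    fun _ _ _ _ => rfl⟩

variable [FiniteDimensional ℂ V] [∀ α, FiniteDimensional ℂ (MF α)]

set_option maxHeartbeats 800000 in
/-- Sections correspond to unique morphisms. -/
theorem existsUnique_corresponds (hf : Q.IsFiniteCorrespondence hB f)
    (u : Q.VertexIdentification E W) (φ : Q.TwistedSection E M) :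
    ∃! Ψ : {Ψ : W.OrthMorphisms M (Q.label hB) // Ψ.IsTracelessOn (Q.irreducibleArrows hB)},
      u.Corresponds f φ Ψ.1 := by
  have b : ∀ x, E.Fib x := fun x => (fib_nonempty E x).some
  have m₀ : ∀ x α, MF α ≃ₗ[ℂ] (M α).Fib x := fun x => (exists_frame_twisting (Q := Q) M x).some
  -- ψ is defined with arbitrarily chosen frames `b` and `m₀`; `hψ` shows by equivariance that any
  -- other frames give the same map, so holomorphic local frames can be used below.
  let ψ : ∀ x a, (W.bdl ((Q.symmetricQuiver hB).tail a)).Fib x →ₗ[ℂ]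
      (M (Q.label hB a)).Fib x →ₗ[ℂ] (W.bdl ((Q.symmetricQuiver hB).head a)).Fib x := fun x a =>
    LinearMap.mk₂ ℂ (fun v n => u.frame x (b x) _ (f a (φ.φ x (b x) (m₀ x) _ ((m₀ x _).symm n))
      ((u.frame x (b x) _).symm v)))
      (fun v v' n => by simp only [map_add]) (fun c v n => by simp only [map_smul])
      (fun v n n' => by simp only [map_add, LinearMap.add_apply])
      (fun c v n => by simp only [map_smul, LinearMap.smul_apply])
  have hψ : ∀ x (p : E.Fib x) (m : ∀ α, MF α ≃ₗ[ℂ] (M α).Fib x) a (n : MF (Q.label hB a)) v,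
      ψ x a (u.frame x p _ v) (m _ n) = u.frame x p _ (f a (φ.φ x p m _ n) v) := by
    intro x p m a n v
    change u.frame x (b x) _ (f a (φ.φ x (b x) (m₀ x) _ ((m₀ x _).symm (m _ n)))
      ((u.frame x (b x) _).symm (u.frame x p _ v))) = _
    obtain ⟨r, rfl⟩ : ∃ r, p = E.act x (b x) r := ⟨_, (E.act_div _ _).symm⟩
    obtain ⟨k, rfl⟩ : ∃ k : ∀ α, MF α ≃ₗ[ℂ] MF α, m = fun α => (k α).trans (m₀ x α) :=
      ⟨fun α => (m α).trans (m₀ x α).symm, funext fun α => LinearEquiv.ext fun y =>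
        ((m₀ x α).apply_symm_apply _).symm⟩
    rw [φ.equivariant]
    refine Eq.trans ?_ (u.equivariant x (b x) r _ _).symm
    have h1 : (u.frame x (b x) _).symm (u.frame x (E.act x (b x) r) _ v) = Q.act r _ v :=
      (LinearEquiv.symm_apply_eq _).2 (u.equivariant x (b x) r _ v)
    rw [h1]
    refine congrArg (u.frame x (b x) _) (Eq.trans ?_ (hf.act_apply a r _ v).symm)
    rw [LinearEquiv.trans_apply, LinearEquiv.symm_apply_apply]
  have hrep : ∀ x (n : ∀ o, (M o).Fib x),
      ((Q.symmetricQuiver hB).IsOrthogonalRep (W.g x) fun a => (ψ x a).flip (n (Q.label hB a))) ∧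
      (Q.symmetricQuiver hB).IsTracelessOn (W := fun i => (W.bdl i).Fib x)
        (Q.irreducibleArrows hB) fun a => (ψ x a).flip (n (Q.label hB a)) := by
    intro x n
    let z : ∀ α, Q.Z α := fun α => φ.φ x (b x) (m₀ x) α ((m₀ x α).symm (n α))
    have hz : ∀ a v, (ψ x a).flip (n (Q.label hB a)) (u.frame x (b x) _ v) =
        u.frame x (b x) _ (f a (z (Q.label hB a)) v) := by
      intro a v
      rw [← hψ x (b x) (m₀ x) a, LinearEquiv.apply_symm_apply]
      rfl
    have hmem := hf.bijective.mapsTo (Set.mem_univ z)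
    exact ⟨(isOrthogonalRep_iff_of_frame (u.isIsometricFrame (b x)) hz).2 hmem.1,
      (isTracelessOn_iff_of_frame _ hz).2 hmem.2⟩
  have huniq : ∀ Ψ : W.OrthMorphisms M (Q.label hB), u.Corresponds f φ Ψ →
      ∀ x a v n, Ψ.ψ x a v n = ψ x a v n := by
    intro Ψ hΨ x a v n
    obtain ⟨v', hv⟩ := (u.frame x (b x) _).surjective v
    obtain ⟨n', hn⟩ := (m₀ x _).surjective n
    rw [← hv, ← hn, hψ]
    exact hΨ x (b x) (m₀ x) a n' v'
  refine ⟨⟨⟨ψ, fun U a s n hU hs hn => ?_, fun x n => (hrep x n).1⟩, fun x n => (hrep x n).2⟩, hψ,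
    fun Ψ' hΨ' => Subtype.ext (orthMorphisms_ext (huniq Ψ'.1 hΨ'))⟩
  · refine HolVectorBundle.isHolOn_of_locally _ fun x hx => ?_
    obtain ⟨c, hc, hxc⟩ := E.cover x
    obtain ⟨U', hU', hxU', m, hm⟩ := exists_isFrameOn_twisting (Q := Q) M x
    have hO : IsOpen (U ∩ (c.1 ∩ U')) := hU.inter ((E.isOpen c hc).inter hU')
    have hOU : U ∩ (c.1 ∩ U') ⊆ U := Set.inter_subset_left
    have hOc : U ∩ (c.1 ∩ U') ⊆ c.1 := fun _ h => h.2.1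
    have hOU' : U ∩ (c.1 ∩ U') ⊆ U' := fun _ h => h.2.2
    refine ⟨c.1 ∩ U', (E.isOpen c hc).inter hU', ⟨hxc, hxU'⟩, ?_⟩
    have hsc := E.isHolOn_atlas hc
    have hn' := (hm _ _ hOU' hO _).1 (hn.mono hOU)
    have hs' := (u.isFrameOn (E.isOpen c hc) hsc _ _ hOc hO _).1 (hs.mono hOU)
    -- The coordinates of the image are f_a(φ(n))(s), assembled from holomorphic coordinates of n
    -- and s and the holomorphic local expression of φ.
    have hz : HolOn EX (U ∩ (c.1 ∩ U')) fun y => φ.φ y (c.2 y) (m y) (Q.label hB a)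
        ((m y _).symm (n y)) :=
      HolOn.linear_apply (fun n₀ => φ.hol _ _ m hO (hsc.mono hOc) (fun α n₀ =>
        ((hm α).mono hOU').isHolOn_apply hO (holOn_const n₀)) _ n₀) hn'
    have hfz := HolOn.linear_apply (fun v => hz.linear ((f a).flip v)) hs'
    refine ((u.isFrameOn (E.isOpen c hc) hsc _).mono hOc |>.isHolOn_apply hO hfz).congr
      fun y _ => ?_
    refine Eq.trans ?_ (hψ y (c.2 y) (m y) a ((m y _).symm (n y))
      ((u.frame y (c.2 y) _).symm (s y)))
    rw [LinearEquiv.apply_symm_apply, LinearEquiv.apply_symm_apply]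

omit [∀ α, FiniteDimensional ℂ (MF α)] in
/-- Traceless morphisms correspond to unique sections. -/
theorem existsUnique_corresponds' (hf : Q.IsFiniteCorrespondence hB f)
    (u : Q.VertexIdentification E W)
    (Ψ : {Ψ : W.OrthMorphisms M (Q.label hB) // Ψ.IsTracelessOn (Q.irreducibleArrows hB)}) :
    ∃! φ : Q.TwistedSection E M, u.Corresponds f φ Ψ.1 := by
  classical
  have := Q.finite_A
  let _ := Fintype.ofFinite Q.A
  let F : (∀ α, Q.Z α) →ₗ[ℂ] ∀ a, (Q.space ((Q.symmetricQuiver hB).tail a) →ₗ[ℂ]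
      Q.space ((Q.symmetricQuiver hB).head a)) :=
    LinearMap.pi fun a => f a ∘ₗ LinearMap.proj (Q.label hB a)
  have hF : Function.Injective F := fun z z' h => hf.bijective.injOn trivial trivial h
  -- A linear left inverse of the map induced by f makes the reconstructed section linear in the
  -- twisting variable. It inverts exactly on the admissible representations.
  obtain ⟨L, hL⟩ := F.exists_leftInverse_of_injective (LinearMap.ker_eq_bot.2 hF)
  let A : ∀ x, E.Fib x → (∀ α, MF α ≃ₗ[ℂ] (M α).Fib x) → (∀ α, MF α) →ₗ[ℂ]
      ∀ a, (Q.space ((Q.symmetricQuiver hB).tail a) →ₗ[ℂ]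
        Q.space ((Q.symmetricQuiver hB).head a)) := fun x p m =>
    LinearMap.pi fun a => ((u.frame x p _).symm.arrowCongr (u.frame x p _).symm).toLinearMap ∘ₗ
      (Ψ.1.ψ x a).flip ∘ₗ (m _).toLinearMap ∘ₗ LinearMap.proj (Q.label hB a)
  have hA : ∀ x p m n a v, u.frame x p _ (A x p m n a v) =
      Ψ.1.ψ x a (u.frame x p _ v) (m _ (n (Q.label hB a))) := fun x p m n a v =>
    (u.frame x p _).apply_symm_apply _
  -- Orthogonality and tracelessness of Ψ, read in the frame p, put `A x p m n` in the range of F.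
  have hFL : ∀ x p m n, F (L (A x p m n)) = A x p m n := by
    intro x p m n
    have hA' : ∀ a v, (Ψ.1.ψ x a).flip (m _ (n (Q.label hB a))) (u.frame x p _ v) =
        u.frame x p _ (A x p m n a v) := fun a v => (hA x p m n a v).symm
    obtain ⟨z, -, hz⟩ := hf.bijective.surjOn
      ⟨(isOrthogonalRep_iff_of_frame (u.isIsometricFrame p) hA').1
        (Ψ.1.orthogonal x fun α => m α (n α)),
      (isTracelessOn_iff_of_frame _ hA').1 (Ψ.2 x fun α => m α (n α))⟩
    have hz' : F z = A x p m n := hz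
    rw [← hz', ← LinearMap.comp_apply L F, hL, LinearMap.id_apply]
  have key : ∀ x p m n a v, u.frame x p _ (f a (L (A x p m n) (Q.label hB a)) v) =
      Ψ.1.ψ x a (u.frame x p _ v) (m _ (n (Q.label hB a))) := by
    intro x p m n a v
    rw [← hA]
    exact congrArg (fun T => u.frame x p _ (T a v)) (hFL x p m n)
  let φ : ∀ x, E.Fib x → (∀ α, MF α ≃ₗ[ℂ] (M α).Fib x) → ∀ α, MF α →ₗ[ℂ] Q.Z α := fun x p m α =>
    LinearMap.proj α ∘ₗ L ∘ₗ A x p m ∘ₗ LinearMap.single ℂ MF α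
  have hφ : ∀ x p m α n, φ x p m α n = L (A x p m (Pi.single α n)) α := fun _ _ _ _ _ => rfl
  have hcor : ∀ x (p : E.Fib x) (m : ∀ α, MF α ≃ₗ[ℂ] (M α).Fib x) a (n : MF (Q.label hB a)) v,
      Ψ.1.ψ x a (u.frame x p _ v) (m _ n) = u.frame x p _ (f a (φ x p m _ n) v) := by
    intro x p m a n v
    rw [hφ, key, Pi.single_eq_same]
  have huniq : ∀ φ' : Q.TwistedSection E M, u.Corresponds f φ' Ψ.1 →
      ∀ x p m α n, φ'.φ x p m α n = φ x p m α n := by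
    intro φ' hφ' x p m
    refine hf.ext_of_apply fun a n v => (u.frame x p _).injective ?_
    exact (hφ' x p m a n v).symm.trans (hcor x p m a n v)
  refine ⟨⟨φ, fun x p m r k α n => ?_, fun U s m hU hs hm α n => ?_⟩, hcor, fun φ' hφ' =>
    twistedSection_ext (huniq φ' hφ')⟩
  · refine hf.ext_of_apply (N := MF) (φ := φ x (E.act x p r) fun β => (k β).trans (m β))
      (φ' := fun α => Q.ρ α r⁻¹ ∘ₗ φ x p m α ∘ₗ (k α).toLinearMap) (fun a n v => ?_) α n
    refine (u.frame x (E.act x p r) _).injective ?_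
    refine (hcor x (E.act x p r) (fun β => (k β).trans (m β)) a n v).symm.trans ?_
    refine Eq.trans ?_ (u.equivariant x p r _ _).symm
    refine Eq.trans ?_ (congrArg (u.frame x p _) (hf.act_apply a r _ v).symm)
    refine Eq.trans ?_ (hcor x p m a (k _ n) _)
    exact congrArg (fun y => Ψ.1.ψ x a y (m _ (k _ n))) (u.equivariant x p r _ v)
  · have hz : HolOn EX U fun x => L (A x (s x) (m x) (Pi.single α n)) := by
      -- Evaluations of f_a at vectors, over all arrows, separate the points of ∏ Z_α; each is a
      -- coordinate of ψ applied to holomorphic sections.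
      refine HolOn.of_jointly_injective (ι := Σ a, Q.space ((Q.symmetricQuiver hB).tail a))
        (G := fun i => Q.space ((Q.symmetricQuiver hB).head i.1))
        (fun i => (f i.1).flip i.2 ∘ₗ LinearMap.proj (Q.label hB i.1)) (fun z hz => ?_)
        fun i => ?_
      · refine hF ?_
        rw [map_zero]
        exact funext fun a => LinearMap.ext fun v => hz ⟨a, v⟩
      · obtain ⟨a, v⟩ := i
        refine ((u.isFrameOn hU hs _ U subset_rfl hU _).1 (Ψ.1.hol U a _ _ hU
          (u.hol U s hU hs _ v) (hm _ (Pi.single α n (Q.label hB a))))).congr fun x _ => ?_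
        rw [LinearEquiv.eq_symm_apply]
        exact key x (s x) (m x) _ a v
    exact hz.linear (LinearMap.proj α)

end GeneralizedQuiver

end

/-! ### Assembly of the correspondence -/

theorem mainTheorem4 {V : Type*} [NormedAddCommGroup V] [NormedSpace ℂ V] [FiniteDimensional ℂ V]
    (ε : ℂ) (hε : ε = 1 ∨ ε = -1) (B : LinearMap.BilinForm ℂ V) (hB : B.Nondegenerate)
    (hsymm : ∀ x y, B x y = ε * B y x) (Q : GeneralizedQuiver B) :
    -- the finite-dimensional correspondence
    ∃ f : Q.ArrowMaps hB, Q.IsFiniteCorrespondence hB f ∧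
    -- complex manifolds `X`, twisting bundles `M α`
    ∀ (EX : Type*) [NormedAddCommGroup EX] [NormedSpace ℂ EX] [FiniteDimensional ℂ EX]
      (X : Type*) [TopologicalSpace X] [ChartedSpace EX X] [IsManifold 𝓘(ℂ, EX) ω X]
      (MF : Q.A → Type*) [∀ α, NormedAddCommGroup (MF α)] [∀ α, NormedSpace ℂ (MF α)]
      [∀ α, FiniteDimensional ℂ (MF α)] (M : ∀ α, HolVectorBundle EX X (MF α)),
      -- principal `R`-bundles and orthogonal vertex bundles determine each other
      (∀ E : HolPrincipalBundle EX X Q.R,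
        ∃ W : OrthVertexBundle EX X (Q.symmetricQuiver hB) ε Q.space,
          Nonempty (Q.VertexIdentification E W)) ∧
      (∀ W : OrthVertexBundle EX X (Q.symmetricQuiver hB) ε Q.space,
        ∃ E : HolPrincipalBundle EX X Q.R, Nonempty (Q.VertexIdentification E W)) ∧
      -- the bijections on (gauge) isomorphisms and on sections, and equivariance
      (∀ (E E' : HolPrincipalBundle EX X Q.R)
        (W W' : OrthVertexBundle EX X (Q.symmetricQuiver hB) ε Q.space)
        (u : Q.VertexIdentification E W) (u' : Q.VertexIdentification E' W'),
        ∃ (Θ : E.Iso E' ≃ W.Iso W')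
          (Φ : Q.TwistedSection E M ≃
            {Ψ : W.OrthMorphisms M (Q.label hB) // Ψ.IsTracelessOn (Q.irreducibleArrows hB)})
          (Φ' : Q.TwistedSection E' M ≃
            {Ψ : W'.OrthMorphisms M (Q.label hB) // Ψ.IsTracelessOn (Q.irreducibleArrows hB)}),
          (∀ k x p χ v, (Θ k).toFun x χ (u.frame x p χ v) = u'.frame x (k.toFun x p) χ v) ∧
          (∀ φ, u.Corresponds f φ (Φ φ).1) ∧ (∀ φ', u'.Corresponds f φ' (Φ' φ').1) ∧
          ∀ k φ φ', φ.CarriedBy k φ' ↔ (Θ k).Carries (Φ φ).1 (Φ' φ').1) ∧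
      -- the bijection on isomorphism classes
      ∃ Λ : Quot (GeneralizedQuiver.TwistedBundle.IsIsomorphic (Q := Q) (M := M)) ≃
          Quot (GeneralizedQuiver.TwistedOrthBundle.IsIsomorphic (Q := Q) (hB := hB) (ε := ε)
            (M := M)),
        ∀ (P : Q.TwistedBundle M) (P' : Q.TwistedOrthBundle hB ε M)
          (u : Q.VertexIdentification P.E P'.W), u.Corresponds f P.φ P'.Ψ →
            Λ (Quot.mk _ P) = Quot.mk _ P' := by
  obtain ⟨f, hf⟩ := GeneralizedQuiver.exists_finiteCorrespondence hB hε hsymm Q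
  refine ⟨f, hf, ?_⟩
  intro EX _ _ _ X _ _ _ MF _ _ _ M
  have hW := GeneralizedQuiver.exists_associatedOrthBundle (EX := EX) (X := X) (Q := Q) hB hsymm
  have hE := GeneralizedQuiver.exists_frameBundle (EX := EX) (X := X) (Q := Q) (hB := hB) hsymm
  refine ⟨hW, hE, fun E E' W W' u u' => ?_, ?_⟩
  · obtain ⟨Θ, hΘ⟩ := exists_equiv_of_existsUnique
      (fun (k : E.Iso E') (l : W.Iso W') => ∀ x p χ v,
        l.toFun x χ (u.frame x p χ v) = u'.frame x (k.toFun x p) χ v)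
      (GeneralizedQuiver.existsUnique_vertexIso u u')
      (GeneralizedQuiver.existsUnique_principalIso u u')
    obtain ⟨Φ, hΦ⟩ := exists_equiv_of_existsUnique _
      (GeneralizedQuiver.existsUnique_corresponds (M := M) hf u)
      (GeneralizedQuiver.existsUnique_corresponds' hf u)
    obtain ⟨Φ', hΦ'⟩ := exists_equiv_of_existsUnique _
      (GeneralizedQuiver.existsUnique_corresponds (M := M) hf u')
      (GeneralizedQuiver.existsUnique_corresponds' hf u')
    exact ⟨Θ, Φ, Φ', hΘ, hΦ, hΦ', fun k φ φ' =>
      GeneralizedQuiver.carriedBy_iff_carries hf (hΘ k) (hΦ φ) (hΦ' φ')⟩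
  · obtain ⟨Λ, hΛ⟩ := exists_quot_equiv
      (r := GeneralizedQuiver.TwistedBundle.IsIsomorphic (Q := Q) (M := M))
      (s := GeneralizedQuiver.TwistedOrthBundle.IsIsomorphic (Q := Q) (hB := hB) (ε := ε) (M := M))
      -- Two objects are related if some identification matches φ with Ψ. This is total on both
      -- sides, and transporting isomorphisms along the identifications matches the two isomorphism
      -- relations.
      (fun P P' => ∃ u : Q.VertexIdentification P.E P'.W, u.Corresponds f P.φ P'.Ψ)
      (fun P => P.isIsomorphic_refl) (fun P => P.isIsomorphic_refl)
      (fun P => by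
        obtain ⟨W, ⟨u⟩⟩ := hW P.E
        obtain ⟨Ψ, hΨ, -⟩ := GeneralizedQuiver.existsUnique_corresponds hf u P.φ
        exact ⟨⟨W, Ψ.1, Ψ.2⟩, u, hΨ⟩)
      (fun P => by
        obtain ⟨E, ⟨u⟩⟩ := hE P.W
        obtain ⟨φ, hφ, -⟩ := GeneralizedQuiver.existsUnique_corresponds' hf u ⟨P.Ψ, P.traceless⟩
        exact ⟨⟨E, φ⟩, u, hφ⟩)
      (fun P P' P₁ P₁' ⟨u, hu⟩ ⟨u₁, hu₁⟩ => by
        constructor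
        · rintro ⟨k, hk⟩
          obtain ⟨l, hl, -⟩ := GeneralizedQuiver.existsUnique_vertexIso u u₁ k
          exact ⟨l, (GeneralizedQuiver.carriedBy_iff_carries hf hl hu hu₁).1 hk⟩
        · rintro ⟨l, hl⟩
          obtain ⟨k, hk, -⟩ := GeneralizedQuiver.existsUnique_principalIso u u₁ l
          exact ⟨k, (GeneralizedQuiver.carriedBy_iff_carries hf hk hu hu₁).2 hl⟩)
    exact ⟨Λ, fun P P' u h => hΛ P P' ⟨u, h⟩⟩
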